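/- Let $(M,0)$ be a germ of a complex manifold. A $(TE)$-structure over $(M,0)$ is a germ $H\to(\mathbb C,0)\times(M,0)$ of a holomorphic vector bundle (coordinate $z$ on $(\mathbb C,0)$) with a flat holomorphic connection $\nabla$ on $H|_{(\mathbb C^*,0)\times(M,0)}$ such that $$\nabla:\mathcal O(H)\to \tfrac1z\Big[\mathcal O_{\mathbb C\times M,0}\cdot\Omega^1_{M,0}+\mathcal O_{\mathbb C\times M,0}\cdot\tfrac{dz}{z}\Big]\otimes\mathcal O(H),$$ where $\mathcal O(H)$ is the $\mathcal O_{\mathbb C\times M,0}$-module of germs of holomorphic sections. Let $K_0$ be the fibre of $H$ at $(0,0)$. The operators $z\nabla_X$ ($X$ a vector field on $M$) and $z\nabla_{z\partial_z}$ induce endomorphisms $C_X$ ($X\in T_0M$) and $\mathcal U$ of $K_0$. The structure satisfies the generation condition (GC) if there is a $\zeta\in K_0$ which together with its images under iteration of $\mathcal U$ and the $C_X$, $X\in T_0M$, generates the vector space $K_0$. Let $w\in\mathbb Z$. A $(TEP(w))$-structure is a $(TE)$-structure with a $\nabla$-flat pairing $P:H_{(z,t)}\times H_{(-z,t)}\to\mathbb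 C$ for $(z,t)\in(\mathbb C^*\times M,0)$, which is $(-1)^w$-symmetric and such that $(a,b)\mapsto \big((z,t)\mapsto P(a(z,t),b(-z,t))\big)$ defines a nondegenerate $z$-sesquilinear pairing $P:\mathcal O(H)\times\mathcal O(H)\to z^w\mathcal O_{\mathbb C\times M,0}$. An unfolding of a $(TE)$-structure $(H,\nabla)$ over $(M,0)$ is a $(TE)$-structure $(\widetilde H,\widetilde\nabla)$ over $(M\times\mathbb C^l,0)$, for some $l\ge 0$, with an isomorphism $i$ from $(H,\nabla)$ to the restriction of $(\widetilde H,\widetilde\nabla)$ to $(M\times\{0\},0)$. **Lemma 3.2.** Let $(H,\nabla,P)$ be a $(TEP(w))$-structure over $(M,0)$ which satisfies (GC), and let $(\widetilde H,\widetilde\nabla,i)$ be an unfolding over $(M\times\mathbb C^l,0)$ of the underlying $(TE)$-structure. Then there is exactly one $\widetilde\nabla$-flat pairing $\widetilde P:\widetilde H_{(z,x)}\times\widetilde H_{(-z,x)}\to\mathbb C$, $(z,x)\in(\mathbb C^*\times M\times\mathbb C^l,0)$, which extends $P$ (via $i$), and $(\widetilde H,\widetilde\nabla,\widetilde P)$ is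 a $(TEP(w))$-structure; in particular $\widetilde P$ maps $\mathcal O(\widetilde H)\times\mathcal O(\widetilde H)$ to $z^w\mathcal O_{\mathbb C\times M\times\mathbb C^l,0}$. -/

import Mathlib

open Filter Topology

noncomputable section

namespace TEP

/-! ## Germs of holomorphic functions along a filter

For `l = 𝓝 0` these are the germs at the origin of holomorphic functions; for
`l = 𝓝[{z ≠ 0}] 0` they are the germs at the origin of functions that are holomorphic
on the complement of `{z = 0}` in a neighbourhood of the origin. -/

section Germs

variable {X Y : Type*} [NormedAddCommGroup X] [NormedSpace ℂ X]
  [NormedAddCommGroup Y] [NormedSpace ℂ Y]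

/-- A filter generated by open sets: what holds along the filter holds locally along it. -/
class OpenFilter (l : Filter X) : Prop where
  eventually_nhds : ∀ {p : X → Prop}, (∀ᶠ x in l, p x) → ∀ᶠ y in l, ∀ᶠ x in 𝓝 y, p x

instance (x : X) : OpenFilter (𝓝 x) := ⟨fun h => eventually_eventually_nhds.2 h⟩

/-- The ring of germs along `l` of holomorphic functions. -/
def HolGerm (l : Filter X) : Subring (Germ l ℂ) where
  carrier := {g | ∃ f : X → ℂ, (∀ᶠ x in l, AnalyticAt ℂ f x) ∧ (f : Germ l ℂ) = g}
  mul_mem' := by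
    rintro _ _ ⟨f, hf, rfl⟩ ⟨g, hg, rfl⟩
    exact ⟨f * g, (hf.and hg).mono fun x h => h.1.mul h.2, rfl⟩
  one_mem' := ⟨1, Eventually.of_forall fun _ => analyticAt_const, rfl⟩
  add_mem' := by
    rintro _ _ ⟨f, hf, rfl⟩ ⟨g, hg, rfl⟩
    exact ⟨f + g, (hf.and hg).mono fun x h => h.1.add h.2, rfl⟩
  zero_mem' := ⟨0, Eventually.of_forall fun _ => analyticAt_const, rfl⟩
  neg_mem' := by
    rintro _ ⟨f, hf, rfl⟩
    exact ⟨-f, hf.mono fun x h => h.neg, rfl⟩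

/-- The germ of a function that is holomorphic along `l`. -/
def HolGerm.of {l : Filter X} (f : X → ℂ) (hf : ∀ᶠ x in l, AnalyticAt ℂ f x) : HolGerm l :=
  ⟨(f : Germ l ℂ), f, hf, rfl⟩

/-- The germ of a constant function. -/
def HolGerm.const {l : Filter X} (c : ℂ) : HolGerm l :=
  HolGerm.of (fun _ => c) (Eventually.of_forall fun _ => analyticAt_const)

/-- The derivative of a holomorphic germ in the direction of the constant vector field `v`. -/
def HolGerm.deriv {l : Filter X} [hl : OpenFilter l] (v : X) (g : HolGerm l) : HolGerm l :=
  ⟨Germ.map' (fun (f : X → ℂ) (x : X) => fderiv ℂ f x v)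
      (fun _ _ h => (hl.eventually_nhds h).mono fun _ hx => by
        simp only [EventuallyEq.fderiv_eq hx]) g.1, by
    obtain ⟨_, f, hf, rfl⟩ := g
    exact ⟨fun x => fderiv ℂ f x v,
      hf.mono fun x h => (ContinuousLinearMap.apply ℂ ℂ v).analyticAt _ |>.comp h.fderiv, rfl⟩⟩

/-- Pullback of holomorphic germs along a (continuous) linear map. -/
def HolGerm.pullback {l : Filter X} {l' : Filter Y} (φ : X →L[ℂ] Y) (h : Tendsto φ l l') :
    HolGerm l' →+* HolGerm l where
  toFun g := ⟨g.1.compTendsto φ h, by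
    obtain ⟨_, f, hf, rfl⟩ := g
    exact ⟨f ∘ φ, (h.eventually hf).mono fun x hx => hx.comp (φ.analyticAt x), rfl⟩⟩
  map_one' := rfl
  map_zero' := rfl
  map_mul' := by
    rintro ⟨_, f, hf, rfl⟩ ⟨_, g, hg, rfl⟩; rfl
  map_add' := by
    rintro ⟨_, f, hf, rfl⟩ ⟨_, g, hg, rfl⟩; rfl

/-- The maximal ideal of the local ring of holomorphic germs at `x`: the germs that vanish
at `x`. -/
def vanishingIdeal (x : X) : Ideal (HolGerm (𝓝 x)) :=
  RingHom.ker ((Germ.valueRingHom (E := ℂ)).comp (HolGerm (𝓝 x)).subtype)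

end Germs

/-! ## The germs `(ℂ, 0) × (M, 0)` and `(ℂ*, 0) × (M, 0)`

The germ of manifold `(M, 0)` is the germ at the origin of a finite-dimensional complex
vector space `E` (that is, coordinates are chosen), so that `T₀M = E`. A point of `ℂ × E` is
a pair `(z, t)`. -/

section Base

variable (E : Type*) [NormedAddCommGroup E] [NormedSpace ℂ E]

/-- The filter of neighbourhoods of the origin in `ℂ × E`, intersected with `{z ≠ 0}`. -/
abbrev puncturedNhds : Filter (ℂ × E) := 𝓝[{p | p.1 ≠ 0}] 0

/-- `𝒪_{ℂ × M, 0}`. -/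
abbrev HolO : Type _ := HolGerm (𝓝 (0 : ℂ × E))

/-- `𝒪_{ℂ* × M, 0}`: germs at the origin of holomorphic functions on
`{(z, t) near the origin, z ≠ 0}`. -/
abbrev HolOStar : Type _ := HolGerm (puncturedNhds E)

instance : OpenFilter (puncturedNhds E) where
  eventually_nhds h := by
    have ho : IsOpen {p : ℂ × E | p.1 ≠ 0} := isOpen_ne.preimage continuous_fst
    filter_upwards [eventually_eventually_nhdsWithin.2 h, self_mem_nhdsWithin] with y hy hy0
    rwa [ho.nhdsWithin_eq hy0] at hy

variable {E}

/-- The restriction `𝒪_{ℂ × M, 0} → 𝒪_{ℂ* × M, 0}`. -/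
def toStar : HolO E →+* HolOStar E :=
  HolGerm.pullback (ContinuousLinearMap.id ℂ (ℂ × E)) (tendsto_id'.2 nhdsWithin_le_nhds)

/-- The coordinate `z` in `𝒪_{ℂ × M, 0}`. -/
def zO : HolO E := HolGerm.of (fun p => p.1) (Eventually.of_forall fun _ => analyticAt_fst)

variable (E) in
/-- The coordinate `z` as an invertible element of `𝒪_{ℂ* × M, 0}`. -/
def zStar : (HolOStar E)ˣ where
  val := HolGerm.of (fun p => p.1) (Eventually.of_forall fun _ => analyticAt_fst)
  inv := HolGerm.of (fun p => p.1⁻¹) (by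
    filter_upwards [self_mem_nhdsWithin] with p hp using analyticAt_fst.inv hp)
  val_inv := Subtype.ext <| Germ.coe_eq.2 <| by
    filter_upwards [self_mem_nhdsWithin] with p hp using mul_inv_cancel₀ hp
  inv_val := Subtype.ext <| Germ.coe_eq.2 <| by
    filter_upwards [self_mem_nhdsWithin] with p hp using inv_mul_cancel₀ hp

variable (E) in
/-- The map `(z, t) ↦ (-z, t)`. -/
def negZ : ℂ × E →L[ℂ] ℂ × E :=
  (-ContinuousLinearMap.id ℂ ℂ).prodMap (ContinuousLinearMap.id ℂ E)

lemma tendsto_negZ : Tendsto (negZ E) (puncturedNhds E) (puncturedNhds E) := by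
  refine tendsto_nhdsWithin_iff.2 ⟨?_, ?_⟩
  · have := (negZ E).continuous.tendsto 0
    rw [map_zero] at this
    exact this.mono_left nhdsWithin_le_nhds
  · filter_upwards [self_mem_nhdsWithin] with p hp
    simpa [negZ] using hp

/-- `f(z, t) ↦ f(-z, t)` on `𝒪_{ℂ* × M, 0}`. -/
def flip : HolOStar E →+* HolOStar E := HolGerm.pullback (negZ E) tendsto_negZ

end Base

/-! ## (TE)-structures -/

section TE

variable (E : Type*) [NormedAddCommGroup E] [NormedSpace ℂ E]

/-- A (TE)-structure over `(M, 0)` on the germ of a holomorphic vector bundle over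
`(ℂ, 0) × (M, 0)` whose module `𝒪(H)` of germs of holomorphic sections is the finite free
`𝒪_{ℂ × M, 0}`-module `H`: a flat connection `∇` over `z ≠ 0` with a pole of Poincaré rank at
most one along `z = 0`, i.e. `∇` maps `𝒪(H)` into
`z⁻¹ (𝒪 · Ω¹_M + 𝒪 · dz / z) ⊗ 𝒪(H)`. Equivalently, the operators `z ∇_v` (`v` a constant
vector field on `M`) and `z² ∇_{∂/∂z}` map `𝒪(H)` to itself; they determine `∇`. -/
structure TEStructure (H : Type*) [AddCommGroup H] [Module (HolO E) H]
    [Module.Free (HolO E) H] [Module.Finite (HolO E) H] where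
  /-- `zNabla v = z ∇_v`. -/
  zNabla : E →+ H →+ H
  /-- `zzNabla = z² ∇_{∂/∂z} = z ∇_{z ∂/∂z}`. -/
  zzNabla : H →+ H
  /-- `∇_v` is `ℂ`-linear in `v`. -/
  zNabla_smul : ∀ (c : ℂ) (v : E) (a : H),
    zNabla (c • v) a = (HolGerm.const c : HolO E) • zNabla v a
  /-- Leibniz rule for `∇_v`. -/
  zNabla_leibniz : ∀ (v : E) (f : HolO E) (a : H),
    zNabla v (f • a) = (zO * HolGerm.deriv ((0, v) : ℂ × E) f) • a + f • zNabla v a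
  /-- Leibniz rule for `∇_{∂/∂z}`. -/
  zzNabla_leibniz : ∀ (f : HolO E) (a : H),
    zzNabla (f • a) = (zO ^ 2 * HolGerm.deriv ((1, 0) : ℂ × E) f) • a + f • zzNabla a
  /-- Flatness: `z² [∇_v, ∇_u] = 0`. -/
  flat_base : ∀ (v u : E) (a : H), zNabla v (zNabla u a) = zNabla u (zNabla v a)
  /-- Flatness: `z³ [∇_{∂/∂z}, ∇_v] = 0`, since
  `(z² ∇_{∂/∂z}) (z ∇_v) = z² ∇_v + z³ ∇_{∂/∂z} ∇_v`. -/
  flat_z : ∀ (v : E) (a : H),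
    zzNabla (zNabla v a) = zNabla v (zzNabla a) + (zO : HolO E) • zNabla v a

variable {E}
variable {H : Type*} [AddCommGroup H] [Module (HolO E) H]

variable (E H) in
/-- The fibre `K₀` of the bundle at `(z, t) = (0, 0)`: sections modulo those vanishing there.
The ring `𝒪_{ℂ × M, 0}` acts on it through `f ↦ f(0, 0)`. -/
abbrev Fibre : Type _ := H ⧸ (vanishingIdeal (0 : ℂ × E) • ⊤ : Submodule (HolO E) H)

/-- The linear endomorphism of the fibre at `(0, 0)` induced by an operator `D` on sections
with `D (f a) = δ(f) a + f D a`, where all `δ(f)` vanish at `(0, 0)`. -/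
def fibreMap (D : H →+ H) (δ : HolO E → HolO E)
    (hδ : ∀ f, δ f ∈ vanishingIdeal (0 : ℂ × E))
    (hD : ∀ (f : HolO E) (a : H), D (f • a) = δ f • a + f • D a) :
    Fibre E H →ₗ[HolO E] Fibre E H where
  __ := QuotientAddGroup.map
    (vanishingIdeal (0 : ℂ × E) • ⊤ : Submodule (HolO E) H).toAddSubgroup
    (vanishingIdeal (0 : ℂ × E) • ⊤ : Submodule (HolO E) H).toAddSubgroup D (by
      intro x hx
      change D x ∈ (vanishingIdeal (0 : ℂ × E) • ⊤ : Submodule (HolO E) H)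
      refine Submodule.smul_induction_on (p := fun x => D x ∈
        (vanishingIdeal (0 : ℂ × E) • ⊤ : Submodule (HolO E) H)) hx ?_ ?_
      · intro f hf a _
        rw [hD]
        exact add_mem (Submodule.smul_mem_smul (hδ f) Submodule.mem_top)
          (Submodule.smul_mem_smul hf Submodule.mem_top)
      · intro a b ha hb
        rw [map_add]
        exact add_mem ha hb)
  map_smul' f x := by
    obtain ⟨a, rfl⟩ := Submodule.Quotient.mk_surjective _ x
    change Submodule.Quotient.mk (D (f • a)) = f • Submodule.Quotient.mk (D a)
    rw [hD, Submodule.Quotient.mk_add, (Submodule.Quotient.mk_eq_zero _).2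
      (Submodule.smul_mem_smul (hδ f) Submodule.mem_top), zero_add]
    rfl

lemma zO_mem : (zO : HolO E) ∈ vanishingIdeal (0 : ℂ × E) := rfl

variable [Module.Free (HolO E) H] [Module.Finite (HolO E) H]

/-- The Higgs field at the origin: `C_v [a] = [z ∇_v a]` on the fibre at `(0, 0)`. -/
def TEStructure.C (T : TEStructure E H) (v : E) : Fibre E H →ₗ[HolO E] Fibre E H :=
  fibreMap (T.zNabla v) (fun f => zO * HolGerm.deriv ((0, v) : ℂ × E) f)
    (fun _ => Ideal.mul_mem_right _ _ zO_mem) (T.zNabla_leibniz v)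

/-- The pole part at the origin: `U [a] = [z ∇_{z ∂/∂z} a]` on the fibre at `(0, 0)`. -/
def TEStructure.U (T : TEStructure E H) : Fibre E H →ₗ[HolO E] Fibre E H :=
  fibreMap T.zzNabla (fun f => zO ^ 2 * HolGerm.deriv ((1, 0) : ℂ × E) f)
    (fun _ => Ideal.mul_mem_right _ _ (Ideal.pow_mem_of_mem _ zO_mem 2 two_pos))
    T.zzNabla_leibniz

/-- The generation condition: some vector `ζ` of the fibre `K₀` at `(0, 0)` generates `K₀`
together with its images under iteration of `U` and the `C_v`. -/
def TEStructure.GenerationCondition (T : TEStructure E H) : Prop :=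
  ∃ ζ : Fibre E H, ∀ S : Submodule (HolO E) (Fibre E H), ζ ∈ S →
    (∀ a ∈ S, T.U a ∈ S) → (∀ (v : E), ∀ a ∈ S, T.C v a ∈ S) → S = ⊤

/-! ## Pairings -/

/-- A `∇`-flat pairing `H_{(z,t)} × H_{(-z,t)} → ℂ` for `(z, t)` near the origin with
`z ≠ 0`. It is given by its values on sections: `P(a, b)` is the function
`(z, t) ↦ P(a(z,t), b(-z,t))`, holomorphic for `z ≠ 0`. -/
@[ext]
structure FlatPairing (T : TEStructure E H) where
  /-- The values on sections. -/
  P : H →+ H →+ HolOStar E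
  smul_left : ∀ (f : HolO E) (a b : H), P (f • a) b = toStar f * P a b
  /-- `P(a, f b)(z, t) = f(-z, t) P(a, b)(z, t)`. -/
  smul_right : ∀ (f : HolO E) (a b : H), P a (f • b) = flip (toStar f) * P a b
  /-- `v P(a, b) = P(∇_v a, b) + P(a, ∇_v b)`, multiplied by `z`; the section `z ∇_v b` at
  `-z` is `-z` times the value of `∇_v b` there. -/
  flat_base : ∀ (v : E) (a b : H),
    (zStar E : HolOStar E) * HolGerm.deriv ((0, v) : ℂ × E) (P a b) =
      P (T.zNabla v a) b - P a (T.zNabla v b)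
  /-- `z ∂/∂z P(a, b) = P(∇_{z ∂/∂z} a, b) + P(a, ∇_{z ∂/∂z} b)`, multiplied by `z`
  (the vector field `z ∂/∂z` is invariant under `z ↦ -z`). -/
  flat_z : ∀ a b : H,
    (zStar E : HolOStar E) ^ 2 * HolGerm.deriv ((1, 0) : ℂ × E) (P a b) =
      P (T.zzNabla a) b - P a (T.zzNabla b)

/-- The flat pairing makes the (TE)-structure a (TEP(w))-structure. -/
structure FlatPairing.IsTEP {T : TEStructure E H} (Q : FlatPairing T) (w : ℤ) : Prop where
  /-- `(-1)^w`-symmetry: `P(b, a)(z, t) = (-1)^w P(a, b)(-z, t)`. -/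
  symm : ∀ a b : H, Q.P b a = (w.negOnePow : ℤ) • flip (Q.P a b)
  /-- `P` takes values in `z^w 𝒪_{ℂ × M, 0}`. -/
  values : ∀ a b : H, ∃ g : HolO E,
    Q.P a b = ((zStar E ^ w : (HolOStar E)ˣ) : HolOStar E) * toStar g
  /-- `P : 𝒪(H) × 𝒪(H) → z^w 𝒪_{ℂ × M, 0}` is nondegenerate: every linear form on `𝒪(H)` with
  values in `z^w 𝒪_{ℂ × M, 0}` is `P(·, b)` for exactly one `b`. -/
  nondegenerate : ∀ φ : H →ₗ[HolO E] HolO E, ∃! b : H, ∀ a : H,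
    Q.P a b = ((zStar E ^ w : (HolOStar E)ˣ) : HolOStar E) * toStar (φ a)

end TE

/-! ## Unfoldings -/

section Unfolding

variable (E : Type*) [NormedAddCommGroup E] [NormedSpace ℂ E] (k : ℕ)

/-- The inclusion `(z, t) ↦ (z, (t, 0))` of `ℂ × M` into `ℂ × (M × ℂ^k)`. -/
def incl : ℂ × E →L[ℂ] ℂ × (E × (Fin k → ℂ)) :=
  (ContinuousLinearMap.id ℂ ℂ).prodMap (ContinuousLinearMap.inl ℂ E (Fin k → ℂ))

lemma tendsto_incl : Tendsto (incl E k) (𝓝 0) (𝓝 0) := by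
  simpa using (incl E k).continuous.tendsto 0

lemma tendsto_incl_punctured :
    Tendsto (incl E k) (puncturedNhds E) (puncturedNhds (E × (Fin k → ℂ))) := by
  refine tendsto_nhdsWithin_iff.2 ⟨(tendsto_incl E k).mono_left nhdsWithin_le_nhds, ?_⟩
  filter_upwards [self_mem_nhdsWithin] with p hp
  simpa [incl] using hp

/-- Restriction of functions, `𝒪_{ℂ × M × ℂ^k, 0} → 𝒪_{ℂ × M, 0}`. -/
def restr : HolO (E × (Fin k → ℂ)) →+* HolO E :=
  HolGerm.pullback (incl E k) (tendsto_incl E k)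

/-- Restriction of functions, `𝒪_{ℂ* × M × ℂ^k, 0} → 𝒪_{ℂ* × M, 0}`. -/
def restrStar : HolOStar (E × (Fin k → ℂ)) →+* HolOStar E :=
  HolGerm.pullback (incl E k) (tendsto_incl_punctured E k)

/-- The sections of the restriction to `M × {0}` of the bundle with sections `H'`: the sections
in `H'` modulo the ideal of the functions that vanish on `(ℂ × M × {0}, 0)`. -/
abbrev RestrictedSections (H' : Type*) [AddCommGroup H'] [Module (HolO (E × (Fin k → ℂ))) H'] :
    Type _ :=
  H' ⧸ (RingHom.ker (restr E k) • ⊤ : Submodule (HolO (E × (Fin k → ℂ))) H')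

variable {E}
variable {H : Type*} [AddCommGroup H] [Module (HolO E) H]
  [Module.Free (HolO E) H] [Module.Finite (HolO E) H]

/-- An unfolding over `(M × ℂ^k, 0)`, with sections `H'`, of a (TE)-structure `T` over
`(M, 0)`: a (TE)-structure over `(M × ℂ^k, 0)` with an isomorphism `i` from `T` to its restriction
to `(M × {0}, 0)`. -/
structure Unfolding (T : TEStructure E H) (H' : Type*) [AddCommGroup H']
    [Module (HolO (E × (Fin k → ℂ))) H'] [Module.Free (HolO (E × (Fin k → ℂ))) H']
    [Module.Finite (HolO (E × (Fin k → ℂ))) H'] where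
  /-- The (TE)-structure over `(M × ℂ^k, 0)`. -/
  T' : TEStructure (E × (Fin k → ℂ)) H'
  /-- The isomorphism with the restriction to `(M × {0}, 0)`. -/
  i : H ≃+ RestrictedSections E k H'
  /-- `i` is linear over `𝒪_{ℂ × M, 0}`, which acts on the restricted sections through lifts. -/
  i_smul : ∀ (g : HolO (E × (Fin k → ℂ))) (a : H), i (restr E k g • a) = g • i a
  /-- `i` is compatible with the connections: if `a'` restricts to `i a`, then `∇_{(v,0)} a'`
  restricts to `i (∇_v a)`. -/
  i_zNabla : ∀ (v : E) (a : H) (a' : H'), i a = Submodule.Quotient.mk a' →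
    i (T.zNabla v a) = Submodule.Quotient.mk (T'.zNabla (v, 0) a')
  /-- Likewise for the `z`-direction. -/
  i_zzNabla : ∀ (a : H) (a' : H'), i a = Submodule.Quotient.mk a' →
    i (T.zzNabla a) = Submodule.Quotient.mk (T'.zzNabla a')

/-- The pairing `Q'` on an unfolding extends the pairing `Q`: sections `a', b'` that restrict to
`i a, i b` have a pairing that restricts to the pairing of `a` and `b`. -/
def Unfolding.Extends {k : ℕ} {T : TEStructure E H} {H' : Type*} [AddCommGroup H']
    [Module (HolO (E × (Fin k → ℂ))) H'] [Module.Free (HolO (E × (Fin k → ℂ))) H']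
    [Module.Finite (HolO (E × (Fin k → ℂ))) H'] (V : Unfolding k T H')
    (Q : FlatPairing T) (Q' : FlatPairing V.T') : Prop :=
  ∀ (a b : H) (a' b' : H'), V.i a = Submodule.Quotient.mk a' → V.i b = Submodule.Quotient.mk b' →
    restrStar E k (Q'.P a' b') = Q.P a b

end Unfolding

end TEP

end

/-!
Let `s = (s₁, …, s_k)` be the coordinates on `ℂ^k`, so that the original structure sits at `s = 0`.

*The flat extension.* A pairing on the unfolding is a Gram matrix of functions on `{z ≠ 0}`, and
flatness in the direction of the radial vector field `ℰ = ∑ s_j ∂/∂s_j` is a linear differential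
equation along the segments from `s = 0` to `s`. Its coefficients are `z⁻¹` times holomorphic
functions, so for `z ≠ 0` it is solved by inverting `1 - (Volterra operator)`, holomorphically in
all parameters (`exists_radial_solution`). As the connection on the unfolding is flat, the other
covariant derivatives of the solution again satisfy radial equations and vanish or are determined
at `s = 0`. Comparing orders in `s` shows that they vanish, which gives flatness and uniqueness
(`eq_zero_of_pairRadial`, `Unfolding.exists_extends`, `Unfolding.Extends.unique`).

*No worse pole.* The extension lies in `z^w 𝒪` as soon as the restrictions to `s = 0` of all its
derivatives do, by a theorem on removable singularities (`exists_extension`,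
`mem_zPowO_of_jetIn`). This is shown by induction on the order in `s`. By flatness
`z ∂/∂s_j P(a, b) = P(z ∇_j a, b) - P(a, z ∇_j b)`, so it must be seen that `z ∇_j` is symmetric
modulo `z`. The operators `z² ∇_{∂/∂z}` and `z ∇_u`, `u ∈ T₀M`, are, since the
corresponding derivatives of `P` do not raise the order in `s`. All these operators commute modulo
`z` and, by the generation condition and Nakayama's lemma, some section `ζ` generates all others
under those that are not derivatives with respect to `s`. Hence there is a polynomial `D` in them,
symmetric modulo `z`, with `z ∇_j ζ = D ζ`. Commutation implies `z ∇_j = D` modulo `z` everywhere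
(`symmModZ_of_cyclic`, `Unfolding.Extends.values`).

*Symmetry and nondegeneracy.* The pairing `(a, b) ↦ (-1)^w P(b, a)(-z)` is another flat extension
of the given pairing, hence the same one. The Gram matrix divided by `z^w` is
invertible, since its value at the origin is that of the given pairing
(`Unfolding.Extends.symm`, `Unfolding.Extends.nondegenerate`).
-/

noncomputable section

namespace TEP

/-! ### Composition operators on spaces of continuous functions -/

section Nemytskii

variable {K Y W : Type*} [TopologicalSpace K] [CompactSpace K]
  [NormedAddCommGroup Y] [NormedSpace ℂ Y] [NormedAddCommGroup W] [NormedSpace ℂ W]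

/-- The power series on `C(K, Y)` obtained by applying the terms of `p` pointwise. -/
def pointwiseSeries (K : Type*) [TopologicalSpace K] [CompactSpace K]
    (p : FormalMultilinearSeries ℂ Y W) :
    FormalMultilinearSeries ℂ C(K, Y) C(K, W) := fun n =>
  MultilinearMap.mkContinuous
    { toFun := fun h => ⟨fun x => p n (fun i => h i x),
        (p n).cont.comp (continuous_pi fun i => (h i).continuous)⟩
      map_update_add' := by
        intro _ h i a b
        ext x
        have key : ∀ c : C(K, Y), (fun j => Function.update h i c j x) =
            Function.update (fun j => h j x) i (c x) := by
          intro c; ext j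
          by_cases hj : j = i
          · subst hj; simp
          · simp [hj]
        simp [key]
      map_update_smul' := by
        intro _ h i a b
        ext x
        have key : ∀ c : C(K, Y), (fun j => Function.update h i c j x) =
            Function.update (fun j => h j x) i (c x) := by
          intro c; ext j
          by_cases hj : j = i
          · subst hj; simp
          · simp [hj]
        simp [key] } ‖p n‖ (by
      intro h
      rw [ContinuousMap.norm_le _ (by positivity)]
      intro x
      refine ((p n).le_opNorm _).trans ?_
      gcongr with i
      exact (h i).norm_coe_le_norm x)

lemma norm_pointwiseSeries_le (p : FormalMultilinearSeries ℂ Y W) (n : ℕ) :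
    ‖pointwiseSeries K p n‖ ≤ ‖p n‖ :=
  MultilinearMap.mkContinuous_norm_le _ (norm_nonneg _) _

/-- Composition with a function that is analytic at `y₀` is an analytic operation on the
continuous maps that stay close to `y₀`: its power series is obtained by applying the terms of the
power series of the function pointwise. -/
theorem exists_analyticAt_comp [CompleteSpace W] {f : Y → W} {y₀ : Y} (hf : AnalyticAt ℂ f y₀) :
    ∃ (F : C(K, Y) → C(K, W)) (r : ℝ), 0 < r ∧
      ∀ h : C(K, Y), ‖h - ContinuousMap.const K y₀‖ < r →
        AnalyticAt ℂ F h ∧ ∀ x, F h x = f (h x) := by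
  obtain ⟨p, R, hp⟩ := hf
  set q := pointwiseSeries K p
  have hrad : p.radius ≤ q.radius := by
    refine ENNReal.le_of_forall_nnreal_lt fun r hr => ?_
    obtain ⟨C, -, hC⟩ := p.norm_mul_pow_le_of_lt_radius hr
    refine q.le_radius_of_bound C fun n => le_trans ?_ (hC n)
    gcongr
    exact norm_pointwiseSeries_le p n
  have hqpos : 0 < q.radius := (hp.r_pos.trans_le hp.r_le).trans_le hrad
  have hq := q.hasFPowerSeriesOnBall hqpos
  obtain ⟨r, hr0, hrR⟩ := ENNReal.lt_iff_exists_nnreal_btwn.1 hp.r_pos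
  refine ⟨fun h => q.sum (h - ContinuousMap.const K y₀), r, by exact_mod_cast hr0, ?_⟩
  intro h hh
  have hmem : h - ContinuousMap.const K y₀ ∈ Metric.eball (0 : C(K, Y)) q.radius := by
    rw [Metric.mem_eball, edist_zero_right]
    refine lt_of_lt_of_le ?_ ((hrR.le.trans hp.r_le).trans hrad)
    rw [← ofReal_norm, ENNReal.ofReal_lt_coe_iff (by positivity)]
    exact hh
  refine ⟨?_, ?_⟩
  · exact (hq.analyticAt_of_mem hmem).comp (f := fun h : C(K, Y) => h - ContinuousMap.const K y₀)
      (analyticAt_id.sub analyticAt_const)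
  · intro x
    have hs := (hq.hasSum hmem)
    rw [zero_add] at hs
    have hs' := hs.mapL (ContinuousMap.evalCLM ℂ x)
    have hx : h x - y₀ ∈ Metric.eball (0 : Y) R := by
      rw [Metric.mem_eball, edist_zero_right]
      refine lt_of_le_of_lt ?_ hrR
      rw [← ofReal_norm]
      refine ENNReal.ofReal_le_of_le_toReal ?_
      exact ((h - ContinuousMap.const K y₀).norm_coe_le_norm x).trans hh.le
    have h2 := hp.hasSum hx
    rw [add_sub_cancel] at h2
    exact hs'.unique h2

end Nemytskii

/-! ### Integrals depending analytically on a parameter -/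

section ParametricIntegral

open MeasureTheory

variable {X W : Type*} [NormedAddCommGroup X] [NormedSpace ℂ X]
  [NormedAddCommGroup W] [NormedSpace ℂ W] [CompleteSpace W]

/-- Integration over `[0, 1]` as a continuous linear functional. -/
def unitIntegral (W : Type*) [NormedAddCommGroup W] [NormedSpace ℂ W] :
    C(unitInterval, W) →L[ℂ] W :=
  LinearMap.mkContinuous
    { toFun := fun φ => ∫ μ in (0 : ℝ)..1, Set.IccExtend zero_le_one φ μ
      map_add' := fun φ ψ => by
        rw [← intervalIntegral.integral_add]
        · rfl
        · exact (φ.continuous.Icc_extend').intervalIntegrable _ _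
        · exact (ψ.continuous.Icc_extend').intervalIntegrable _ _
      map_smul' := fun c φ => by
        rw [RingHom.id_apply, ← intervalIntegral.integral_smul]
        rfl } 1 (fun φ => by
      have := intervalIntegral.norm_integral_le_of_norm_le_const (a := 0) (b := 1)
        (f := Set.IccExtend zero_le_one φ) (C := ‖φ‖) (fun x _ => φ.norm_coe_le_norm _)
      simpa using this)

/-- The integral over a short piece of a path is analytic in the parameter. -/
lemma eventually_analyticAt_integral {c : ℝ → ℂ} (hc : Continuous c) {F : ℂ × X → W} {x₀ : X}
    (θ₀ : ℝ) (hF : AnalyticAt ℂ F (c θ₀, x₀)) :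
    ∀ᶠ θ₁ in 𝓝 θ₀, AnalyticAt ℂ (fun x => ∫ θ in θ₀..θ₁, F (c θ, x)) x₀ := by
  obtain ⟨N, r, hr, hN⟩ := exists_analyticAt_comp (K := unitInterval) hF
  -- for `θ₁` close to `θ₀`, the path stays within `r / 2` of `c θ₀`
  obtain ⟨δ, hδ, hcδ⟩ := Metric.continuousAt_iff.1 hc.continuousAt (r / 2) (half_pos hr)
  filter_upwards [Metric.ball_mem_nhds θ₀ hδ] with θ₁ hθ₁
  let γ : C(unitInterval, ℂ) :=
    ⟨fun μ => c (θ₀ + (θ₁ - θ₀) * μ), hc.comp (by fun_prop)⟩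
  have hγ : ∀ μ, ‖γ μ - c θ₀‖ < r / 2 := by
    intro μ
    rw [← dist_eq_norm]
    refine hcδ ?_
    rw [Real.dist_eq, add_sub_cancel_left, abs_mul]
    refine lt_of_le_of_lt ?_ (by rwa [Metric.mem_ball, Real.dist_eq] at hθ₁)
    rw [abs_of_nonneg μ.2.1]
    exact mul_le_of_le_one_right (abs_nonneg _) μ.2.2
  let A : X → C(unitInterval, ℂ × X) := fun x =>
    ContinuousMap.prodMk γ (ContinuousMap.const _ x)
  have hAan : AnalyticAt ℂ A x₀ := by
    let L : X →L[ℂ] C(unitInterval, ℂ × X) :=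
      LinearMap.mkContinuous
        { toFun := fun x => ContinuousMap.const _ ((0 : ℂ), x)
          map_add' := fun x y => by ext <;> simp
          map_smul' := fun x y => by ext <;> simp } 1 (fun x => by
          rw [ContinuousMap.norm_le _ (by positivity)]
          intro μ
          simp [Prod.norm_def])
    have : A = fun x => ContinuousMap.prodMk γ (ContinuousMap.const _ 0) + L x := by
      funext x
      ext μ <;> simp [A, L]
    rw [this]
    exact analyticAt_const.add (L.analyticAt _)
  have hnear : ∀ x, ‖x - x₀‖ < r → ‖A x - ContinuousMap.const _ (c θ₀, x₀)‖ < r := by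
    intro x hx
    rw [ContinuousMap.norm_lt_iff _ hr]
    intro μ
    change ‖(γ μ - c θ₀, x - x₀)‖ < r
    rw [Prod.norm_def]
    exact max_lt ((hγ μ).trans (half_lt_self hr)) hx
  have hx₀ := hnear x₀ (by simpa using hr)
  have h1 : AnalyticAt ℂ (fun x => (θ₁ - θ₀ : ℂ) • unitIntegral W (N (A x))) x₀ :=
    analyticAt_const.smul
      (((unitIntegral W).analyticAt _).comp (((hN _ hx₀).1).comp hAan))
  refine h1.congr ?_
  filter_upwards [Metric.ball_mem_nhds x₀ hr] with x hx
  have hx' := hN _ (hnear x (by simpa [dist_eq_norm] using hx))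
  have e1 : unitIntegral W (N (A x)) = ∫ μ in (0 : ℝ)..1, F (c (θ₀ + (θ₁ - θ₀) * μ), x) := by
    refine intervalIntegral.integral_congr fun μ hμ => ?_
    rw [Set.uIcc_of_le zero_le_one] at hμ
    simp only [Set.IccExtend_of_mem _ _ hμ, hx'.2]
    rfl
  rw [e1]
  have e2 := intervalIntegral.smul_integral_comp_add_mul (a := 0) (b := 1)
    (fun θ => F (c θ, x)) (θ₁ - θ₀) θ₀
  simp only [mul_zero, add_zero, mul_one, add_sub_cancel] at e2
  rw [← e2]
  norm_cast

/-- The integral along a path is analytic in the parameter. -/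
lemma analyticAt_integral {c : ℝ → ℂ} (hc : Continuous c) {F : ℂ × X → W} {x₀ : X}
    (hF : ∀ θ, AnalyticAt ℂ F (c θ, x₀)) (a b : ℝ) :
    AnalyticAt ℂ (fun x => ∫ θ in a..b, F (c θ, x)) x₀ := by
  have hint : ∀ a b : ℝ, ∀ᶠ x in 𝓝 x₀,
      IntervalIntegrable (fun θ => F (c θ, x)) volume a b := by
    intro a b
    have h1 : ∀ᶠ x in 𝓝 x₀, ∀ θ ∈ Set.uIcc a b, AnalyticAt ℂ F (c θ, x) := by
      refine isCompact_uIcc.eventually_forall_of_forall_eventually fun θ _ => ?_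
      have hcont : ContinuousAt (fun p : X × ℝ => (c p.2, p.1)) (x₀, θ) := by
        fun_prop
      exact hcont.eventually (hF θ).eventually_analyticAt
    filter_upwards [h1] with x hx
    refine ContinuousOn.intervalIntegrable fun θ hθ => ?_
    exact ((hx θ hθ).continuousAt.comp (f := fun θ => (c θ, x))
      (by fun_prop)).continuousWithinAt
  -- analyticity of the integral over `[a, b]` does not change under small changes of `b`
  let S : ℝ → Prop := fun b => AnalyticAt ℂ (fun x => ∫ θ in a..b, F (c θ, x)) x₀
  have hS : IsLocallyConstant S := by
    refine (IsLocallyConstant.iff_eventually_eq S).2 fun θ₀ => ?_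
    filter_upwards [eventually_analyticAt_integral hc θ₀ (hF θ₀)] with θ₁ hθ₁
    refine propext ⟨fun h => ?_, fun h => ?_⟩
    · refine (h.sub hθ₁).congr ?_
      filter_upwards [hint a θ₀, hint θ₀ θ₁] with x h1 h2
      rw [Pi.sub_apply, ← intervalIntegral.integral_add_adjacent_intervals h1 h2]
      abel
    · refine (h.add hθ₁).congr ?_
      filter_upwards [hint a θ₀, hint θ₀ θ₁] with x h1 h2
      exact intervalIntegral.integral_add_adjacent_intervals h1 h2
  have hSa : S a := by
    change AnalyticAt ℂ (fun x => ∫ θ in a..a, F (c θ, x)) x₀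
    simpa using analyticAt_const
  exact (hS.apply_eq_of_isPreconnected isPreconnected_univ (Set.mem_univ a)
    (Set.mem_univ b)).mp hSa

lemma analyticAt_circleIntegral {R : ℝ} {F : ℂ × X → W} {x₀ : X}
    (hF : ∀ ζ ∈ Metric.sphere (0 : ℂ) |R|, AnalyticAt ℂ F (ζ, x₀)) :
    AnalyticAt ℂ (fun x => ∮ ζ in C(0, R), F (ζ, x)) x₀ := by
  have h := analyticAt_integral (continuous_circleMap 0 R)
    (F := fun p : ℂ × X => (p.1 * Complex.I) • F p) (x₀ := x₀) (fun θ =>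
      (analyticAt_fst.mul analyticAt_const).smul (hF _ (circleMap_mem_sphere' 0 R θ)))
    0 (2 * Real.pi)
  simpa only [circleIntegral, deriv_circleMap] using h

end ParametricIntegral

/-! ### Linear Volterra equations -/

section Volterra

open MeasureTheory

variable (W : Type*) [NormedAddCommGroup W] [NormedSpace ℂ W]

/-- The Volterra operator `g ↦ (τ ↦ ∫₀^τ Λ(μ) g(μ) dμ)` on `C([0, 1], W)`, as a function of the
coefficient `Λ`. -/
def volterra : C(unitInterval, W →L[ℂ] W) →L[ℂ] C(unitInterval, W) →L[ℂ] C(unitInterval, W) :=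
  LinearMap.mkContinuous₂
    (LinearMap.mk₂ ℂ (fun (Λ : C(unitInterval, W →L[ℂ] W)) (g : C(unitInterval, W)) =>
        (⟨fun τ => ∫ μ in (0 : ℝ)..τ,
        Set.IccExtend zero_le_one Λ μ (Set.IccExtend zero_le_one g μ), by
        refine Continuous.comp (g := fun τ : ℝ => ∫ μ in (0 : ℝ)..τ,
          Set.IccExtend zero_le_one Λ μ (Set.IccExtend zero_le_one g μ)) ?_ continuous_subtype_val
        refine intervalIntegral.continuous_primitive (fun a b => ?_) 0
        exact (Λ.continuous.Icc_extend'.clm_apply g.continuous.Icc_extend').intervalIntegrable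
          _ _⟩ : C(unitInterval, W)))
      (fun Λ Λ' g => by
        ext τ
        refine (intervalIntegral.integral_congr fun μ _ => ?_).trans
          (intervalIntegral.integral_add
          ((Λ.continuous.Icc_extend'.clm_apply g.continuous.Icc_extend').intervalIntegrable _ _)
          ((Λ'.continuous.Icc_extend'.clm_apply g.continuous.Icc_extend').intervalIntegrable _ _))
        rfl)
      (fun c Λ g => by
        ext τ
        exact intervalIntegral.integral_smul c _)
      (fun Λ g g' => by
        ext τ
        refine (intervalIntegral.integral_congr fun μ _ => ?_).trans
          (intervalIntegral.integral_add
          ((Λ.continuous.Icc_extend'.clm_apply g.continuous.Icc_extend').intervalIntegrable _ _)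
          ((Λ.continuous.Icc_extend'.clm_apply g'.continuous.Icc_extend').intervalIntegrable _ _))
        exact map_add _ _ _)
      (fun c Λ g => by
        ext τ
        refine (intervalIntegral.integral_congr fun μ _ => ?_).trans
          (intervalIntegral.integral_smul c _)
        exact map_smul _ _ _)) 1 (by
    intro Λ g
    rw [ContinuousMap.norm_le _ (by positivity)]
    intro τ
    refine (intervalIntegral.norm_integral_le_of_norm_le_const (C := ‖Λ‖ * ‖g‖)
      (fun μ _ => ?_)).trans ?_
    · refine (ContinuousLinearMap.le_opNorm _ _).trans ?_
      gcongr
      exacts [Λ.norm_coe_le_norm _, g.norm_coe_le_norm _]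
    · rw [sub_zero, abs_of_nonneg τ.2.1, one_mul]
      exact mul_le_of_le_one_right (by positivity) τ.2.2)

variable {W}

lemma volterra_apply (Λ : C(unitInterval, W →L[ℂ] W)) (g : C(unitInterval, W))
    (τ : unitInterval) : volterra W Λ g τ = ∫ μ in (0 : ℝ)..τ,
      Set.IccExtend zero_le_one Λ μ (Set.IccExtend zero_le_one g μ) := rfl

lemma norm_volterra_pow_apply_le (Λ : C(unitInterval, W →L[ℂ] W)) (g : C(unitInterval, W)) (n : ℕ)
    (τ : unitInterval) :
    ‖(volterra W Λ ^ n) g τ‖ ≤ ‖Λ‖ ^ n * ‖g‖ / n.factorial * (τ : ℝ) ^ n := by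
  induction n generalizing τ with
  | zero => simpa using g.norm_coe_le_norm τ
  | succ n ih =>
    rw [pow_succ', mul_apply_eq_comp, volterra_apply]
    have hb : ∀ μ ∈ Set.Ioc (0 : ℝ) τ, ‖Set.IccExtend zero_le_one Λ μ
        (Set.IccExtend zero_le_one ((volterra W Λ ^ n) g) μ)‖ ≤
        ‖Λ‖ * (‖Λ‖ ^ n * ‖g‖ / n.factorial) * μ ^ n := by
      intro μ hμ
      have hμ' : μ ∈ Set.Icc (0 : ℝ) 1 := ⟨hμ.1.le, hμ.2.trans τ.2.2⟩
      rw [Set.IccExtend_of_mem _ _ hμ', Set.IccExtend_of_mem _ _ hμ', mul_assoc]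
      refine (ContinuousLinearMap.le_opNorm _ _).trans ?_
      gcongr
      exacts [Λ.norm_coe_le_norm _, ih _]
    refine (intervalIntegral.norm_integral_le_of_norm_le τ.2.1
      (Eventually.of_forall hb) ?_).trans_eq ?_
    · exact Continuous.intervalIntegrable (by fun_prop) _ _
    · rw [intervalIntegral.integral_const_mul, integral_pow, Nat.factorial_succ]
      have : (n.factorial : ℝ) ≠ 0 := by positivity
      push_cast
      field_simp
      ring

/-- By the factorial decay of its powers, some power of the Volterra operator is a contraction, and
`1 - A` divides `1 - A ^ n`. -/
lemma isUnit_one_sub_volterra [CompleteSpace W] (Λ : C(unitInterval, W →L[ℂ] W)) :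
    IsUnit (1 - volterra W Λ) := by
  obtain ⟨n, hn⟩ := ((FloorSemiring.tendsto_pow_div_factorial_atTop ‖Λ‖).eventually
    (gt_mem_nhds one_pos)).exists
  have hlt : ‖volterra W Λ ^ n‖ < 1 := by
    have h0 : 0 ≤ ‖Λ‖ ^ n / n.factorial := by positivity
    refine lt_of_le_of_lt (ContinuousLinearMap.opNorm_le_bound _ h0 fun g => ?_) hn
    rw [ContinuousMap.norm_le _ (by positivity)]
    intro τ
    refine (norm_volterra_pow_apply_le Λ g n τ).trans ?_
    rw [div_mul_eq_mul_div (‖Λ‖ ^ n) _ ‖g‖]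
    exact mul_le_of_le_one_right (by positivity) (pow_le_one₀ τ.2.1 τ.2.2)
  have hu : IsUnit (1 - volterra W Λ ^ n) := isUnit_one_sub_of_norm_lt_one
    (R := C(unitInterval, W) →L[ℂ] C(unitInterval, W)) hlt
  have hc : Commute (1 - volterra W Λ) (∑ i ∈ Finset.range n, volterra W Λ ^ i) :=
    (Commute.one_left _).sub_left
      (Commute.sum_right _ _ _ fun i _ => (Commute.refl _).pow_right i)
  rw [← mul_neg_geom_sum] at hu
  exact (hc.isUnit_mul_iff.1 hu).1

end Volterra

/-! ### Calculus of holomorphic germs -/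

section GermCalculus

variable {X Y : Type*} [NormedAddCommGroup X] [NormedSpace ℂ X]
  [NormedAddCommGroup Y] [NormedSpace ℂ Y] {l : Filter X} {l' : Filter Y}

namespace HolGerm

lemma exists_eq_of (g : HolGerm l) :
    ∃ (f : X → ℂ) (hf : ∀ᶠ x in l, AnalyticAt ℂ f x), g = of f hf := by
  obtain ⟨_, f, hf, rfl⟩ := g
  exact ⟨f, hf, rfl⟩

lemma of_eq_of_iff {f g : X → ℂ} {hf : ∀ᶠ x in l, AnalyticAt ℂ f x}
    {hg : ∀ᶠ x in l, AnalyticAt ℂ g x} : of f hf = of g hg ↔ f =ᶠ[l] g :=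
  Subtype.ext_iff.trans Germ.coe_eq

lemma of_add {f g : X → ℂ} (hf : ∀ᶠ x in l, AnalyticAt ℂ f x)
    (hg : ∀ᶠ x in l, AnalyticAt ℂ g x) :
    of f hf + of g hg = of (f + g) ((hf.and hg).mono fun _ h => h.1.add h.2) := rfl

lemma of_mul {f g : X → ℂ} (hf : ∀ᶠ x in l, AnalyticAt ℂ f x)
    (hg : ∀ᶠ x in l, AnalyticAt ℂ g x) :
    of f hf * of g hg = of (f * g) ((hf.and hg).mono fun _ h => h.1.mul h.2) := rfl

lemma pullback_of (φ : X →L[ℂ] Y) (h : Tendsto φ l l') {f : Y → ℂ}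
    (hf : ∀ᶠ y in l', AnalyticAt ℂ f y) :
    pullback φ h (of f hf) =
      of (f ∘ φ) ((h.eventually hf).mono fun _ hx => hx.comp (φ.analyticAt _)) := rfl

variable [OpenFilter l] [OpenFilter l']

lemma deriv_of (v : X) {f : X → ℂ} (hf : ∀ᶠ x in l, AnalyticAt ℂ f x) :
    deriv v (of f hf) = of (fun x => fderiv ℂ f x v) (hf.mono fun _ h =>
      (ContinuousLinearMap.apply ℂ ℂ v).analyticAt _ |>.comp h.fderiv) := rfl

lemma deriv_add (v : X) (f g : HolGerm l) : deriv v (f + g) = deriv v f + deriv v g := by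
  obtain ⟨f, hf, rfl⟩ := exists_eq_of f
  obtain ⟨g, hg, rfl⟩ := exists_eq_of g
  rw [of_add, deriv_of, deriv_of, deriv_of, of_add, of_eq_of_iff]
  filter_upwards [hf, hg] with x h1 h2
  rw [fderiv_add h1.differentiableAt h2.differentiableAt]
  rfl

lemma deriv_mul (v : X) (f g : HolGerm l) :
    deriv v (f * g) = deriv v f * g + f * deriv v g := by
  obtain ⟨f, hf, rfl⟩ := exists_eq_of f
  obtain ⟨g, hg, rfl⟩ := exists_eq_of g
  rw [of_mul, deriv_of, deriv_of, deriv_of, of_mul, of_mul, of_add, of_eq_of_iff]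
  filter_upwards [hf, hg] with x h1 h2
  rw [fderiv_mul h1.differentiableAt h2.differentiableAt]
  simp
  ring

lemma deriv_const (v : X) (c : ℂ) : deriv v (const c : HolGerm l) = 0 := by
  rw [const, deriv_of]
  refine of_eq_of_iff (hg := Eventually.of_forall fun _ => analyticAt_const).2 ?_
  exact Eventually.of_forall fun x => by simp

lemma deriv_zero (v : X) : deriv v (0 : HolGerm l) = 0 := deriv_const v 0

lemma deriv_one (v : X) : deriv v (1 : HolGerm l) = 0 := deriv_const v 1

lemma deriv_neg (v : X) (f : HolGerm l) : deriv v (-f) = -deriv v f := by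
  rw [eq_neg_iff_add_eq_zero, ← deriv_add, neg_add_cancel, deriv_zero]

lemma deriv_sub (v : X) (f g : HolGerm l) : deriv v (f - g) = deriv v f - deriv v g := by
  rw [sub_eq_add_neg, deriv_add, deriv_neg, ← sub_eq_add_neg]

lemma deriv_sum {ι : Type*} (s : Finset ι) (v : X) (f : ι → HolGerm l) :
    deriv v (∑ i ∈ s, f i) = ∑ i ∈ s, deriv v (f i) :=
  map_sum (AddMonoidHom.mk' (deriv v) (deriv_add v)) f s

lemma deriv_add_dir (v u : X) (f : HolGerm l) :
    deriv (v + u) f = deriv v f + deriv u f := by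
  obtain ⟨f, hf, rfl⟩ := exists_eq_of f
  rw [deriv_of, deriv_of, deriv_of, of_add, of_eq_of_iff]
  exact Eventually.of_forall fun x => by simp

lemma deriv_smul_dir (c : ℂ) (v : X) (f : HolGerm l) :
    deriv (c • v) f = const c * deriv v f := by
  obtain ⟨f, hf, rfl⟩ := exists_eq_of f
  rw [deriv_of, deriv_of, const, of_mul, of_eq_of_iff]
  exact Eventually.of_forall fun x => by simp

lemma deriv_sum_dir {ι : Type*} (s : Finset ι) (v : ι → X) (f : HolGerm l) :
    deriv (∑ i ∈ s, v i) f = ∑ i ∈ s, deriv (v i) f :=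
  map_sum (AddMonoidHom.mk' (fun v => deriv v f) (fun v u => deriv_add_dir v u f)) v s

lemma deriv_comm (v u : X) (f : HolGerm l) : deriv v (deriv u f) = deriv u (deriv v f) := by
  obtain ⟨f, hf, rfl⟩ := exists_eq_of f
  rw [deriv_of, deriv_of, deriv_of, deriv_of, of_eq_of_iff]
  filter_upwards [hf] with x hx
  have h := hx.fderiv.differentiableAt
  have key : ∀ w w' : X, fderiv ℂ (fun y => fderiv ℂ f y w) x w' =
      fderiv ℂ (fderiv ℂ f) x w' w := by
    intro w w'
    rw [fderiv_clm_apply h (differentiableAt_const _)]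
    simp
  rw [key, key]
  exact (hx.contDiffAt (n := 2)).isSymmSndFDerivAt (by simp) v u

lemma deriv_pullback (φ : X →L[ℂ] Y) (h : Tendsto φ l l') (v : X) (g : HolGerm l') :
    deriv v (pullback φ h g) = pullback φ h (deriv (φ v) g) := by
  obtain ⟨f, hf, rfl⟩ := exists_eq_of g
  rw [deriv_of, pullback_of, pullback_of, deriv_of, of_eq_of_iff]
  filter_upwards [h.eventually hf] with x hx
  rw [fderiv_comp x hx.differentiableAt φ.differentiableAt]
  simp

lemma deriv_of_clm (v : X) (L : X →L[ℂ] ℂ) :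
    deriv v (of L (Eventually.of_forall L.analyticAt) : HolGerm l) = const (L v) := by
  rw [const, deriv_of, of_eq_of_iff]
  exact Eventually.of_forall fun x => by simp

end HolGerm

lemma mem_vanishingIdeal_of {x : X} {f : X → ℂ} (hf : ∀ᶠ y in 𝓝 x, AnalyticAt ℂ f y) :
    HolGerm.of f hf ∈ vanishingIdeal x ↔ f x = 0 := Iff.rfl

/-- A holomorphic germ that does not vanish at the base point is invertible. -/
lemma isUnit_of_notMem_vanishingIdeal {x : X} {f : HolGerm (𝓝 x)} (hf : f ∉ vanishingIdeal x) :
    IsUnit f := by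
  obtain ⟨f, hfa, rfl⟩ := HolGerm.exists_eq_of f
  rw [mem_vanishingIdeal_of] at hf
  have hne : ∀ᶠ y in 𝓝 x, f y ≠ 0 := hfa.self_of_nhds.continuousAt.eventually_ne hf
  refine IsUnit.of_mul_eq_one (HolGerm.of f⁻¹ ((hfa.and hne).mono fun y hy => hy.1.inv hy.2)) ?_
  rw [HolGerm.of_mul]
  refine HolGerm.of_eq_of_iff (hg := Eventually.of_forall fun _ => analyticAt_const).2 ?_
  filter_upwards [hne] with y hy using mul_inv_cancel₀ hy

lemma vanishingIdeal_le_jacobson (x : X) :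
    vanishingIdeal x ≤ Ideal.jacobson (⊥ : Ideal (HolGerm (𝓝 x))) := by
  intro f hf
  rw [Ideal.mem_jacobson_bot]
  intro g
  refine isUnit_of_notMem_vanishingIdeal fun h => ?_
  have h1 : (1 : HolGerm (𝓝 x)) ∈ vanishingIdeal x := by
    simpa using Ideal.sub_mem _ h (Ideal.mul_mem_right g _ hf)
  have h2 := (mem_vanishingIdeal_of (f := fun _ : X => (1 : ℂ))
    (Eventually.of_forall fun _ => analyticAt_const)).1 h1
  exact one_ne_zero h2

end GermCalculus

/-! ### The rings of germs on `(ℂ, 0) × (M, 0)` and their restriction maps -/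

section BaseCalculus

variable {E : Type*} [NormedAddCommGroup E] [NormedSpace ℂ E]

lemma frequently_fst_ne {F : Type*} [NormedAddCommGroup F] (p : ℂ × F) : ∃ᶠ q in 𝓝 p, q.1 ≠ 0 := by
  intro h
  have h2 : Tendsto (fun c : ℂ => (c, p.2)) (𝓝 p.1) (𝓝 p) :=
    (Continuous.tendsto (by fun_prop) p.1)
  have h3 := h2.eventually h
  have h4 : (∀ᶠ c : ℂ in 𝓝[≠] p.1, c = 0) := nhdsWithin_le_nhds
    (h3.mono fun c hc => by simpa using hc)
  have h5 : ∀ᶠ c : ℂ in 𝓝[≠] p.1, c ≠ 0 := by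
    by_cases hp : p.1 = 0
    · rw [hp]; exact self_mem_nhdsWithin
    · exact nhdsWithin_le_nhds (isOpen_ne.mem_nhds hp)
  obtain ⟨c, hc, hc'⟩ := (h4.and h5).exists
  exact hc' hc

lemma toStar_of {f : ℂ × E → ℂ} (hf : ∀ᶠ x in 𝓝 0, AnalyticAt ℂ f x) :
    toStar (HolGerm.of f hf) = HolGerm.of f (hf.filter_mono nhdsWithin_le_nhds) := rfl

lemma toStar_injective : Function.Injective (toStar (E := E)) := by
  intro f g h
  obtain ⟨f, hf, rfl⟩ := HolGerm.exists_eq_of f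
  obtain ⟨g, hg, rfl⟩ := HolGerm.exists_eq_of g
  rw [toStar_of, toStar_of, HolGerm.of_eq_of_iff] at h
  rw [HolGerm.of_eq_of_iff]
  have h' := eventually_nhdsWithin_iff.1 h
  filter_upwards [hf, hg, eventually_eventually_nhds.2 h'] with x h1 h2 h3
  by_contra hne
  have h4 : ∀ᶠ y in 𝓝 x, f y ≠ g y := (h1.continuousAt.prodMk h2.continuousAt).eventually
    (isClosed_diagonal.isOpen_compl.mem_nhds (x := (f x, g x)) hne)
  obtain ⟨q, hq, hq3, hq4⟩ := ((frequently_fst_ne x).and_eventually (h3.and h4)).exists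
  exact hq4 (hq3 hq)

lemma deriv_toStar (v : ℂ × E) (f : HolO E) :
    HolGerm.deriv v (toStar f) = toStar (HolGerm.deriv v f) :=
  HolGerm.deriv_pullback _ _ _ _

lemma toStar_zO : toStar (zO : HolO E) = zStar E := rfl

lemma toStar_const (c : ℂ) : toStar (HolGerm.const c : HolO E) = HolGerm.const c := rfl

/-- `f(z, t) ↦ f(-z, t)` on `𝒪_{ℂ × M, 0}`. -/
def flipO : HolO E →+* HolO E :=
  HolGerm.pullback (negZ E) (by simpa using (negZ E).continuous.tendsto 0)

lemma toStar_flipO (f : HolO E) : toStar (flipO f) = flip (toStar f) := by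
  obtain ⟨f, hf, rfl⟩ := HolGerm.exists_eq_of f
  rfl

lemma negZ_negZ (p : ℂ × E) : negZ E (negZ E p) = p := by
  ext <;> simp [negZ]

lemma flip_flip (f : HolOStar E) : flip (flip f) = f := by
  obtain ⟨f, hf, rfl⟩ := HolGerm.exists_eq_of f
  rw [flip, HolGerm.pullback_of, HolGerm.pullback_of, HolGerm.of_eq_of_iff]
  exact Eventually.of_forall fun x => by simp [negZ_negZ]

lemma flipO_flipO (f : HolO E) : flipO (flipO f) = f := by
  apply toStar_injective
  rw [toStar_flipO, toStar_flipO, flip_flip]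

lemma flip_zStar : flip (zStar E : HolOStar E) = -zStar E := rfl

lemma flip_const (c : ℂ) : flip (HolGerm.const c : HolOStar E) = HolGerm.const c := rfl

lemma deriv_flip (v : E) (f : HolOStar E) :
    HolGerm.deriv ((0, v) : ℂ × E) (flip f) = flip (HolGerm.deriv ((0, v) : ℂ × E) f) := by
  rw [flip, HolGerm.deriv_pullback]
  simp [negZ]

lemma deriv_z_flip (f : HolOStar E) :
    HolGerm.deriv ((1, 0) : ℂ × E) (flip f) = -flip (HolGerm.deriv ((1, 0) : ℂ × E) f) := by
  rw [flip, HolGerm.deriv_pullback, ← map_neg]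
  have h : negZ E (1, 0) = (-1 : ℂ) • ((1, 0) : ℂ × E) := by simp [negZ]
  rw [h, HolGerm.deriv_smul_dir]
  have : (HolGerm.const (-1) : HolOStar E) = -1 := rfl
  rw [this, neg_one_mul]

lemma deriv_zStar (v : E) : HolGerm.deriv ((0, v) : ℂ × E) (zStar E : HolOStar E) = 0 :=
  HolGerm.deriv_of_clm (0, v) (ContinuousLinearMap.fst ℂ ℂ E)

lemma deriv_z_zStar : HolGerm.deriv ((1, 0) : ℂ × E) (zStar E : HolOStar E) = 1 :=
  HolGerm.deriv_of_clm (1, 0) (ContinuousLinearMap.fst ℂ ℂ E)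

lemma deriv_zStar_zpow (v : E) (n : ℤ) :
    HolGerm.deriv ((0, v) : ℂ × E) ((zStar E ^ n : (HolOStar E)ˣ) : HolOStar E) = 0 := by
  have hinv : HolGerm.deriv ((0, v) : ℂ × E) (((zStar E)⁻¹ : (HolOStar E)ˣ) : HolOStar E) = 0 := by
    have h := HolGerm.deriv_mul ((0, v) : ℂ × E) (zStar E : HolOStar E)
      ((zStar E)⁻¹ : (HolOStar E)ˣ)
    rw [Units.mul_inv, HolGerm.deriv_one, deriv_zStar, zero_mul, zero_add] at h
    exact (Units.mul_right_eq_zero _).1 h.symm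
  induction n using Int.induction_on with
  | zero => simpa using HolGerm.deriv_one _
  | succ n ih => rw [zpow_add_one, Units.val_mul, HolGerm.deriv_mul, ih, deriv_zStar]; ring
  | pred n ih => rw [zpow_sub_one, Units.val_mul, HolGerm.deriv_mul, ih, hinv]; ring

lemma zStar_mul_deriv_z_zpow (n : ℤ) :
    (zStar E : HolOStar E) *
        HolGerm.deriv ((1, 0) : ℂ × E) ((zStar E ^ n : (HolOStar E)ˣ) : HolOStar E) =
      n * ((zStar E ^ n : (HolOStar E)ˣ) : HolOStar E) := by
  set u := zStar E
  have hinv : (u : HolOStar E) *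
      HolGerm.deriv ((1, 0) : ℂ × E) ((u⁻¹ : (HolOStar E)ˣ) : HolOStar E) =
      -((u⁻¹ : (HolOStar E)ˣ) : HolOStar E) := by
    have h := HolGerm.deriv_mul ((1, 0) : ℂ × E) (u : HolOStar E) (u⁻¹ : (HolOStar E)ˣ)
    rw [Units.mul_inv, HolGerm.deriv_one, deriv_z_zStar, one_mul] at h
    linear_combination -h
  induction n using Int.induction_on with
  | zero => simp [HolGerm.deriv_one]
  | succ n ih =>
    rw [zpow_add_one, Units.val_mul, HolGerm.deriv_mul, deriv_z_zStar]
    push_cast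
    linear_combination (u : HolOStar E) * ih
  | pred n ih =>
    rw [zpow_sub_one, Units.val_mul, HolGerm.deriv_mul]
    push_cast
    push_cast at ih
    linear_combination ((u⁻¹ : (HolOStar E)ˣ) : HolOStar E) * ih +
      ((u ^ (-(n : ℤ)) : (HolOStar E)ˣ) : HolOStar E) * hinv

end BaseCalculus

section RestrictionCalculus

variable {E : Type*} [NormedAddCommGroup E] [NormedSpace ℂ E] {k : ℕ}

lemma restrStar_toStar (f : HolO (E × (Fin k → ℂ))) :
    restrStar E k (toStar f) = toStar (restr E k f) := by
  obtain ⟨f, hf, rfl⟩ := HolGerm.exists_eq_of f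
  rfl

lemma restrStar_flip (f : HolOStar (E × (Fin k → ℂ))) :
    restrStar E k (flip f) = flip (restrStar E k f) := by
  obtain ⟨f, hf, rfl⟩ := HolGerm.exists_eq_of f
  rfl

lemma restrStar_zStar_zpow (n : ℤ) :
    restrStar E k ((zStar (E × (Fin k → ℂ)) ^ n : (HolOStar (E × (Fin k → ℂ)))ˣ)) =
      ((zStar E ^ n : (HolOStar E)ˣ) : HolOStar E) := by
  have h : Units.map (restrStar E k : HolOStar (E × (Fin k → ℂ)) →* HolOStar E) (zStar _) =
      zStar E := Units.ext rfl
  rw [← h, ← map_zpow, Units.coe_map]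
  rfl

lemma restrStar_zStar : restrStar E k (zStar (E × (Fin k → ℂ))) = (zStar E : HolOStar E) := rfl

lemma deriv_restrStar (v : E) (f : HolOStar (E × (Fin k → ℂ))) :
    HolGerm.deriv ((0, v) : ℂ × E) (restrStar E k f) =
      restrStar E k (HolGerm.deriv ((0, (v, 0)) : ℂ × (E × (Fin k → ℂ))) f) :=
  HolGerm.deriv_pullback _ _ _ _

lemma deriv_z_restrStar (f : HolOStar (E × (Fin k → ℂ))) :
    HolGerm.deriv ((1, 0) : ℂ × E) (restrStar E k f) =
      restrStar E k (HolGerm.deriv ((1, 0) : ℂ × (E × (Fin k → ℂ))) f) :=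
  HolGerm.deriv_pullback _ _ _ _

/-- The projection `(z, (t, s)) ↦ (z, t)`. -/
def projE (E : Type*) [NormedAddCommGroup E] [NormedSpace ℂ E] (k : ℕ) :
    ℂ × (E × (Fin k → ℂ)) →L[ℂ] ℂ × E :=
  (ContinuousLinearMap.id ℂ ℂ).prodMap (ContinuousLinearMap.fst ℂ E (Fin k → ℂ))

lemma tendsto_projE_punctured :
    Tendsto (projE E k) (puncturedNhds (E × (Fin k → ℂ))) (puncturedNhds E) := by
  refine tendsto_nhdsWithin_iff.2 ⟨?_, ?_⟩
  · have := (projE E k).continuous.tendsto 0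
    rw [map_zero] at this
    exact this.mono_left nhdsWithin_le_nhds
  · filter_upwards [self_mem_nhdsWithin] with p hp
    simpa [projE] using hp

lemma restr_surjective : Function.Surjective (restr E k) := by
  intro f
  refine ⟨HolGerm.pullback (projE E k) (by simpa using (projE E k).continuous.tendsto 0) f, ?_⟩
  obtain ⟨f, hf, rfl⟩ := HolGerm.exists_eq_of f
  rfl

lemma restr_mem_vanishingIdeal_iff {f : HolO (E × (Fin k → ℂ))} :
    restr E k f ∈ vanishingIdeal 0 ↔ f ∈ vanishingIdeal 0 := by
  obtain ⟨f, hf, rfl⟩ := HolGerm.exists_eq_of f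
  change f (incl E k 0) = 0 ↔ f 0 = 0
  rw [map_zero]

/-- The coordinate `s_j` on `ℂ × M × ℂ^k`. -/
def sCoord (E : Type*) [NormedAddCommGroup E] [NormedSpace ℂ E] {k : ℕ} (j : Fin k) :
    HolO (E × (Fin k → ℂ)) :=
  HolGerm.of (fun p => p.2.2 j) (Eventually.of_forall fun _ =>
    ((ContinuousLinearMap.proj (R := ℂ) (φ := fun _ => ℂ) j ∘L
      ContinuousLinearMap.snd ℂ E (Fin k → ℂ)) ∘L
      ContinuousLinearMap.snd ℂ ℂ (E × (Fin k → ℂ))).analyticAt _)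

lemma restr_sCoord (j : Fin k) : restr E k (sCoord E j) = 0 := rfl

lemma deriv_sCoord (c : ℂ) (v : E) (σ : Fin k → ℂ) (j : Fin k) :
    HolGerm.deriv ((c, (v, σ)) : ℂ × (E × (Fin k → ℂ))) (sCoord E j) = HolGerm.const (σ j) :=
  HolGerm.deriv_of_clm (c, (v, σ)) ((ContinuousLinearMap.proj (R := ℂ) (φ := fun _ => ℂ) j ∘L
    ContinuousLinearMap.snd ℂ E (Fin k → ℂ)) ∘L ContinuousLinearMap.snd ℂ ℂ (E × (Fin k → ℂ)))

end RestrictionCalculus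

/-! ### Radial linear differential equations -/

section Radial

open MeasureTheory

variable {E S W : Type*} [NormedAddCommGroup E] [NormedSpace ℂ E]
  [NormedAddCommGroup S] [NormedSpace ℂ S] [NormedAddCommGroup W] [NormedSpace ℂ W]

/-- The radial segment `τ ↦ ((z, (t, τ s)), s)` for `τ ∈ [0, 1]`, as a linear function of the
point `(z, (t, s))`. -/
def radialPath (E S : Type*) [NormedAddCommGroup E] [NormedSpace ℂ E]
    [NormedAddCommGroup S] [NormedSpace ℂ S] :
    ℂ × (E × S) →L[ℂ] C(unitInterval, (ℂ × (E × S)) × S) :=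
  LinearMap.mkContinuous
    { toFun := fun p => ⟨fun τ => ((p.1, (p.2.1, ((τ : ℝ) : ℂ) • p.2.2)), p.2.2), by fun_prop⟩
      map_add' := fun p q => by ext τ <;> simp
      map_smul' := fun c p => by
        ext τ <;> simp [smul_comm c] } 1 (fun p => by
      rw [ContinuousMap.norm_le _ (by positivity), one_mul]
      intro τ
      have h1 : ‖((τ : ℝ) : ℂ) • p.2.2‖ ≤ ‖p.2.2‖ := by
        rw [norm_smul, Complex.norm_real, Real.norm_eq_abs, abs_of_nonneg τ.2.1]
        exact mul_le_of_le_one_left (norm_nonneg _) τ.2.2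
      have h2 : ‖p.2.1‖ ≤ ‖p‖ := (norm_fst_le p.2).trans (norm_snd_le p)
      have h3 : ‖p.2.2‖ ≤ ‖p‖ := (norm_snd_le p.2).trans (norm_snd_le p)
      exact max_le (max_le (norm_fst_le p) (max_le h2 (h1.trans h3))) h3)

lemma norm_radialPath_le (p : ℂ × (E × S)) : ‖radialPath E S p‖ ≤ ‖p‖ := by
  simpa using (radialPath E S).le_of_opNorm_le (LinearMap.mkContinuous_norm_le _ zero_le_one _) p

/-- Constant functions, as a continuous linear map. -/
def constMap (W : Type*) [NormedAddCommGroup W] [NormedSpace ℂ W] :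
    W →L[ℂ] C(unitInterval, W) :=
  LinearMap.mkContinuous
    { toFun := fun w => ContinuousMap.const _ w
      map_add' := fun _ _ => rfl
      map_smul' := fun _ _ => rfl } 1 (fun w => by
      rw [ContinuousMap.norm_le _ (by positivity), one_mul]
      exact fun _ => le_rfl)

variable [CompleteSpace W]

/-- The solution operator of `g(τ) = w + ∫₀^τ Λ(μ) g(μ) dμ`. -/
def volterraSolution (Λ : C(unitInterval, W →L[ℂ] W)) : W →L[ℂ] C(unitInterval, W) :=
  Ring.inverse (1 - volterra W Λ) ∘L constMap W

lemma volterraSolution_eq (Λ : C(unitInterval, W →L[ℂ] W)) (w : W) (τ : unitInterval) :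
    volterraSolution Λ w τ = w + ∫ μ in (0 : ℝ)..τ,
      Set.IccExtend zero_le_one Λ μ (Set.IccExtend zero_le_one (volterraSolution Λ w) μ) := by
  have h := congrArg (fun A : C(unitInterval, W) →L[ℂ] C(unitInterval, W) => A (constMap W w))
    (Ring.mul_inverse_cancel _ (isUnit_one_sub_volterra Λ))
  have h2 : volterraSolution Λ w - volterra W Λ (volterraSolution Λ w) = constMap W w := h
  have h3 := congrArg (fun g : C(unitInterval, W) => g τ) h2
  simp only [ContinuousMap.sub_apply, volterra_apply] at h3
  exact sub_eq_iff_eq_add.1 h3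

lemma eq_volterraSolution (Λ : C(unitInterval, W →L[ℂ] W)) (w : W) (g : C(unitInterval, W))
    (h : ∀ τ : unitInterval, g τ = w + ∫ μ in (0 : ℝ)..τ,
      Set.IccExtend zero_le_one Λ μ (Set.IccExtend zero_le_one g μ)) :
    g = volterraSolution Λ w := by
  have h2 : (1 - volterra W Λ) g = constMap W w := by
    ext τ
    change g τ - volterra W Λ g τ = w
    rw [volterra_apply, h τ, add_sub_cancel_right]
  have h3 := congrArg (fun A : C(unitInterval, W) →L[ℂ] C(unitInterval, W) => A g)
    (Ring.inverse_mul_cancel _ (isUnit_one_sub_volterra Λ))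
  change Ring.inverse (1 - volterra W Λ) ((1 - volterra W Λ) g) = g at h3
  rw [← h3, h2]
  rfl

/-- The rescaled solution of a Volterra equation solves the rescaled equation. -/
lemma volterraSolution_rescale (Λ Λ' : C(unitInterval, W →L[ℂ] W)) (θ : unitInterval)
    (hΛ : ∀ τ, Λ' τ = (θ : ℝ) • Λ (θ * τ)) (w : W) (τ : unitInterval) :
    volterraSolution Λ' w τ = volterraSolution Λ w (θ * τ) := by
  let g : C(unitInterval, W) := ⟨fun τ => volterraSolution Λ w (θ * τ), by fun_prop⟩
  suffices h : g = volterraSolution Λ' w by rw [← h]; rfl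
  refine eq_volterraSolution _ _ _ fun τ => ?_
  change volterraSolution Λ w (θ * τ) = _
  rw [volterraSolution_eq]
  congr 1
  have e2 := intervalIntegral.smul_integral_comp_mul_left (a := 0) (b := τ)
    (fun μ => Set.IccExtend zero_le_one Λ μ
      (Set.IccExtend zero_le_one (volterraSolution Λ w) μ)) (θ : ℝ)
  rw [mul_zero] at e2
  rw [Set.Icc.coe_mul, ← e2, ← intervalIntegral.integral_smul]
  refine intervalIntegral.integral_congr fun μ hμ => ?_
  rw [Set.uIcc_of_le τ.2.1] at hμ
  have hμ' : μ ∈ Set.Icc (0 : ℝ) 1 := ⟨hμ.1, hμ.2.trans τ.2.2⟩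
  have hθμ : (θ : ℝ) * μ ∈ Set.Icc (0 : ℝ) 1 := (θ * ⟨μ, hμ'⟩ : unitInterval).2
  simp only [Set.IccExtend_of_mem _ _ hμ', Set.IccExtend_of_mem _ _ hθμ, hΛ]
  rfl

/-- A radial linear system `z ∂_s Φ = 𝓛(z, t, s)(s) Φ` (with `∂_s` the derivative in the radial
direction) has a fundamental solution that is analytic for `z ≠ 0` on a neighbourhood of
the origin, with `Φ = 1` for `s = 0`. -/
theorem exists_radial_fundamental_solution {𝓛 : ℂ × (E × S) → S →L[ℂ] W →L[ℂ] W}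
    (h𝓛 : AnalyticAt ℂ 𝓛 0) :
    ∃ (Φ : ℂ × (E × S) → W →L[ℂ] W), ∀ᶠ p in 𝓝 (0 : ℂ × (E × S)),
      (p.2.2 = 0 → Φ p = 1) ∧ (p.1 ≠ 0 → AnalyticAt ℂ Φ p ∧
        ∀ w, fderiv ℂ Φ p (0, (0, p.2.2)) w = p.1⁻¹ • 𝓛 p p.2.2 (Φ p w)) := by
  have hf : AnalyticAt ℂ (fun q : (ℂ × (E × S)) × S => 𝓛 q.1 q.2) 0 :=
    ((ContinuousLinearMap.id ℂ (S →L[ℂ] W →L[ℂ] W)).analyticAt_bilinear _).comp₂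
      (h𝓛.comp (f := Prod.fst) (x := (0 : (ℂ × (E × S)) × S)) analyticAt_fst) analyticAt_snd
  obtain ⟨F, r, hr, hF⟩ := exists_analyticAt_comp (K := unitInterval) hf
  have hF' : ∀ p : ℂ × (E × S), ‖p‖ < r → AnalyticAt ℂ F (radialPath E S p) ∧
      ∀ τ : unitInterval, F (radialPath E S p) τ =
        𝓛 (p.1, (p.2.1, ((τ : ℝ) : ℂ) • p.2.2)) p.2.2 := by
    intro p hp
    refine hF _ (lt_of_le_of_lt ?_ hp)
    have : ContinuousMap.const unitInterval (0 : (ℂ × (E × S)) × S) = 0 := rfl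
    rw [this, sub_zero]
    exact norm_radialPath_le p
  -- the coefficient of the system on the segment from `(z, t, 0)` to `p`, parametrized by `[0, 1]`
  let Λ : ℂ × (E × S) → C(unitInterval, W →L[ℂ] W) := fun p => p.1⁻¹ • F (radialPath E S p)
  let Φ : ℂ × (E × S) → W →L[ℂ] W := fun p =>
    ContinuousMap.evalCLM ℂ (1 : unitInterval) ∘L volterraSolution (Λ p)
  refine ⟨Φ, ?_⟩
  filter_upwards [Metric.ball_mem_nhds (0 : ℂ × (E × S)) hr] with p hp
  rw [mem_ball_zero_iff] at hp
  refine ⟨fun hs => ?_, fun hz => ?_⟩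
  · have h0 : Λ p = 0 := by
      ext1 τ
      change p.1⁻¹ • F (radialPath E S p) τ = 0
      rw [(hF' p hp).2, hs, map_zero, smul_zero]
    ext w
    change volterraSolution (Λ p) w 1 = w
    rw [h0, volterraSolution_eq]
    have : ∀ μ : ℝ, Set.IccExtend zero_le_one (0 : C(unitInterval, W →L[ℂ] W)) μ = 0 :=
      fun _ => rfl
    simp only [this, _root_.zero_apply, intervalIntegral.integral_zero, add_zero]
  have han : AnalyticAt ℂ Φ p := by
    have h1 : AnalyticAt ℂ Λ p := (analyticAt_fst.inv hz).smul
      ((hF' p hp).1.comp ((radialPath E S).analyticAt p))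
    have hV : AnalyticAt ℂ (volterra W) (Λ p) :=
      ContinuousLinearMap.analyticAt (𝕜 := ℂ) (E := C(unitInterval, W →L[ℂ] W))
        (F := C(unitInterval, W) →L[ℂ] C(unitInterval, W)) (volterra W) (Λ p)
    have h2 : AnalyticAt ℂ (fun q => 1 - volterra W (Λ q)) p :=
      analyticAt_const.sub (hV.comp h1)
    have h3 : AnalyticAt ℂ (fun q => Ring.inverse (1 - volterra W (Λ q))) p := by
      have hinv : AnalyticAt ℂ (Ring.inverse (M₀ := C(unitInterval, W) →L[ℂ] C(unitInterval, W)))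
          (1 - volterra W (Λ p)) := analyticOnNhd_inverse (𝕜 := ℂ)
            (A := C(unitInterval, W) →L[ℂ] C(unitInterval, W)) _ (isUnit_one_sub_volterra (Λ p))
      exact hinv.comp (f := fun q => 1 - volterra W (Λ q)) h2
    let L₁ := (ContinuousLinearMap.compL ℂ W C(unitInterval, W) C(unitInterval, W)).flip
      (constMap W)
    let L₂ := ContinuousLinearMap.compL ℂ W C(unitInterval, W) W
      (ContinuousMap.evalCLM ℂ (1 : unitInterval))
    have h4 := (L₁.analyticAt (F := W →L[ℂ] C(unitInterval, W)) _).comp h3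
    exact (L₂.analyticAt (E := W →L[ℂ] C(unitInterval, W)) (F := W →L[ℂ] W) _).comp h4
  refine ⟨han, fun w => ?_⟩
  -- along the segment from `(z, t, 0)` to `p`, the function `Φ` is the Volterra solution for `p`
  have hray : ∀ θ : unitInterval, Φ (p.1, (p.2.1, ((θ : ℝ) : ℂ) • p.2.2)) w =
      volterraSolution (Λ p) w θ := by
    intro θ
    have hq : ‖(p.1, (p.2.1, ((θ : ℝ) : ℂ) • p.2.2))‖ < r :=
      lt_of_le_of_lt ((norm_fst_le (radialPath E S p θ)).trans
        (((radialPath E S p).norm_coe_le_norm θ).trans (norm_radialPath_le p))) hp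
    have := volterraSolution_rescale (Λ p) (Λ (p.1, (p.2.1, ((θ : ℝ) : ℂ) • p.2.2))) θ
      (fun τ => by
        change p.1⁻¹ • F (radialPath E S _) τ = (θ : ℝ) • p.1⁻¹ • F (radialPath E S p) (θ * τ)
        rw [(hF' _ hq).2, (hF' p hp).2]
        simp only [map_smul, smul_smul, Set.Icc.coe_mul, Complex.ofReal_mul]
        rw [← Complex.coe_smul, smul_smul, mul_comm (p.1⁻¹), mul_comm ((τ : ℝ) : ℂ)]) w 1
    rw [mul_one] at this
    exact this
  have hd1 : HasDerivAt (fun θ : ℝ => w + ∫ μ in (0 : ℝ)..θ,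
      Set.IccExtend zero_le_one (Λ p) μ
        (Set.IccExtend zero_le_one (volterraSolution (Λ p) w) μ))
      (p.1⁻¹ • 𝓛 p p.2.2 (Φ p w)) 1 := by
    have hcont : Continuous fun μ : ℝ => Set.IccExtend zero_le_one (Λ p) μ
        (Set.IccExtend zero_le_one (volterraSolution (Λ p) w) μ) :=
      (Λ p).continuous.Icc_extend'.clm_apply (volterraSolution (Λ p) w).continuous.Icc_extend'
    have h := (hcont.integral_hasStrictDerivAt 0 1).hasDerivAt.const_add w
    convert! h using 1
    have h1 : (1 : ℝ) ∈ Set.Icc (0 : ℝ) 1 := Set.right_mem_Icc.2 zero_le_one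
    rw [Set.IccExtend_of_mem _ _ h1, Set.IccExtend_of_mem _ _ h1]
    change _ = (p.1⁻¹ • F (radialPath E S p) 1) (Φ p w)
    rw [(hF' p hp).2]
    simp
  have hd2 : HasDerivAt (fun θ : ℝ => Φ (p.1, (p.2.1, (θ : ℂ) • p.2.2)) w)
      (fderiv ℂ Φ p (0, (0, p.2.2)) w) 1 := by
    have hγ : HasDerivAt (fun θ : ℝ => ((p.1, (p.2.1, (θ : ℂ) • p.2.2)) : ℂ × (E × S)))
        (0, (0, p.2.2)) 1 := by
      refine (hasDerivAt_const _ _).prodMk ((hasDerivAt_const _ _).prodMk ?_)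
      simpa using (Complex.ofRealCLM.hasDerivAt (x := (1 : ℝ))).smul_const p.2.2
    have hp1 : ((p.1, (p.2.1, ((1 : ℝ) : ℂ) • p.2.2)) : ℂ × (E × S)) = p := by simp
    have hΦ : HasFDerivAt Φ (fderiv ℂ Φ p) (p.1, (p.2.1, ((1 : ℝ) : ℂ) • p.2.2)) := by
      rw [hp1]; exact han.differentiableAt.hasFDerivAt
    have h3 := (hΦ.restrictScalars ℝ).comp_hasDerivAt (1 : ℝ) hγ
    exact (((ContinuousLinearMap.apply ℂ W w).restrictScalars ℝ).hasFDerivAt).comp_hasDerivAt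
      (1 : ℝ) h3
  have hu : UniqueDiffWithinAt ℝ (Set.Icc (0 : ℝ) 1) 1 :=
    uniqueDiffOn_Icc_zero_one 1 (Set.right_mem_Icc.2 zero_le_one)
  refine hu.eq_deriv _ hd2.hasDerivWithinAt (hd1.hasDerivWithinAt.congr (fun θ hθ => ?_) ?_)
  · rw [hray ⟨θ, hθ⟩, volterraSolution_eq]
  · exact (hray 1).trans (volterraSolution_eq _ _ _)

end Radial

section RadialGerm

variable {E : Type*} [NormedAddCommGroup E] [NormedSpace ℂ E] {k : ℕ}

/-- The direction of the coordinate `s_j`. -/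
abbrev sDir (E : Type*) [NormedAddCommGroup E] [NormedSpace ℂ E] {k : ℕ} (j : Fin k) :
    ℂ × (E × (Fin k → ℂ)) := (0, (0, Pi.single j 1))

lemma sum_smul_sDir (σ : Fin k → ℂ) :
    ∑ j, σ j • sDir E j = ((0, (0, σ)) : ℂ × (E × (Fin k → ℂ))) := by
  have h := (pi_eq_sum_univ' σ).symm
  ext : 1
  · simp [Prod.fst_sum]
  · ext : 1
    · simp [Prod.fst_sum, Prod.snd_sum]
    · simp only [Prod.snd_sum, Prod.smul_snd]
      rw [pi_eq_sum_univ' σ]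
      simp [Pi.single_apply]

lemma HolGerm.sum_of {X ι : Type*} [NormedAddCommGroup X] [NormedSpace ℂ X] {l : Filter X}
    [Fintype ι] {f : ι → X → ℂ} (hf : ∀ i, ∀ᶠ x in l, AnalyticAt ℂ (f i) x) :
    ∑ i, HolGerm.of (f i) (hf i) = HolGerm.of (fun x => ∑ i, f i x) ((eventually_all.2 hf).mono
      fun _ h => Finset.analyticAt_fun_sum _ fun i _ => h i) := by
  apply Subtype.ext
  have h1 := map_sum (HolGerm l).subtype (fun i => HolGerm.of (f i) (hf i)) Finset.univ
  have h2 := map_sum (Germ.coeRingHom l (R := ℂ)) f Finset.univ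
  refine h1.trans (h2.symm.trans ?_)
  change ((∑ i, f i : X → ℂ) : Germ l ℂ) = ((fun x => ∑ i, f i x : X → ℂ) : Germ l ℂ)
  congr 1
  ext x
  simp

lemma toStar_of_mul_of {f g : ℂ × E → ℂ} (hf : ∀ᶠ p in 𝓝 0, AnalyticAt ℂ f p)
    (hg : ∀ᶠ p in puncturedNhds E, AnalyticAt ℂ g p) :
    toStar (HolGerm.of f hf) * HolGerm.of g hg = HolGerm.of (fun p => f p * g p)
      (((hf.filter_mono nhdsWithin_le_nhds).and hg).mono fun _ h => h.1.mul h.2) := rfl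

/-- Existence of solutions of radial linear systems with prescribed restriction to `s = 0`. -/
theorem exists_radial_solution {ι : Type*} [Fintype ι]
    (L : Fin k → ι → ι → HolO (E × (Fin k → ℂ))) (G₀ : ι → HolOStar E) :
    ∃ G : ι → HolOStar (E × (Fin k → ℂ)), (∀ i, restrStar E k (G i) = G₀ i) ∧
      ∀ i, (zStar (E × (Fin k → ℂ)) : HolOStar (E × (Fin k → ℂ))) *
          ∑ l, toStar (sCoord E l) * HolGerm.deriv (sDir E l) (G i) =
          ∑ l, toStar (sCoord E l) * ∑ j, toStar (L l i j) * G j := by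
  classical
  choose f hf hL using fun l i j => HolGerm.exists_eq_of (L l i j)
  choose g₀ hg₀ hG₀ using fun i => HolGerm.exists_eq_of (G₀ i)
  let B : Fin k → ι → ι → (Fin k → ℂ) →L[ℂ] (ι → ℂ) →L[ℂ] (ι → ℂ) := fun l i j =>
    (ContinuousLinearMap.proj (R := ℂ) (φ := fun _ => ℂ) l).smulRight
      ((ContinuousLinearMap.proj (R := ℂ) (φ := fun _ => ℂ) j).smulRight (Pi.single i (1 : ℂ)))
  let 𝓛 : ℂ × (E × (Fin k → ℂ)) → (Fin k → ℂ) →L[ℂ] (ι → ℂ) →L[ℂ] (ι → ℂ) := fun p =>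
    ∑ l, ∑ i, ∑ j, f l i j p • B l i j
  have h𝓛 : AnalyticAt ℂ 𝓛 0 :=
    Finset.analyticAt_fun_sum _ fun l _ => Finset.analyticAt_fun_sum _ fun i _ =>
      Finset.analyticAt_fun_sum _ fun j _ => (ContinuousLinearMap.analyticAt
        (F := (Fin k → ℂ) →L[ℂ] (ι → ℂ) →L[ℂ] (ι → ℂ))
        (ContinuousLinearMap.toSpanSingleton ℂ (B l i j)) _).comp
        (hf l i j).self_of_nhds
  have h𝓛apply : ∀ p s w i, 𝓛 p s w i = ∑ l, s l * ∑ j, f l i j p * w j := by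
    intro p s w i
    simp only [𝓛, B, _root_.sum_apply, _root_.smul_apply,
      ContinuousLinearMap.smulRight_apply, ContinuousLinearMap.proj_apply, Finset.sum_apply,
      Pi.smul_apply, smul_eq_mul, Pi.single_apply, Finset.mul_sum]
    refine Finset.sum_congr rfl fun l _ => ?_
    rw [Finset.sum_comm]
    refine Finset.sum_congr rfl fun j _ => ?_
    simp
    ring
  obtain ⟨Φ, hΦ⟩ := exists_radial_fundamental_solution h𝓛
  -- the initial values do not depend on `s`, so that `Φ G₀` solves the system that `Φ` solves
  let G : ι → ℂ × (E × (Fin k → ℂ)) → ℂ := fun i p => Φ p (fun j => g₀ j (projE E k p)) i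
  have hg₀' : ∀ᶠ p in puncturedNhds (E × (Fin k → ℂ)), ∀ j, AnalyticAt ℂ (g₀ j) (projE E k p) :=
    eventually_all.2 fun j => tendsto_projE_punctured.eventually (hg₀ j)
  have hvec : ∀ p, (∀ j, AnalyticAt ℂ (g₀ j) (projE E k p)) →
      AnalyticAt ℂ (fun p j => g₀ j (projE E k p)) p := fun p hp =>
    AnalyticAt.pi fun j => (hp j).comp ((projE E k).analyticAt p)
  have hΦ' := hΦ.filter_mono (nhdsWithin_le_nhds (s := {p : ℂ × (E × (Fin k → ℂ)) | p.1 ≠ 0}))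
  have hvecG : ∀ᶠ p in puncturedNhds (E × (Fin k → ℂ)), AnalyticAt ℂ (fun p i => G i p) p := by
    filter_upwards [hg₀', hΦ', self_mem_nhdsWithin] with p hp hp2 hz
    exact ((ContinuousLinearMap.id ℂ ((ι → ℂ) →L[ℂ] (ι → ℂ))).analyticAt_bilinear _).comp₂
      (hp2.2 hz).1 (hvec p hp)
  have hGan : ∀ i, ∀ᶠ p in puncturedNhds (E × (Fin k → ℂ)), AnalyticAt ℂ (G i) p := fun i =>
    hvecG.mono fun p hp => (ContinuousLinearMap.proj (R := ℂ) (φ := fun _ : ι => ℂ) i).analyticAt _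
      |>.comp hp
  have hproj : ∀ (F : ℂ × (E × (Fin k → ℂ)) → ι → ℂ) (p v : ℂ × (E × (Fin k → ℂ))) (j : ι),
      DifferentiableAt ℂ F p → fderiv ℂ (fun p => F p j) p v = fderiv ℂ F p v j := by
    intro F p v j hF
    have := ((ContinuousLinearMap.proj (R := ℂ) (φ := fun _ : ι => ℂ) j).hasFDerivAt.comp p
      hF.hasFDerivAt).fderiv
    exact congrArg (fun A => A v) this
  refine ⟨fun i => HolGerm.of (G i) (hGan i), fun i => ?_, fun i => ?_⟩
  · rw [hG₀, restrStar, HolGerm.pullback_of, HolGerm.of_eq_of_iff]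
    filter_upwards [(tendsto_incl_punctured E k).eventually hΦ'] with p hp
    have h1 : Φ (incl E k p) = 1 := hp.1 rfl
    change Φ (incl E k p) _ i = _
    rw [h1]
    rfl
  · have h : ∀ᶠ p in puncturedNhds (E × (Fin k → ℂ)),
        p.1 * ∑ l, p.2.2 l * fderiv ℂ (G i) p (sDir E l) =
          ∑ l, p.2.2 l * ∑ j, f l i j p * G j p := by
      filter_upwards [hg₀', hΦ', self_mem_nhdsWithin, hvecG] with p hp hp2 hz hGp
      have hΦp := (hp2.2 hz).1.differentiableAt
      have hv := (hvec p hp).differentiableAt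
      have e1 : ∑ l, p.2.2 l * fderiv ℂ (G i) p (sDir E l) =
          fderiv ℂ (G i) p (0, (0, p.2.2)) := by
        rw [← sum_smul_sDir, map_sum]
        simp only [map_smul, smul_eq_mul]
      have e2 : fderiv ℂ (fun p j => g₀ j (projE E k p)) p (0, (0, p.2.2)) = 0 := by
        ext j
        rw [← hproj _ _ _ _ hv]
        change fderiv ℂ (g₀ j ∘ projE E k) p (0, (0, p.2.2)) = 0
        rw [fderiv_comp p (hp j).differentiableAt (projE E k).differentiableAt,
          ContinuousLinearMap.fderiv]
        have : projE E k (0, (0, p.2.2)) = 0 := rfl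
        simp [this]
      have e3 : fderiv ℂ (G i) p (0, (0, p.2.2)) =
          fderiv ℂ (fun p i => G i p) p (0, (0, p.2.2)) i :=
        hproj _ _ _ _ hGp.differentiableAt
      have e4 : fderiv ℂ (fun p i => G i p) p (0, (0, p.2.2)) =
          p.1⁻¹ • 𝓛 p p.2.2 (fun i => G i p) := by
        rw [show (fun p i => G i p) = fun p => Φ p (fun j => g₀ j (projE E k p)) from rfl,
          fderiv_clm_apply hΦp hv]
        rw [_root_.add_apply, ContinuousLinearMap.comp_apply, e2, map_zero, zero_add,
          ContinuousLinearMap.flip_apply]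
        exact (hp2.2 hz).2 _
      rw [e1, e3, e4, Pi.smul_apply, smul_eq_mul, h𝓛apply, mul_inv_cancel_left₀ hz]
    simp only [hL, sCoord, HolGerm.deriv_of, toStar_of_mul_of, HolGerm.sum_of]
    rw [← toStar_zO, zO, toStar_of_mul_of]
    exact HolGerm.of_eq_of_iff.2 h

end RadialGerm

/-! ### Removable singularities along `z = 0` detected on the Taylor coefficients -/

section Removable

variable {F : Type*} [NormedAddCommGroup F] [NormedSpace ℂ F]

/-- The derivative in the direction `(0, v)`. -/
def dirDeriv (v : F) (f : ℂ × F → ℂ) : ℂ × F → ℂ := fun p => fderiv ℂ f p (0, v)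

/-- The points `(z, x)` with `z ≠ 0` in the ball of radius `ε`. -/
def slitBall (F : Type*) [NormedAddCommGroup F] (ε : ℝ) : Set (ℂ × F) :=
  {p | ‖p‖ < ε ∧ p.1 ≠ 0}

variable {ε : ℝ} {f : ℂ × F → ℂ}

lemma analyticOnNhd_iterate_dirDeriv (hf : AnalyticOnNhd ℂ f (slitBall F ε)) (v : F) (n : ℕ) :
    AnalyticOnNhd ℂ ((dirDeriv v)^[n] f) (slitBall F ε) := by
  induction n with
  | zero => exact hf
  | succ n ih =>
    rw [Function.iterate_succ_apply']
    intro p hp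
    exact ((ContinuousLinearMap.apply ℂ ℂ ((0, v) : ℂ × F)).analyticAt _).comp (ih p hp).fderiv

lemma line_mem_slitBall {z : ℂ} {x : F} (hz : ‖z‖ < ε) (hz0 : z ≠ 0) (hx : ‖x‖ < ε / 2) {c : ℂ}
    (hc : ‖c‖ < 2) : (z, c • x) ∈ slitBall F ε := by
  refine ⟨max_lt hz ?_, hz0⟩
  change ‖c • x‖ < ε
  rw [norm_smul]
  nlinarith [norm_nonneg x, norm_nonneg c]

lemma hasDerivAt_line {z : ℂ} {x : F} {c : ℂ} (hf : DifferentiableAt ℂ f (z, c • x)) :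
    HasDerivAt (fun c : ℂ => f (z, c • x)) (dirDeriv x f (z, c • x)) c := by
  have h : HasDerivAt (fun c : ℂ => ((z, c • x) : ℂ × F)) (0, x) c := by
    refine (hasDerivAt_const _ _).prodMk ?_
    simpa using (hasDerivAt_id c).smul_const x
  exact hf.hasFDerivAt.comp_hasDerivAt c h

lemma differentiableOn_line (hf : AnalyticOnNhd ℂ f (slitBall F ε)) {z : ℂ} {x : F}
    (hz : ‖z‖ < ε) (hz0 : z ≠ 0) (hx : ‖x‖ < ε / 2) :
    DifferentiableOn ℂ (fun c : ℂ => f (z, c • x)) (Metric.ball 0 2) := fun _ hc =>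
  (hasDerivAt_line (hf _ (line_mem_slitBall hz hz0 hx
    (mem_ball_zero_iff.1 hc))).differentiableAt).differentiableAt.differentiableWithinAt

lemma iteratedDeriv_line (hf : AnalyticOnNhd ℂ f (slitBall F ε)) {z : ℂ} {x : F}
    (hz : ‖z‖ < ε) (hz0 : z ≠ 0) (hx : ‖x‖ < ε / 2) (n : ℕ) {c : ℂ} (hc : ‖c‖ < 2) :
    iteratedDeriv n (fun c : ℂ => f (z, c • x)) c = (dirDeriv x)^[n] f (z, c • x) := by
  induction n generalizing c with
  | zero => simp
  | succ n ih =>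
    rw [iteratedDeriv_succ, Function.iterate_succ_apply']
    have h : iteratedDeriv n (fun c : ℂ => f (z, c • x)) =ᶠ[𝓝 c]
        fun c => (dirDeriv x)^[n] f (z, c • x) := by
      filter_upwards [isOpen_lt continuous_norm continuous_const |>.mem_nhds hc] with c' hc'
      exact ih hc'
    rw [h.deriv_eq]
    exact (hasDerivAt_line (analyticOnNhd_iterate_dirDeriv hf x n _
      (line_mem_slitBall hz hz0 hx hc)).differentiableAt).deriv

/-- The homogeneous terms in `x` of the Taylor expansion of `f(z, x)` at `x = 0`. -/
def taylorTerm (f : ℂ × F → ℂ) (x : F) (n : ℕ) (z : ℂ) : ℂ :=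
  (n.factorial : ℂ)⁻¹ * (dirDeriv x)^[n] f (z, 0)

lemma hasSum_taylorTerm (hf : AnalyticOnNhd ℂ f (slitBall F ε)) {z : ℂ} {x : F}
    (hz : ‖z‖ < ε) (hz0 : z ≠ 0) (hx : ‖x‖ < ε / 2) :
    HasSum (fun n => taylorTerm f x n z) (f (z, x)) := by
  have h := Complex.hasSum_taylorSeries_on_ball (c := 0) (z := 1) (r := 2)
    (differentiableOn_line hf hz hz0 hx) (by simp)
  simpa [iteratedDeriv_line hf hz hz0 hx, taylorTerm] using h

lemma norm_taylorTerm_le (hf : AnalyticOnNhd ℂ f (slitBall F ε)) {z : ℂ} {x : F}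
    (hz : ‖z‖ < ε) (hz0 : z ≠ 0) (hx : ‖x‖ < ε / 2) {M : ℝ}
    (hM : ∀ c : ℂ, ‖c‖ = 3 / 2 → ‖f (z, c • x)‖ ≤ M) (n : ℕ) :
    ‖taylorTerm f x n z‖ ≤ M / (3 / 2) ^ n := by
  have h := Complex.norm_iteratedDeriv_le_of_forall_mem_sphere_norm_le (c := 0) (R := 3 / 2) n
    (by norm_num) (((differentiableOn_line hf hz hz0 hx).mono (fun c hc => by
      rw [mem_closedBall_zero_iff] at hc
      rw [mem_ball_zero_iff]
      linarith)).diffContOnCl_ball (U := Metric.closedBall 0 (3 / 2)) subset_rfl)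
    (fun c hc => hM c (by simpa using hc))
  rw [iteratedDeriv_line hf hz hz0 hx n (by simp), zero_smul] at h
  rw [taylorTerm, norm_mul, norm_inv, Complex.norm_natCast, inv_mul_le_iff₀ (by positivity)]
  linarith [h, (mul_div_assoc (n.factorial : ℝ) M ((3 / 2) ^ n)).le]

lemma differentiableAt_taylorTerm (hf : AnalyticOnNhd ℂ f (slitBall F ε)) {z : ℂ}
    (hz : ‖z‖ < ε) (hz0 : z ≠ 0) (x : F) (n : ℕ) :
    DifferentiableAt ℂ (taylorTerm f x n) z := by
  have hmem : ((z, 0) : ℂ × F) ∈ slitBall F ε := by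
    refine ⟨max_lt hz ?_, hz0⟩
    simpa using (norm_nonneg z).trans_lt hz
  refine DifferentiableAt.const_mul ?_ _
  exact (analyticOnNhd_iterate_dirDeriv hf x n _ hmem).differentiableAt.comp z
    (f := fun z : ℂ => ((z, 0) : ℂ × F)) (by fun_prop)

/-- If the Taylor terms of `f(z, x)` at `x = 0` extend holomorphically to `z = 0`, then they
extend to holomorphic functions on a disc that does not depend on the term. -/
lemma exists_extension_taylorTerm (hf : AnalyticOnNhd ℂ f (slitBall F ε)) (x : F) (n : ℕ)
    {b : ℂ → ℂ} (hb : AnalyticAt ℂ b 0) (hfb : ∀ᶠ z in 𝓝[≠] 0, (dirDeriv x)^[n] f (z, 0) = b z) :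
    ∃ a : ℂ → ℂ, DifferentiableOn ℂ a (Metric.ball 0 ε) ∧ (∀ z ≠ 0, a z = taylorTerm f x n z) ∧
      a =ᶠ[𝓝 0] fun z => (n.factorial : ℂ)⁻¹ * b z := by
  classical
  let a := Function.update (taylorTerm f x n) 0 ((n.factorial : ℂ)⁻¹ * b 0)
  have ha : ∀ z ≠ 0, a z = taylorTerm f x n z := fun z hz => Function.update_of_ne hz _ _
  have hab : a =ᶠ[𝓝 0] fun z => (n.factorial : ℂ)⁻¹ * b z := by
    filter_upwards [eventually_nhdsWithin_iff.1 hfb] with z hz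
    by_cases h : z = 0
    · rw [h]; exact Function.update_self _ _ _
    · rw [ha z h, taylorTerm, hz h]
  refine ⟨a, fun z hz => DifferentiableAt.differentiableWithinAt ?_, ha, hab⟩
  by_cases h : z = 0
  · rw [h]
    exact (hab.differentiableAt_iff).2 (hb.differentiableAt.const_mul _)
  · refine DifferentiableAt.congr_of_eventuallyEq
      (differentiableAt_taylorTerm hf (mem_ball_zero_iff.1 hz) h x n) ?_
    filter_upwards [isOpen_ne.mem_nhds h] with w hw using ha w hw

/-- For fixed `x`, the function `f(·, x)` extends holomorphically to `z = 0` as soon as its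
Taylor terms in `x` do. -/
lemma exists_extension_of_taylorTerm (hf : AnalyticOnNhd ℂ f (slitBall F ε)) {x : F}
    (hx : ‖x‖ < ε / 2) (hb : ∀ n, ∃ b : ℂ → ℂ, AnalyticAt ℂ b 0 ∧
      ∀ᶠ z in 𝓝[≠] 0, (dirDeriv x)^[n] f (z, 0) = b z) :
    ∃ B : ℂ → ℂ, DifferentiableOn ℂ B (Metric.ball 0 (ε / 2)) ∧
      ∀ z, ‖z‖ < ε / 2 → z ≠ 0 → B z = f (z, x) := by
  have hε : 0 < ε / 2 := (norm_nonneg x).trans_lt hx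
  choose b hb1 hb2 using hb
  choose a ha1 ha2 ha3 using fun n => exists_extension_taylorTerm hf x n (hb1 n) (hb2 n)
  obtain ⟨M, hM⟩ : ∃ M, ∀ q ∈ Metric.sphere (0 : ℂ) (ε / 2) ×ˢ Metric.sphere (0 : ℂ) (3 / 2),
      ‖f (q.1, q.2 • x)‖ ≤ M := by
    refine ((isCompact_sphere _ _).prod (isCompact_sphere _ _)).exists_bound_of_continuousOn ?_
    rintro ⟨ζ, c⟩ ⟨hζ, hc⟩
    rw [mem_sphere_zero_iff_norm] at hζ hc
    dsimp only at hζ hc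
    have h := hf _ (line_mem_slitBall (z := ζ) (x := x) (c := c) (by linarith)
      (norm_pos_iff.1 (by linarith)) hx (by linarith))
    exact (h.continuousAt.comp (f := fun q : ℂ × ℂ => (q.1, q.2 • x)) (x := (ζ, c))
      (by fun_prop)).continuousWithinAt
  -- the bound on the circle `|z| = ε / 2` propagates to the disc by the maximum principle
  have hbound : ∀ n, ∀ z ∈ Metric.ball (0 : ℂ) (ε / 2), ‖a n z‖ ≤ M / (3 / 2) ^ n := by
    intro n z hz
    refine Complex.norm_le_of_forall_mem_frontier_norm_le Metric.isBounded_ball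
      (((ha1 n).mono (fun w hw => ?_)).diffContOnCl_ball
        (U := Metric.closedBall 0 (ε / 2)) subset_rfl) (fun w hw => ?_) (subset_closure hz)
    · rw [mem_closedBall_zero_iff] at hw
      rw [mem_ball_zero_iff]
      linarith
    · rw [frontier_ball _ hε.ne', mem_sphere_zero_iff_norm] at hw
      have hw0 : w ≠ 0 := norm_pos_iff.1 (by linarith)
      rw [ha2 n w hw0]
      exact norm_taylorTerm_le hf (by linarith) hw0 hx
        (fun c hc => hM (w, c) ⟨by simpa using hw, by simpa using hc⟩) n
  have hsummable : Summable fun n : ℕ => M / (3 / 2 : ℝ) ^ n := by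
    have := (summable_geometric_of_lt_one (r := (2 / 3 : ℝ)) (by norm_num) (by norm_num)).mul_left M
    refine this.congr fun n => ?_
    rw [div_eq_mul_inv M, ← inv_pow, inv_div]
  refine ⟨fun z => ∑' n, a n z, Complex.differentiableOn_tsum_of_summable_norm hsummable
    (fun n => (ha1 n).mono (Metric.ball_subset_ball (by linarith))) Metric.isOpen_ball hbound,
    fun z hz hz0 => ?_⟩
  simp only [ha2 _ z hz0]
  exact (hasSum_taylorTerm hf (by linarith) hz0 hx).tsum_eq

/-- A function that is holomorphic for `z ≠ 0` extends to `z = 0` if all its Taylor coefficients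
at `x = 0` do: the extension is given by the Cauchy integral in `z`. -/
theorem exists_extension (hε : 0 < ε) (hf : AnalyticOnNhd ℂ f (slitBall F ε))
    (hb : ∀ (x : F) (n : ℕ), ∃ b : ℂ → ℂ, AnalyticAt ℂ b 0 ∧
      ∀ᶠ z in 𝓝[≠] 0, (dirDeriv x)^[n] f (z, 0) = b z) :
    ∃ h : ℂ × F → ℂ, AnalyticAt ℂ h 0 ∧ f =ᶠ[puncturedNhds F] h := by
  let h : ℂ × F → ℂ := fun p =>
    (2 * Real.pi * Complex.I : ℂ)⁻¹ • ∮ ζ in C(0, ε / 4), (ζ - p.1)⁻¹ • f (ζ, p.2)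
  refine ⟨h, ?_, ?_⟩
  · refine AnalyticAt.smul (A := ℂ) analyticAt_const (analyticAt_circleIntegral
      (F := fun q : ℂ × (ℂ × F) => (q.1 - q.2.1)⁻¹ • f (q.1, q.2.2)) fun ζ hζ => ?_)
    rw [mem_sphere_zero_iff_norm, abs_of_pos (by linarith)] at hζ
    have hζ0 : ζ ≠ 0 := norm_pos_iff.1 (by linarith)
    have h1 : AnalyticAt ℂ (fun q : ℂ × (ℂ × F) => q.1 - q.2.1) (ζ, 0) :=
      ((ContinuousLinearMap.fst ℂ ℂ (ℂ × F)).analyticAt _).sub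
        (((ContinuousLinearMap.fst ℂ ℂ F).comp (ContinuousLinearMap.snd ℂ ℂ (ℂ × F))).analyticAt _)
    have h2 : AnalyticAt ℂ (fun q : ℂ × (ℂ × F) => (q.1, q.2.2)) (ζ, 0) :=
      ((ContinuousLinearMap.fst ℂ ℂ (ℂ × F)).prod
        ((ContinuousLinearMap.snd ℂ ℂ F).comp (ContinuousLinearMap.snd ℂ ℂ (ℂ × F)))).analyticAt _
    refine (h1.inv (by simpa using hζ0)).smul (AnalyticAt.comp (g := f) ?_ h2)
    refine hf _ ⟨max_lt (by simp only [hζ]; linarith) ?_, hζ0⟩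
    simpa using hε
  · have hmem : ∀ᶠ p in puncturedNhds F, ‖p‖ < ε / 4 :=
      nhdsWithin_le_nhds ((isOpen_lt continuous_norm continuous_const).mem_nhds (by simpa using hε))
    filter_upwards [hmem, self_mem_nhdsWithin] with p hp hp0
    have hx : ‖p.2‖ < ε / 2 := (norm_snd_le p).trans_lt (by linarith)
    have hz : ‖p.1‖ < ε / 4 := (norm_fst_le p).trans_lt hp
    obtain ⟨B, hB, hBf⟩ := exists_extension_of_taylorTerm hf hx (hb p.2)
    have hcauchy := DiffContOnCl.circleIntegral_sub_inv_smul
      ((hB.mono (fun w hw => by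
        rw [mem_closedBall_zero_iff] at hw
        rw [mem_ball_zero_iff]
        linarith)).diffContOnCl_ball (U := Metric.closedBall 0 (ε / 4)) subset_rfl)
      (mem_ball_zero_iff.2 hz)
    rw [← hBf p.1 (by linarith) hp0]
    rw [eq_comm, ← eq_inv_smul_iff₀ Complex.two_pi_I_ne_zero] at hcauchy
    rw [hcauchy]
    change _ = (2 * Real.pi * Complex.I : ℂ)⁻¹ • _
    congr 1
    refine circleIntegral.integral_congr (by linarith) fun ζ hζ => ?_
    rw [mem_sphere_zero_iff_norm] at hζ
    simp only [hBf ζ (by linarith) (norm_pos_iff.1 (by linarith))]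

/-- A function that is holomorphic for `z ≠ 0` vanishes if all its Taylor coefficients
at `x = 0` vanish near `z = 0`. -/
theorem eventuallyEq_zero_of_taylor (hε : 0 < ε) (hf : AnalyticOnNhd ℂ f (slitBall F ε))
    (hb : ∀ (x : F) (n : ℕ), ∀ᶠ z in 𝓝[≠] 0, (dirDeriv x)^[n] f (z, 0) = 0) :
    f =ᶠ[puncturedNhds F] 0 := by
  have hmem : ∀ᶠ p in puncturedNhds F, ‖p‖ < ε / 2 :=
    nhdsWithin_le_nhds ((isOpen_lt continuous_norm continuous_const).mem_nhds (by simpa using hε))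
  filter_upwards [hmem, self_mem_nhdsWithin] with p hp hp0
  have hx : ‖p.2‖ < ε / 2 := (norm_snd_le p).trans_lt hp
  have hz : ‖p.1‖ < ε := (norm_fst_le p).trans_lt (by linarith)
  refine (hasSum_taylorTerm hf hz hp0 hx).unique ?_
  convert! hasSum_zero with n
  obtain ⟨a, ha1, ha2, ha3⟩ := exists_extension_taylorTerm hf p.2 n
    (b := fun _ => 0) analyticAt_const (hb p.2 n)
  have h := (ha1.analyticOnNhd Metric.isOpen_ball).eqOn_zero_of_preconnected_of_eventuallyEq_zero
    (convex_ball _ _).isPreconnected (Metric.mem_ball_self hε) (ha3.trans (by simp; rfl))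
  rw [← ha2 p.1 hp0]
  exact h (mem_ball_zero_iff.2 hz)

end Removable

section TaylorGerm

variable {E : Type*} [NormedAddCommGroup E] [NormedSpace ℂ E]

lemma exists_analyticOnNhd_slitBall {f : ℂ × E → ℂ}
    (hf : ∀ᶠ p in puncturedNhds E, AnalyticAt ℂ f p) :
    ∃ ε > 0, AnalyticOnNhd ℂ f (slitBall E ε) := by
  obtain ⟨ε, hε, h⟩ := Metric.eventually_nhds_iff.1 (eventually_nhdsWithin_iff.1 hf)
  exact ⟨ε, hε, fun p hp => h (by simpa using hp.1) hp.2⟩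

lemma iterate_deriv_of {f : ℂ × E → ℂ} (hf : ∀ᶠ p in puncturedNhds E, AnalyticAt ℂ f p) (v : E)
    (n : ℕ) : ∃ h, (HolGerm.deriv ((0, v) : ℂ × E))^[n] (HolGerm.of f hf) =
      HolGerm.of ((dirDeriv v)^[n] f) h := by
  induction n with
  | zero => exact ⟨hf, rfl⟩
  | succ n ih =>
    obtain ⟨h, ih⟩ := ih
    simp only [Function.iterate_succ_apply', ih]
    exact ⟨h.mono fun _ h => (ContinuousLinearMap.apply ℂ ℂ ((0, v) : ℂ × E)).analyticAt _
      |>.comp h.fderiv, rfl⟩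

lemma tendsto_axis {F : Type*} [NormedAddCommGroup F] :
    Tendsto (fun z : ℂ => ((z, 0) : ℂ × F)) (𝓝[≠] 0) (puncturedNhds F) := by
  refine tendsto_nhdsWithin_iff.2 ⟨?_, ?_⟩
  · exact (Continuous.tendsto (by fun_prop) (0 : ℂ)).mono_left nhdsWithin_le_nhds
  · exact self_mem_nhdsWithin

variable {k : ℕ}

/-- A germ on `{z ≠ 0}` extends holomorphically to `z = 0` if the restrictions to `s = 0` of all
its derivatives do. -/
theorem mem_range_toStar_of_restrStar (g : HolOStar (E × (Fin k → ℂ)))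
    (hg : ∀ (v : E × (Fin k → ℂ)) (n : ℕ),
      ∃ h, restrStar E k ((HolGerm.deriv ((0, v) : ℂ × (E × (Fin k → ℂ))))^[n] g) = toStar h) :
    ∃ h, g = toStar h := by
  obtain ⟨f, hf, rfl⟩ := HolGerm.exists_eq_of g
  obtain ⟨ε, hε, hfε⟩ := exists_analyticOnNhd_slitBall hf
  obtain ⟨h, hh, hfh⟩ := exists_extension hε hfε fun v n => by
    obtain ⟨h, hh⟩ := hg v n
    obtain ⟨h', e⟩ := iterate_deriv_of hf v n
    obtain ⟨b, hb, rfl⟩ := HolGerm.exists_eq_of h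
    rw [e, restrStar, HolGerm.pullback_of, toStar_of, HolGerm.of_eq_of_iff] at hh
    exact ⟨fun z => b (z, 0), hb.self_of_nhds.comp (f := fun z : ℂ => ((z, 0) : ℂ × E))
      (analyticAt_id.prod analyticAt_const), tendsto_axis.eventually hh⟩
  refine ⟨HolGerm.of h hh.eventually_analyticAt, ?_⟩
  rw [toStar_of, HolGerm.of_eq_of_iff]
  exact hfh

/-- A germ on `{z ≠ 0}` vanishes if the restrictions to `s = 0` of all its derivatives do. -/
theorem eq_zero_of_restrStar (g : HolOStar (E × (Fin k → ℂ)))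
    (hg : ∀ (v : E × (Fin k → ℂ)) (n : ℕ),
      restrStar E k ((HolGerm.deriv ((0, v) : ℂ × (E × (Fin k → ℂ))))^[n] g) = 0) :
    g = 0 := by
  obtain ⟨f, hf, rfl⟩ := HolGerm.exists_eq_of g
  obtain ⟨ε, hε, hfε⟩ := exists_analyticOnNhd_slitBall hf
  refine (HolGerm.of_eq_of_iff (hg := Eventually.of_forall fun _ => analyticAt_const)).2
    (eventuallyEq_zero_of_taylor hε hfε fun v n => ?_)
  have hh := hg v n
  obtain ⟨h', e⟩ := iterate_deriv_of hf v n
  rw [e, restrStar, HolGerm.pullback_of] at hh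
  exact tendsto_axis.eventually ((HolGerm.of_eq_of_iff
    (hg := Eventually.of_forall fun _ => analyticAt_const)).1 hh)

end TaylorGerm

/-! ### Jets along `s = 0` -/

section Jets

variable {E : Type*} [NormedAddCommGroup E] [NormedSpace ℂ E] {k : ℕ}

/-- The germs on `{z ≠ 0}` whose derivatives of order `≤ m` in the directions of the coordinates
`s_j` have a restriction to `s = 0` that lies in `𝒱`. -/
def JetIn (𝒱 : AddSubgroup (HolOStar E)) : ℕ → HolOStar (E × (Fin k → ℂ)) → Prop
  | 0, g => restrStar E k g ∈ 𝒱
  | m + 1, g => restrStar E k g ∈ 𝒱 ∧ ∀ j, JetIn 𝒱 m (HolGerm.deriv (sDir E j) g)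

/-- Subgroups of `𝒪_{ℂ* × M, 0}` that are stable under multiplication with `𝒪_{ℂ × M, 0}`,
under the derivatives in the directions of `M` and under `z ∂/∂z`. -/
structure IsStable (𝒱 : AddSubgroup (HolOStar E)) : Prop where
  toStar_mul : ∀ (f : HolO E), ∀ x ∈ 𝒱, toStar f * x ∈ 𝒱
  deriv : ∀ (v : E), ∀ x ∈ 𝒱, HolGerm.deriv ((0, v) : ℂ × E) x ∈ 𝒱
  deriv_z : ∀ x ∈ 𝒱, (zStar E : HolOStar E) * HolGerm.deriv ((1, 0) : ℂ × E) x ∈ 𝒱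

variable {𝒱 : AddSubgroup (HolOStar E)} {m : ℕ} {g h : HolOStar (E × (Fin k → ℂ))}

lemma JetIn.restrStar_mem (hg : JetIn 𝒱 m g) : restrStar E k g ∈ 𝒱 := by
  cases m with
  | zero => exact hg
  | succ m => exact hg.1

lemma JetIn.of_succ (hg : JetIn 𝒱 (m + 1) g) : JetIn 𝒱 m g := by
  induction m generalizing g with
  | zero => exact hg.1
  | succ m ih => exact ⟨hg.1, fun j => ih (hg.2 j)⟩

variable (𝒱 m) in
lemma JetIn.zero : JetIn 𝒱 m (0 : HolOStar (E × (Fin k → ℂ))) := by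
  induction m with
  | zero => simp [JetIn]
  | succ m ih =>
    refine ⟨by simp, fun j => ?_⟩
    rwa [HolGerm.deriv_zero]

lemma JetIn.add (hg : JetIn 𝒱 m g) (hh : JetIn 𝒱 m h) : JetIn 𝒱 m (g + h) := by
  induction m generalizing g h with
  | zero =>
    change restrStar E k (g + h) ∈ 𝒱
    rw [map_add]
    exact 𝒱.add_mem hg hh
  | succ m ih =>
    refine ⟨?_, fun j => ?_⟩
    · rw [map_add]; exact 𝒱.add_mem hg.1 hh.1
    · rw [HolGerm.deriv_add]; exact ih (hg.2 j) (hh.2 j)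

lemma JetIn.neg (hg : JetIn 𝒱 m g) : JetIn 𝒱 m (-g) := by
  induction m generalizing g with
  | zero =>
    change restrStar E k (-g) ∈ 𝒱
    rw [map_neg]
    exact 𝒱.neg_mem hg
  | succ m ih =>
    refine ⟨?_, fun j => ?_⟩
    · rw [map_neg]; exact 𝒱.neg_mem hg.1
    · rw [HolGerm.deriv_neg]; exact ih (hg.2 j)

lemma JetIn.sub (hg : JetIn 𝒱 m g) (hh : JetIn 𝒱 m h) : JetIn 𝒱 m (g - h) := by
  rw [sub_eq_add_neg]; exact hg.add hh.neg

lemma JetIn.sum {ι : Type*} (s : Finset ι) {g : ι → HolOStar (E × (Fin k → ℂ))}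
    (hg : ∀ i ∈ s, JetIn 𝒱 m (g i)) : JetIn 𝒱 m (∑ i ∈ s, g i) :=
  Finset.sum_induction g (JetIn 𝒱 m) (fun _ _ => JetIn.add) (JetIn.zero 𝒱 m) hg

lemma JetIn.toStar_mul (h𝒱 : IsStable 𝒱) (f : HolO (E × (Fin k → ℂ))) (hg : JetIn 𝒱 m g) :
    JetIn 𝒱 m (toStar f * g) := by
  have h0 : restrStar E k (toStar f * g) ∈ 𝒱 := by
    rw [map_mul, restrStar_toStar]
    exact h𝒱.toStar_mul _ _ hg.restrStar_mem
  induction m generalizing f g with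
  | zero => exact h0
  | succ m ih =>
    refine ⟨h0, fun j => ?_⟩
    rw [HolGerm.deriv_mul, deriv_toStar]
    refine (ih _ hg.of_succ ?_).add (ih _ (hg.2 j) ?_)
    all_goals
      rw [map_mul, restrStar_toStar]
      refine h𝒱.toStar_mul _ _ (JetIn.restrStar_mem (m := m) ?_)
    exacts [hg.of_succ, hg.2 j]

lemma JetIn.deriv (h𝒱 : IsStable 𝒱) (u : E) (hg : JetIn 𝒱 m g) :
    JetIn 𝒱 m (HolGerm.deriv ((0, (u, 0)) : ℂ × (E × (Fin k → ℂ))) g) := by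
  have h0 : ∀ {g : HolOStar (E × (Fin k → ℂ))}, restrStar E k g ∈ 𝒱 →
      restrStar E k (HolGerm.deriv ((0, (u, 0)) : ℂ × (E × (Fin k → ℂ))) g) ∈ 𝒱 := by
    intro g hg
    rw [← deriv_restrStar]
    exact h𝒱.deriv _ _ hg
  induction m generalizing g with
  | zero => exact h0 hg
  | succ m ih =>
    refine ⟨h0 hg.1, fun j => ?_⟩
    rw [HolGerm.deriv_comm]
    exact ih (hg.2 j)

lemma JetIn.deriv_z (h𝒱 : IsStable 𝒱) (hg : JetIn 𝒱 m g) :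
    JetIn 𝒱 m ((zStar (E × (Fin k → ℂ)) : HolOStar (E × (Fin k → ℂ))) *
      HolGerm.deriv ((1, 0) : ℂ × (E × (Fin k → ℂ))) g) := by
  have h0 : ∀ {g : HolOStar (E × (Fin k → ℂ))}, restrStar E k g ∈ 𝒱 →
      restrStar E k ((zStar (E × (Fin k → ℂ)) : HolOStar (E × (Fin k → ℂ))) *
        HolGerm.deriv ((1, 0) : ℂ × (E × (Fin k → ℂ))) g) ∈ 𝒱 := by
    intro g hg
    rw [map_mul, ← deriv_z_restrStar]
    exact h𝒱.deriv_z _ hg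
  induction m generalizing g with
  | zero => exact h0 hg
  | succ m ih =>
    refine ⟨h0 hg.1, fun j => ?_⟩
    rw [HolGerm.deriv_mul, deriv_zStar, zero_mul, zero_add, HolGerm.deriv_comm]
    exact ih (hg.2 j)

lemma JetIn.restrStar_iterate_deriv (h𝒱 : IsStable 𝒱) (hg : ∀ m, JetIn 𝒱 m g)
    (v : E × (Fin k → ℂ)) (n : ℕ) :
    restrStar E k ((HolGerm.deriv ((0, v) : ℂ × (E × (Fin k → ℂ))))^[n] g) ∈ 𝒱 := by
  suffices h : ∀ m, JetIn 𝒱 m ((HolGerm.deriv ((0, v) : ℂ × (E × (Fin k → ℂ))))^[n] g) from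
    (h 0).restrStar_mem
  induction n with
  | zero => exact hg
  | succ n ih =>
    intro m
    rw [Function.iterate_succ_apply']
    have hv : ((0, v) : ℂ × (E × (Fin k → ℂ))) =
        (0, (v.1, 0)) + ∑ j, v.2 j • sDir E j := by
      rw [sum_smul_sDir]; simp
    set y := (HolGerm.deriv ((0, v) : ℂ × (E × (Fin k → ℂ))))^[n] g
    rw [hv, HolGerm.deriv_add_dir, HolGerm.deriv_sum_dir]
    refine ((ih m).deriv h𝒱 _).add (JetIn.sum _ fun j _ => ?_)
    rw [HolGerm.deriv_smul_dir, ← toStar_const]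
    exact ((ih (m + 1)).2 j).toStar_mul h𝒱 _

lemma isStable_bot : IsStable (⊥ : AddSubgroup (HolOStar E)) where
  toStar_mul f x hx := by rw [AddSubgroup.mem_bot] at *; rw [hx, mul_zero]
  deriv v x hx := by rw [AddSubgroup.mem_bot] at *; rw [hx, HolGerm.deriv_zero]
  deriv_z x hx := by rw [AddSubgroup.mem_bot] at *; rw [hx, HolGerm.deriv_zero, mul_zero]

lemma eq_zero_of_jetIn_bot (hg : ∀ m, JetIn (⊥ : AddSubgroup (HolOStar E)) m g) : g = 0 :=
  eq_zero_of_restrStar g fun v n => AddSubgroup.mem_bot.1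
    (JetIn.restrStar_iterate_deriv isStable_bot hg v n)

variable (E) in
/-- The subgroup `z^w 𝒪_{ℂ × M, 0}` of `𝒪_{ℂ* × M, 0}`. -/
def zPowO (w : ℤ) : AddSubgroup (HolOStar E) where
  carrier := {x | ∃ h : HolO E, x = ((zStar E ^ w : (HolOStar E)ˣ) : HolOStar E) * toStar h}
  zero_mem' := ⟨0, by simp⟩
  add_mem' := by
    rintro _ _ ⟨a, rfl⟩ ⟨b, rfl⟩
    exact ⟨a + b, by rw [map_add, mul_add]⟩
  neg_mem' := by
    rintro _ ⟨a, rfl⟩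
    exact ⟨-a, by rw [map_neg, mul_neg]⟩

lemma isStable_zPowO (w : ℤ) : IsStable (zPowO E w) where
  toStar_mul := by
    rintro f _ ⟨a, rfl⟩
    exact ⟨f * a, by rw [map_mul]; ring⟩
  deriv := by
    rintro v _ ⟨a, rfl⟩
    exact ⟨HolGerm.deriv (0, v) a, by
      rw [HolGerm.deriv_mul, deriv_zStar_zpow, deriv_toStar]; ring⟩
  deriv_z := by
    rintro _ ⟨a, rfl⟩
    refine ⟨(w : HolO E) * a + zO * HolGerm.deriv (1, 0) a, ?_⟩
    rw [HolGerm.deriv_mul, map_add, map_mul, map_mul, map_intCast, toStar_zO, deriv_toStar]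
    linear_combination toStar a * zStar_mul_deriv_z_zpow (E := E) w

lemma iterate_deriv_zStar_zpow_mul (v : E) (w : ℤ) (n : ℕ) (x : HolOStar E) :
    (HolGerm.deriv ((0, v) : ℂ × E))^[n] (((zStar E ^ w : (HolOStar E)ˣ) : HolOStar E) * x) =
      ((zStar E ^ w : (HolOStar E)ˣ) : HolOStar E) * (HolGerm.deriv ((0, v) : ℂ × E))^[n] x := by
  induction n with
  | zero => rfl
  | succ n ih =>
    rw [Function.iterate_succ_apply', ih, HolGerm.deriv_mul, deriv_zStar_zpow, zero_mul, zero_add,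
      Function.iterate_succ_apply']

/-- A germ lies in `z^w 𝒪` if all its jets along `s = 0` do. -/
lemma mem_zPowO_of_jetIn {w : ℤ} (hg : ∀ m, JetIn (zPowO E w) m g) :
    g ∈ zPowO (E × (Fin k → ℂ)) w := by
  obtain ⟨h, hh⟩ := mem_range_toStar_of_restrStar
    (((zStar (E × (Fin k → ℂ)) ^ (-w) : (HolOStar (E × (Fin k → ℂ)))ˣ) :
      HolOStar (E × (Fin k → ℂ))) * g) fun v n => by
    obtain ⟨a, ha⟩ := JetIn.restrStar_iterate_deriv (isStable_zPowO w) hg v n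
    refine ⟨a, ?_⟩
    rw [iterate_deriv_zStar_zpow_mul, map_mul, ha, restrStar_zStar_zpow, ← mul_assoc,
      ← Units.val_mul, ← zpow_add, neg_add_cancel, zpow_zero, Units.val_one, one_mul]
  refine ⟨h, ?_⟩
  rw [← hh, ← mul_assoc, ← Units.val_mul, ← zpow_add, add_neg_cancel, zpow_zero, Units.val_one,
    one_mul]

/-! ### The radial vector field -/

lemma JetIn.sCoord_mul (hg : JetIn (⊥ : AddSubgroup (HolOStar E)) m g) (j : Fin k) :
    JetIn (⊥ : AddSubgroup (HolOStar E)) (m + 1) (toStar (sCoord E j) * g) := by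
  have h0 : ∀ g, restrStar E k (toStar (sCoord E j) * g) ∈ (⊥ : AddSubgroup (HolOStar E)) := by
    intro g
    rw [map_mul, restrStar_toStar, restr_sCoord, map_zero, zero_mul]
    exact AddSubgroup.zero_mem _
  have h1 : ∀ (g : HolOStar (E × (Fin k → ℂ))) i, HolGerm.deriv (sDir E i)
      (toStar (sCoord E j) * g) = toStar (HolGerm.const ((Pi.single i (1 : ℂ) : Fin k → ℂ) j)) * g +
        toStar (sCoord E j) * HolGerm.deriv (sDir E i) g := by
    intro g i
    rw [HolGerm.deriv_mul, deriv_toStar, deriv_sCoord]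
  induction m generalizing g with
  | zero =>
    refine ⟨h0 g, fun i => ?_⟩
    rw [h1]
    exact (JetIn.toStar_mul (m := 0) isStable_bot _ hg).add (h0 _)
  | succ m ih =>
    refine ⟨h0 g, fun i => ?_⟩
    rw [h1]
    exact (hg.toStar_mul isStable_bot _).add (ih (hg.2 i))

/-- The derivative `ℰ` in the direction of the radial vector field `∑ s_j ∂/∂s_j`. -/
def radialDeriv (g : HolOStar (E × (Fin k → ℂ))) : HolOStar (E × (Fin k → ℂ)) :=
  ∑ j, toStar (sCoord E j) * HolGerm.deriv (sDir E j) g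

lemma restrStar_radialDeriv : restrStar E k (radialDeriv g) = 0 := by
  simp [radialDeriv, restrStar_toStar, restr_sCoord]

lemma deriv_radialDeriv (i : Fin k) : HolGerm.deriv (sDir E i) (radialDeriv g) =
    radialDeriv (HolGerm.deriv (sDir E i) g) + HolGerm.deriv (sDir E i) g := by
  have h1 : ∀ j, HolGerm.deriv (sDir E i) (toStar (sCoord E j) * HolGerm.deriv (sDir E j) g) =
      toStar (sCoord E j) * HolGerm.deriv (sDir E j) (HolGerm.deriv (sDir E i) g) +
        HolGerm.const ((Pi.single i (1 : ℂ) : Fin k → ℂ) j) * HolGerm.deriv (sDir E j) g := by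
    intro j
    rw [HolGerm.deriv_mul, deriv_toStar, deriv_sCoord, toStar_const, add_comm,
      HolGerm.deriv_comm (sDir E i)]
  rw [radialDeriv, HolGerm.deriv_sum, Finset.sum_congr rfl fun j _ => h1 j,
    Finset.sum_add_distrib]
  congr 1
  rw [Finset.sum_eq_single i]
  · rw [Pi.single_eq_same]; exact one_mul _
  · intro j _ hj
    rw [Pi.single_eq_of_ne hj]; exact zero_mul _
  · simp

lemma restrStar_eq_zero_of_radialDeriv {c : ℕ} (hc : c ≠ 0)
    (hg : restrStar E k (radialDeriv g + HolGerm.const (c : ℂ) * g) = 0) :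
    restrStar E k g = 0 := by
  rw [map_add, restrStar_radialDeriv, zero_add, map_mul] at hg
  have h2 : (HolGerm.const (c : ℂ)⁻¹ : HolOStar E) *
      restrStar E k (HolGerm.const (c : ℂ)) = 1 := by
    have : (HolGerm.const (c : ℂ)⁻¹ : HolOStar E) * restrStar E k (HolGerm.const (c : ℂ)) =
      HolGerm.const ((c : ℂ)⁻¹ * c) := rfl
    rw [this, inv_mul_cancel₀ (Nat.cast_ne_zero.2 hc)]
    rfl
  rw [← one_mul (restrStar E k g), ← h2, mul_assoc, hg, mul_zero]

/-- Euler's argument: `ℰ` acts on the terms of degree `d` in `s` as multiplication with `d`,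
so `ℰ + c` is injective on jets except for the terms of degree `0` if `c = 0`. -/
lemma JetIn.of_radialDeriv {c : ℕ} (hc : c ≠ 0 ∨ restrStar E k g = 0)
    (hg : JetIn (⊥ : AddSubgroup (HolOStar E)) m
      (radialDeriv g + HolGerm.const (c : ℂ) * g)) :
    JetIn (⊥ : AddSubgroup (HolOStar E)) m g := by
  have h0 : restrStar E k g = 0 := hc.elim
    (fun hc => restrStar_eq_zero_of_radialDeriv hc (AddSubgroup.mem_bot.1 hg.restrStar_mem)) id
  clear hc
  induction m generalizing g c with
  | zero => exact h0
  | succ m ih =>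
    have key : ∀ j, JetIn (⊥ : AddSubgroup (HolOStar E)) m
        (radialDeriv (HolGerm.deriv (sDir E j) g) +
          HolGerm.const ((c + 1 : ℕ) : ℂ) * HolGerm.deriv (sDir E j) g) := by
      intro j
      have h := hg.2 j
      rw [HolGerm.deriv_add, HolGerm.deriv_mul, HolGerm.deriv_const, deriv_radialDeriv] at h
      have e : (HolGerm.const ((c + 1 : ℕ) : ℂ) : HolOStar (E × (Fin k → ℂ))) =
          HolGerm.const (c : ℂ) + 1 := by
        rw [Nat.cast_succ]; rfl
      rw [e]
      convert h using 1
      ring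
    exact ⟨h0, fun j => ih (key j) (restrStar_eq_zero_of_radialDeriv c.succ_ne_zero
      (AddSubgroup.mem_bot.1 (key j).restrStar_mem))⟩

end Jets

/-! ### Covariant derivatives of pairings -/

section Covariant

variable {E : Type*} [NormedAddCommGroup E] [NormedSpace ℂ E]
  {H : Type*} [AddCommGroup H] [Module (HolO E) H]

/-- A pairing of sections with values in `𝒪_{ℂ* × M, 0}` is `z`-sesquilinear. -/
structure IsSesquilinear (S : H →+ H →+ HolOStar E) : Prop where
  smul_left : ∀ (f : HolO E) (a b : H), S (f • a) b = toStar f * S a b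
  smul_right : ∀ (f : HolO E) (a b : H), S a (f • b) = flip (toStar f) * S a b

variable [Module.Free (HolO E) H] [Module.Finite (HolO E) H]

namespace TEStructure

variable (T : TEStructure E H)

/-- `z` times the covariant derivative of a pairing in the direction of the vector field `v`
on `M`. It vanishes if and only if the pairing is flat in this direction. -/
def pairDeriv (v : E) (S : H → H → HolOStar E) (a b : H) : HolOStar E :=
  (zStar E : HolOStar E) * HolGerm.deriv ((0, v) : ℂ × E) (S a b) -
    (S (T.zNabla v a) b - S a (T.zNabla v b))

/-- `z` times the covariant derivative of a pairing in the direction of `z ∂/∂z`. -/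
def pairDerivZ (S : H → H → HolOStar E) (a b : H) : HolOStar E :=
  (zStar E : HolOStar E) ^ 2 * HolGerm.deriv ((1, 0) : ℂ × E) (S a b) -
    (S (T.zzNabla a) b - S a (T.zzNabla b))

lemma pairDeriv_comm (v u : E) (S : H → H → HolOStar E) (a b : H) :
    T.pairDeriv v (T.pairDeriv u S) a b = T.pairDeriv u (T.pairDeriv v S) a b := by
  simp only [pairDeriv, HolGerm.deriv_sub, HolGerm.deriv_mul, deriv_zStar,
    T.flat_base v u, HolGerm.deriv_comm ((0, v) : ℂ × E) (0, u)]
  ring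

lemma pairDerivZ_pairDeriv (v : E) {S : H →+ H →+ HolOStar E} (hS : IsSesquilinear S) (a b : H) :
    T.pairDeriv v (T.pairDerivZ fun a b => S a b) a b =
      T.pairDerivZ (T.pairDeriv v fun a b => S a b) a b -
        (zStar E : HolOStar E) * T.pairDeriv v (fun a b => S a b) a b := by
  simp only [pairDeriv, pairDerivZ, HolGerm.deriv_sub, HolGerm.deriv_mul, deriv_zStar,
    deriv_z_zStar, pow_two, T.flat_z, HolGerm.deriv_comm ((0, v) : ℂ × E) (1, 0), map_add,
    AddMonoidHom.add_apply, hS.smul_left, hS.smul_right, toStar_zO, flip_zStar]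
  ring

lemma pairDeriv_add_dir (v u : E) (S : H →+ H →+ HolOStar E) (a b : H) :
    T.pairDeriv (v + u) (fun a b => S a b) a b =
      T.pairDeriv v (fun a b => S a b) a b + T.pairDeriv u (fun a b => S a b) a b := by
  have h : ((0, v + u) : ℂ × E) = (0, v) + (0, u) := by simp
  simp only [pairDeriv, h, HolGerm.deriv_add_dir, map_add, AddMonoidHom.add_apply]
  ring

lemma pairDeriv_smul_dir (c : ℂ) (v : E) {S : H →+ H →+ HolOStar E} (hS : IsSesquilinear S)
    (a b : H) : T.pairDeriv (c • v) (fun a b => S a b) a b =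
      HolGerm.const c * T.pairDeriv v (fun a b => S a b) a b := by
  have h : ((0, c • v) : ℂ × E) = c • (0, v) := by simp
  simp only [pairDeriv, h, HolGerm.deriv_smul_dir, T.zNabla_smul, hS.smul_left, hS.smul_right,
    toStar_const, flip_const]
  ring

lemma pairDeriv_sum_dir {ι : Type*} (s : Finset ι) (v : ι → E) (S : H →+ H →+ HolOStar E)
    (a b : H) : T.pairDeriv (∑ i ∈ s, v i) (fun a b => S a b) a b =
      ∑ i ∈ s, T.pairDeriv (v i) (fun a b => S a b) a b :=
  map_sum (AddMonoidHom.mk' (fun v => T.pairDeriv v (fun a b => S a b) a b)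
    fun v u => T.pairDeriv_add_dir v u S a b) v s

lemma pairDeriv_add_left (v : E) (S : H →+ H →+ HolOStar E) (a a' b : H) :
    T.pairDeriv v (fun a b => S a b) (a + a') b =
      T.pairDeriv v (fun a b => S a b) a b + T.pairDeriv v (fun a b => S a b) a' b := by
  simp only [pairDeriv, map_add, AddMonoidHom.add_apply, HolGerm.deriv_add]
  ring

lemma pairDeriv_add_right (v : E) (S : H →+ H →+ HolOStar E) (a b b' : H) :
    T.pairDeriv v (fun a b => S a b) a (b + b') =
      T.pairDeriv v (fun a b => S a b) a b + T.pairDeriv v (fun a b => S a b) a b' := by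
  simp only [pairDeriv, map_add, HolGerm.deriv_add]
  ring

lemma pairDeriv_smul_left (v : E) {S : H →+ H →+ HolOStar E} (hS : IsSesquilinear S)
    (f : HolO E) (a b : H) : T.pairDeriv v (fun a b => S a b) (f • a) b =
      toStar f * T.pairDeriv v (fun a b => S a b) a b := by
  simp only [pairDeriv, T.zNabla_leibniz, map_add, AddMonoidHom.add_apply, hS.smul_left,
    HolGerm.deriv_mul, map_mul, toStar_zO, deriv_toStar]
  ring

lemma pairDeriv_smul_right (v : E) {S : H →+ H →+ HolOStar E} (hS : IsSesquilinear S)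
    (f : HolO E) (a b : H) : T.pairDeriv v (fun a b => S a b) a (f • b) =
      flip (toStar f) * T.pairDeriv v (fun a b => S a b) a b := by
  simp only [pairDeriv, T.zNabla_leibniz, map_add, hS.smul_right, HolGerm.deriv_mul, map_mul,
    toStar_zO, deriv_flip, deriv_toStar, flip_zStar]
  ring

end TEStructure

end Covariant

/-! ### Pairings that are flat in the radial direction -/

section RadialFlat

variable {E : Type*} [NormedAddCommGroup E] [NormedSpace ℂ E] {k : ℕ}
  {H' : Type*} [AddCommGroup H'] [Module (HolO (E × (Fin k → ℂ))) H']
  [Module.Free (HolO (E × (Fin k → ℂ))) H'] [Module.Finite (HolO (E × (Fin k → ℂ))) H']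
  (T : TEStructure (E × (Fin k → ℂ)) H')

/-- The coordinate vector field `∂/∂s_j` on `M × ℂ^k`. -/
abbrev sVec (E : Type*) [NormedAddCommGroup E] [NormedSpace ℂ E] {k : ℕ} (j : Fin k) :
    E × (Fin k → ℂ) := (0, Pi.single j 1)

/-- `z` times the covariant derivative of a pairing in the direction of the radial vector
field. -/
def TEStructure.pairRadial (S : H' → H' → HolOStar (E × (Fin k → ℂ))) (a b : H') :
    HolOStar (E × (Fin k → ℂ)) :=
  ∑ j, toStar (sCoord E j) * T.pairDeriv (sVec E j) S a b

lemma JetIn.inv_zStar_mul {m : ℕ} {g : HolOStar (E × (Fin k → ℂ))}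
    (hg : JetIn (⊥ : AddSubgroup (HolOStar E)) m g) :
    JetIn (⊥ : AddSubgroup (HolOStar E)) m
      ((((zStar (E × (Fin k → ℂ)))⁻¹ : (HolOStar (E × (Fin k → ℂ)))ˣ) :
        HolOStar (E × (Fin k → ℂ))) * g) := by
  have h0 : ∀ {g : HolOStar (E × (Fin k → ℂ))}, restrStar E k g ∈ (⊥ : AddSubgroup (HolOStar E)) →
      restrStar E k ((((zStar (E × (Fin k → ℂ)))⁻¹ : (HolOStar (E × (Fin k → ℂ)))ˣ) :
        HolOStar (E × (Fin k → ℂ))) * g) ∈ (⊥ : AddSubgroup (HolOStar E)) := by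
    intro g hg
    rw [AddSubgroup.mem_bot] at hg ⊢
    rw [map_mul, hg, mul_zero]
  induction m generalizing g with
  | zero => exact h0 hg
  | succ m ih =>
    refine ⟨h0 hg.1, fun j => ?_⟩
    rw [HolGerm.deriv_mul, ← zpow_neg_one, deriv_zStar_zpow, zero_mul, zero_add, zpow_neg_one]
    exact ih (hg.2 j)

/-- A pairing `S` with `(∇_ℰ + c) S = 0` that vanishes for `s = 0` (which is automatic
if `c ≠ 0`) is zero: all its jets along `s = 0` vanish, since the connection terms raise the order
in `s`. -/
lemma eq_zero_of_pairRadial {S : H' → H' → HolOStar (E × (Fin k → ℂ))} (c : ℕ)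
    (hc : c ≠ 0 ∨ ∀ a b, restrStar E k (S a b) = 0)
    (hS : ∀ a b, T.pairRadial S a b =
      -((zStar (E × (Fin k → ℂ)) : HolOStar (E × (Fin k → ℂ))) * (HolGerm.const (c : ℂ) * S a b)))
    (a b : H') : S a b = 0 := by
  set z := zStar (E × (Fin k → ℂ))
  let R : H' → H' → HolOStar (E × (Fin k → ℂ)) := fun a b =>
    ∑ j, toStar (sCoord E j) * (((z⁻¹ : (HolOStar (E × (Fin k → ℂ)))ˣ) :
      HolOStar (E × (Fin k → ℂ))) * (S (T.zNabla (sVec E j) a) b - S a (T.zNabla (sVec E j) b)))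
  have hR : ∀ a b, radialDeriv (S a b) + HolGerm.const (c : ℂ) * S a b = R a b := by
    intro a b
    have h := hS a b
    have e : T.pairRadial S a b = z * (radialDeriv (S a b) - R a b) := by
      simp only [TEStructure.pairRadial, TEStructure.pairDeriv, radialDeriv, R,
        ← Finset.sum_sub_distrib, Finset.mul_sum]
      refine Finset.sum_congr rfl fun j _ => ?_
      linear_combination (toStar (sCoord E j) * (S (T.zNabla (sVec E j) a) b -
        S a (T.zNabla (sVec E j) b))) * z.mul_inv
    rw [e] at h
    have h2 := congrArg (fun x => ((z⁻¹ : (HolOStar (E × (Fin k → ℂ)))ˣ) :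
      HolOStar (E × (Fin k → ℂ))) * x) h
    simp only [mul_neg, Units.inv_mul_cancel_left] at h2
    linear_combination h2
  refine eq_zero_of_jetIn_bot fun m => ?_
  induction m generalizing a b with
  | zero =>
    refine JetIn.of_radialDeriv (c := c) (hc.imp_right fun h => h a b) ?_
    rw [hR]
    change restrStar E k (R a b) ∈ _
    simp [R, restrStar_toStar, restr_sCoord]
  | succ m ih =>
    refine JetIn.of_radialDeriv (c := c) (hc.imp_right fun h => h a b) ?_
    rw [hR]
    refine JetIn.sum _ fun j _ => JetIn.sCoord_mul ?_ j
    exact ((ih _ b).sub (ih a _)).inv_zStar_mul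

variable {T} {S : H' →+ H' →+ HolOStar (E × (Fin k → ℂ))}

/-- The covariant derivatives in the directions of the coordinates `s_j` of a pairing that is
flat in the radial direction vanish. -/
lemma pairDeriv_sVec_eq_zero (hrad : ∀ a b, T.pairRadial (fun a b => S a b) a b = 0)
    (j : Fin k) (a b : H') : T.pairDeriv (sVec E j) (fun a b => S a b) a b = 0 := by
  classical
  refine eq_zero_of_pairRadial T 1 (Or.inl one_ne_zero) (fun a b => ?_) a b
  -- `[∇_ℰ, ∇_{∂/∂s_j}] = - ∇_{∂/∂s_j}`
  have h1 : (zStar (E × (Fin k → ℂ)) : HolOStar (E × (Fin k → ℂ))) *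
      HolGerm.deriv (sDir E j) (T.pairRadial (fun a b => S a b) a b) -
      (T.pairRadial (fun a b => S a b) (T.zNabla (sVec E j) a) b -
        T.pairRadial (fun a b => S a b) a (T.zNabla (sVec E j) b)) = 0 := by
    simp [hrad, HolGerm.deriv_zero]
  have h2 : ∑ i, toStar (HolGerm.const ((Pi.single j (1 : ℂ) : Fin k → ℂ) i)) *
      T.pairDeriv (sVec E i) (fun a b => S a b) a b =
      T.pairDeriv (sVec E j) (fun a b => S a b) a b := by
    rw [Finset.sum_eq_single j]
    · rw [Pi.single_eq_same]; exact one_mul _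
    · intro i _ hi
      rw [Pi.single_eq_of_ne hi]; exact zero_mul _
    · simp
  have h3 : (HolGerm.const ((1 : ℕ) : ℂ) : HolOStar (E × (Fin k → ℂ))) = 1 := by
    rw [Nat.cast_one]; rfl
  rw [h3, one_mul, ← h2, ← sub_eq_zero, ← h1]
  simp only [TEStructure.pairRadial, T.pairDeriv_comm _ (sVec E j)]
  simp only [HolGerm.deriv_sum, HolGerm.deriv_mul, deriv_toStar, deriv_sCoord,
    Finset.mul_sum, ← Finset.sum_sub_distrib, ← Finset.sum_neg_distrib]
  refine Finset.sum_congr rfl fun i _ => ?_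
  rw [TEStructure.pairDeriv]
  ring

/-- A pairing that is flat in the radial direction is flat in the directions of `M` if its
restriction to `s = 0` is. -/
lemma pairDeriv_base_eq_zero (hrad : ∀ a b, T.pairRadial (fun a b => S a b) a b = 0) (u : E)
    (h0 : ∀ a b, restrStar E k (T.pairDeriv (u, 0) (fun a b => S a b) a b) = 0) (a b : H') :
    T.pairDeriv (u, 0) (fun a b => S a b) a b = 0 := by
  refine eq_zero_of_pairRadial T 0 (Or.inr h0) (fun a b => ?_) a b
  have h3 : (HolGerm.const ((0 : ℕ) : ℂ) : HolOStar (E × (Fin k → ℂ))) = 0 := by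
    rw [Nat.cast_zero]; rfl
  rw [h3, zero_mul, mul_zero, neg_zero]
  refine Finset.sum_eq_zero fun j _ => ?_
  have hz : T.pairDeriv (sVec E j) (fun a b => S a b) = fun _ _ => 0 :=
    funext₂ (pairDeriv_sVec_eq_zero hrad j)
  rw [T.pairDeriv_comm, hz]
  simp [TEStructure.pairDeriv, HolGerm.deriv_zero]

/-- A pairing that is flat in the radial direction is flat in the direction of `z ∂/∂z` if its
restriction to `s = 0` is. -/
lemma pairDerivZ_eq_zero (hS : IsSesquilinear S)
    (hrad : ∀ a b, T.pairRadial (fun a b => S a b) a b = 0)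
    (h0 : ∀ a b, restrStar E k (T.pairDerivZ (fun a b => S a b) a b) = 0) (a b : H') :
    T.pairDerivZ (fun a b => S a b) a b = 0 := by
  refine eq_zero_of_pairRadial T 0 (Or.inr h0) (fun a b => ?_) a b
  have h3 : (HolGerm.const ((0 : ℕ) : ℂ) : HolOStar (E × (Fin k → ℂ))) = 0 := by
    rw [Nat.cast_zero]; rfl
  rw [h3, zero_mul, mul_zero, neg_zero]
  refine Finset.sum_eq_zero fun j _ => ?_
  have hz : T.pairDeriv (sVec E j) (fun a b => S a b) = fun _ _ => 0 :=
    funext₂ (pairDeriv_sVec_eq_zero hrad j)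
  rw [T.pairDerivZ_pairDeriv _ hS, hz]
  simp [TEStructure.pairDerivZ, HolGerm.deriv_zero]

/-- A sesquilinear pairing that is flat in the directions of the `s_j` and of `M` is flat in all
directions of `M × ℂ^k`. -/
lemma pairDeriv_eq_zero (hS : IsSesquilinear S)
    (hs : ∀ j a b, T.pairDeriv (sVec E j) (fun a b => S a b) a b = 0)
    (hu : ∀ u a b, T.pairDeriv (u, 0) (fun a b => S a b) a b = 0)
    (v : E × (Fin k → ℂ)) (a b : H') : T.pairDeriv v (fun a b => S a b) a b = 0 := by
  have hv : v = (v.1, 0) + ∑ j, v.2 j • sVec E j := by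
    have := congrArg Prod.snd (sum_smul_sDir (E := E) v.2)
    rw [Prod.snd_sum] at this
    simp only [Prod.smul_snd] at this
    rw [this]; simp
  rw [hv, T.pairDeriv_add_dir, T.pairDeriv_sum_dir, hu, zero_add]
  refine Finset.sum_eq_zero fun j _ => ?_
  rw [T.pairDeriv_smul_dir _ _ hS, hs, mul_zero]

/-- Sesquilinearity reduces radial flatness to pairs of generators. -/
lemma pairRadial_eq_zero_of_span {ι : Type*} {e : ι → H'}
    (he : Submodule.span (HolO (E × (Fin k → ℂ))) (Set.range e) = ⊤) (hS : IsSesquilinear S)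
    (h : ∀ i j, T.pairRadial (fun a b => S a b) (e i) (e j) = 0) (a b : H') :
    T.pairRadial (fun a b => S a b) a b = 0 := by
  have hmem : ∀ x : H', x ∈ Submodule.span (HolO (E × (Fin k → ℂ))) (Set.range e) := fun x => by
    rw [he]; trivial
  have hright : ∀ i b, T.pairRadial (fun a b => S a b) (e i) b = 0 := by
    intro i b
    induction hmem b using Submodule.span_induction with
    | mem x hx => obtain ⟨j, rfl⟩ := hx; exact h i j
    | zero => simp [TEStructure.pairRadial, TEStructure.pairDeriv, HolGerm.deriv_zero]
    | add x y _ _ hx hy =>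
      simp only [TEStructure.pairRadial] at hx hy
      simp only [TEStructure.pairRadial, T.pairDeriv_add_right, mul_add, Finset.sum_add_distrib,
        hx, hy, add_zero]
    | smul f x _ hx =>
      rw [← mul_zero (flip (toStar f)), ← hx]
      simp only [TEStructure.pairRadial, T.pairDeriv_smul_right _ hS, Finset.mul_sum]
      exact Finset.sum_congr rfl fun j _ => mul_left_comm _ _ _
  induction hmem a using Submodule.span_induction with
  | mem x hx => obtain ⟨i, rfl⟩ := hx; exact hright i b
  | zero => simp [TEStructure.pairRadial, TEStructure.pairDeriv, HolGerm.deriv_zero]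
  | add x y _ _ hx hy =>
    simp only [TEStructure.pairRadial] at hx hy
    simp only [TEStructure.pairRadial, T.pairDeriv_add_left, mul_add, Finset.sum_add_distrib,
      hx, hy, add_zero]
  | smul f x _ hx =>
    rw [← mul_zero (toStar f), ← hx]
    simp only [TEStructure.pairRadial, T.pairDeriv_smul_left _ hS, Finset.mul_sum]
    exact Finset.sum_congr rfl fun j _ => mul_left_comm _ _ _

end RadialFlat

/-! ### Gram matrices of sesquilinear pairings -/

section Gram

variable {E : Type*} [NormedAddCommGroup E] [NormedSpace ℂ E]
  {H : Type*} [AddCommGroup H] [Module (HolO E) H]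

/-- The sesquilinear pairing with a given Gram matrix in a basis. -/
def sesquilinearOfMatrix {ι : Type*} [Fintype ι] (e : Module.Basis ι (HolO E) H)
    (G : ι × ι → HolOStar E) : H →+ H →+ HolOStar E :=
  AddMonoidHom.mk' (fun a => AddMonoidHom.mk' (fun b =>
      ∑ p : ι × ι, toStar (e.repr a p.1) * flip (toStar (e.repr b p.2)) * G p)
    (fun b b' => by
      simp only [map_add, Finsupp.add_apply, mul_add, add_mul, Finset.sum_add_distrib]))
    (fun a a' => by
      ext b
      simp only [AddMonoidHom.mk'_apply, AddMonoidHom.add_apply, map_add, Finsupp.add_apply,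
        add_mul, Finset.sum_add_distrib])

variable {ι : Type*} [Fintype ι] (e : Module.Basis ι (HolO E) H) (G : ι × ι → HolOStar E)

lemma sesquilinearOfMatrix_apply (a b : H) : sesquilinearOfMatrix e G a b =
    ∑ p : ι × ι, toStar (e.repr a p.1) * flip (toStar (e.repr b p.2)) * G p := rfl

lemma sesquilinearOfMatrix_basis (i j : ι) : sesquilinearOfMatrix e G (e i) (e j) = G (i, j) := by
  classical
  rw [sesquilinearOfMatrix_apply, Finset.sum_eq_single (i, j)]
  · simp
  · rintro ⟨i', j'⟩ - h
    simp only [Module.Basis.repr_self, Finsupp.single_apply]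
    by_cases hi : i = i'
    · by_cases hj : j = j'
      · exact absurd (by rw [hi, hj]) h
      · simp [hj]
    · simp [hi]
  · simp

lemma isSesquilinear_ofMatrix : IsSesquilinear (sesquilinearOfMatrix e G) where
  smul_left f a b := by
    simp only [sesquilinearOfMatrix_apply, map_smul, Finsupp.smul_apply, smul_eq_mul, map_mul,
      Finset.mul_sum]
    exact Finset.sum_congr rfl fun p _ => by ring
  smul_right f a b := by
    simp only [sesquilinearOfMatrix_apply, map_smul, Finsupp.smul_apply, smul_eq_mul, map_mul,
      Finset.mul_sum]
    exact Finset.sum_congr rfl fun p _ => by ring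

lemma IsSesquilinear.apply_eq_sum {S : H →+ H →+ HolOStar E} (hS : IsSesquilinear S)
    {ι : Type*} [Fintype ι] (x y : ι → H) (f g : ι → HolO E) :
    S (∑ i, f i • x i) (∑ j, g j • y j) =
      ∑ p : ι × ι, toStar (f p.1) * flip (toStar (g p.2)) * S (x p.1) (y p.2) := by
  have h1 : S (∑ i, f i • x i) = ∑ i, S (f i • x i) := map_sum S _ _
  rw [h1, AddMonoidHom.finsetSum_apply, Fintype.sum_prod_type]
  refine Finset.sum_congr rfl fun i _ => ?_
  rw [map_sum]
  refine Finset.sum_congr rfl fun j _ => ?_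
  rw [hS.smul_left, hS.smul_right, mul_assoc]

end Gram

/-! ### Extension of flat pairings to unfoldings -/

section Extension

variable {E : Type*} [NormedAddCommGroup E] [NormedSpace ℂ E] {k : ℕ}
  {H : Type*} [AddCommGroup H] [Module (HolO E) H]
  [Module.Free (HolO E) H] [Module.Finite (HolO E) H] {T : TEStructure E H}
  {H' : Type*} [AddCommGroup H'] [Module (HolO (E × (Fin k → ℂ))) H']
  [Module.Free (HolO (E × (Fin k → ℂ))) H'] [Module.Finite (HolO (E × (Fin k → ℂ))) H']

namespace Unfolding

variable (V : Unfolding k T H')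

/-- The restriction of sections of the unfolding to `M × {0}`, identified with sections of the
original bundle. -/
def res : H' →+ H :=
  (V.i.symm : RestrictedSections E k H' →+ H).comp (Submodule.mkQ _).toAddMonoidHom

lemma i_res (a : H') : V.i (V.res a) = Submodule.Quotient.mk a :=
  V.i.apply_symm_apply _

lemma res_eq {x : H} {a : H'} (h : V.i x = Submodule.Quotient.mk a) : V.res a = x :=
  V.i.injective ((V.i_res a).trans h.symm)

lemma res_surjective : Function.Surjective V.res := by
  intro x
  obtain ⟨a, ha⟩ := Submodule.Quotient.mk_surjective _ (V.i x)
  exact ⟨a, V.res_eq ha.symm⟩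

lemma res_smul (f : HolO (E × (Fin k → ℂ))) (a : H') : V.res (f • a) = restr E k f • V.res a :=
  V.res_eq (by rw [V.i_smul, V.i_res]; rfl)

lemma res_zNabla (v : E) (a : H') : V.res (V.T'.zNabla (v, 0) a) = T.zNabla v (V.res a) :=
  V.res_eq (V.i_zNabla v _ _ (V.i_res a))

lemma res_zzNabla (a : H') : V.res (V.T'.zzNabla a) = T.zzNabla (V.res a) :=
  V.res_eq (V.i_zzNabla _ _ (V.i_res a))

lemma extends_iff (Q : FlatPairing T) (Q' : FlatPairing V.T') :
    V.Extends Q Q' ↔ ∀ a b, restrStar E k (Q'.P a b) = Q.P (V.res a) (V.res b) := by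
  refine ⟨fun h a b => h _ _ a b (V.i_res a) (V.i_res b), fun h a b a' b' ha hb => ?_⟩
  rw [h, V.res_eq ha, V.res_eq hb]

end Unfolding

lemma FlatPairing.isSesquilinear (Q : FlatPairing T) : IsSesquilinear Q.P :=
  ⟨Q.smul_left, Q.smul_right⟩

lemma FlatPairing.pairDeriv_eq_zero (Q : FlatPairing T) (v : E) (a b : H) :
    T.pairDeriv v (fun a b => Q.P a b) a b = 0 := sub_eq_zero.2 (Q.flat_base v a b)

lemma FlatPairing.pairDerivZ_eq_zero (Q : FlatPairing T) (a b : H) :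
    T.pairDerivZ (fun a b => Q.P a b) a b = 0 := sub_eq_zero.2 (Q.flat_z a b)

/-- A flat pairing on an unfolding is determined by its restriction. -/
theorem Unfolding.Extends.unique {V : Unfolding k T H'} {Q : FlatPairing T}
    {Q₁ Q₂ : FlatPairing V.T'} (h₁ : V.Extends Q Q₁) (h₂ : V.Extends Q Q₂) : Q₁ = Q₂ := by
  rw [V.extends_iff] at h₁ h₂
  refine FlatPairing.ext (AddMonoidHom.ext fun a => AddMonoidHom.ext fun b => ?_)
  rw [← sub_eq_zero]
  refine eq_zero_of_pairRadial V.T' (S := fun a b => Q₁.P a b - Q₂.P a b) 0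
    (Or.inr fun a b => by rw [map_sub, h₁, h₂, sub_self]) (fun a b => ?_) a b
  have h3 : (HolGerm.const ((0 : ℕ) : ℂ) : HolOStar (E × (Fin k → ℂ))) = 0 := by
    rw [Nat.cast_zero]; rfl
  rw [h3, zero_mul, mul_zero, neg_zero]
  refine Finset.sum_eq_zero fun j _ => ?_
  have e : V.T'.pairDeriv (sVec E j) (fun a b => Q₁.P a b - Q₂.P a b) a b =
      V.T'.pairDeriv (sVec E j) (fun a b => Q₁.P a b) a b -
        V.T'.pairDeriv (sVec E j) (fun a b => Q₂.P a b) a b := by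
    simp only [TEStructure.pairDeriv, HolGerm.deriv_sub]
    ring
  rw [e, Q₁.pairDeriv_eq_zero, Q₂.pairDeriv_eq_zero, sub_zero, mul_zero]

/-- Every flat pairing extends to every unfolding. -/
theorem Unfolding.exists_extends (V : Unfolding k T H') (Q : FlatPairing T) :
    ∃ Q' : FlatPairing V.T', V.Extends Q Q' := by
  classical
  let e := Module.Free.chooseBasis (HolO (E × (Fin k → ℂ))) H'
  obtain ⟨G, hG₀, hG⟩ := exists_radial_solution (ι := _ × _) (k := k) (E := E)
    (fun l p q => e.repr (V.T'.zNabla (sVec E l) (e p.1)) q.1 * flipO (e.repr (e p.2) q.2) -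
      e.repr (e p.1) q.1 * flipO (e.repr (V.T'.zNabla (sVec E l) (e p.2)) q.2))
    (fun p => Q.P (V.res (e p.1)) (V.res (e p.2)))
  let S := sesquilinearOfMatrix e G
  have hS : IsSesquilinear S := isSesquilinear_ofMatrix e G
  have hres : ∀ a b, restrStar E k (S a b) = Q.P (V.res a) (V.res b) := by
    intro a b
    have h : ∀ a, V.res a = ∑ i, restr E k (e.repr a i) • V.res (e i) := by
      intro a
      conv_lhs => rw [← e.sum_repr a]
      rw [map_sum]
      simp only [V.res_smul]
    rw [h a, h b, Q.isSesquilinear.apply_eq_sum, sesquilinearOfMatrix_apply, map_sum]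
    simp only [map_mul, restrStar_flip, restrStar_toStar, hG₀]
  have hrad : ∀ a b, V.T'.pairRadial (fun a b => S a b) a b = 0 := by
    refine pairRadial_eq_zero_of_span e.span_eq hS fun i j => ?_
    have h := hG (i, j)
    rw [← sub_eq_zero] at h
    rw [← h]
    simp only [TEStructure.pairRadial, TEStructure.pairDeriv, Finset.mul_sum,
      ← Finset.sum_sub_distrib]
    refine Finset.sum_congr rfl fun l _ => ?_
    rw [← Finset.mul_sum]
    have e1 : S (e i) (e j) = G (i, j) := sesquilinearOfMatrix_basis e G i j
    have e2 : ∑ q, toStar (e.repr (V.T'.zNabla (sVec E l) (e i)) q.1 *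
        flipO (e.repr (e j) q.2) - e.repr (e i) q.1 *
          flipO (e.repr (V.T'.zNabla (sVec E l) (e j)) q.2)) * G q =
        S (V.T'.zNabla (sVec E l) (e i)) (e j) - S (e i) (V.T'.zNabla (sVec E l) (e j)) := by
      simp only [S, sesquilinearOfMatrix_apply, map_sub, map_mul, toStar_flipO, sub_mul,
        Finset.sum_sub_distrib]
    rw [e1, e2]
    ring
  have hbase : ∀ v a b, V.T'.pairDeriv v (fun a b => S a b) a b = 0 := by
    refine pairDeriv_eq_zero hS (pairDeriv_sVec_eq_zero hrad) fun u =>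
      pairDeriv_base_eq_zero hrad u fun a b => ?_
    rw [TEStructure.pairDeriv, map_sub, map_sub, map_mul, ← deriv_restrStar, hres, hres, hres,
      V.res_zNabla, V.res_zNabla, restrStar_zStar]
    exact Q.pairDeriv_eq_zero u _ _
  have hz : ∀ a b, V.T'.pairDerivZ (fun a b => S a b) a b = 0 := by
    refine pairDerivZ_eq_zero hS hrad fun a b => ?_
    rw [TEStructure.pairDerivZ, map_sub, map_sub, map_mul, map_pow, ← deriv_z_restrStar, hres,
      hres, hres, V.res_zzNabla, V.res_zzNabla, restrStar_zStar]
    exact Q.pairDerivZ_eq_zero _ _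
  exact ⟨⟨S, hS.smul_left, hS.smul_right, fun v a b => sub_eq_zero.1 (hbase v a b),
    fun a b => sub_eq_zero.1 (hz a b)⟩, (V.extends_iff Q _).2 hres⟩

end Extension

/-! ### Cyclic vectors of unfoldings -/

section Cyclic

variable {E : Type*} [NormedAddCommGroup E] [NormedSpace ℂ E] {k : ℕ}
  {H : Type*} [AddCommGroup H] [Module (HolO E) H]
  [Module.Free (HolO E) H] [Module.Finite (HolO E) H] {T : TEStructure E H}
  {H' : Type*} [AddCommGroup H'] [Module (HolO (E × (Fin k → ℂ))) H']
  [Module.Free (HolO (E × (Fin k → ℂ))) H'] [Module.Finite (HolO (E × (Fin k → ℂ))) H']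

/-- The restriction to `M × {0}` is an isomorphism of the fibres at the origin. -/
lemma Unfolding.mem_smul_top_of_res (V : Unfolding k T H') {y : H'}
    (hy : V.res y ∈ (vanishingIdeal (0 : ℂ × E) • ⊤ : Submodule (HolO E) H)) :
    y ∈ (vanishingIdeal (0 : ℂ × (E × (Fin k → ℂ))) • ⊤ :
      Submodule (HolO (E × (Fin k → ℂ))) H') := by
  have hlift : ∀ x ∈ (vanishingIdeal (0 : ℂ × E) • ⊤ : Submodule (HolO E) H),
      ∃ y ∈ (vanishingIdeal (0 : ℂ × (E × (Fin k → ℂ))) • ⊤ :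
        Submodule (HolO (E × (Fin k → ℂ))) H'), V.res y = x := by
    intro x hx
    refine Submodule.smul_induction_on (p := fun x => ∃ y ∈ (vanishingIdeal
      (0 : ℂ × (E × (Fin k → ℂ))) • ⊤ : Submodule (HolO (E × (Fin k → ℂ))) H'),
        V.res y = x) hx ?_ ?_
    · intro f hf a _
      obtain ⟨g, rfl⟩ := restr_surjective (k := k) f
      obtain ⟨c, rfl⟩ := V.res_surjective a
      exact ⟨g • c, Submodule.smul_mem_smul (restr_mem_vanishingIdeal_iff.1 hf)
        Submodule.mem_top, V.res_smul g c⟩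
    · rintro _ _ ⟨a', ha', rfl⟩ ⟨b', hb', rfl⟩
      exact ⟨a' + b', add_mem ha' hb', map_add _ _ _⟩
  obtain ⟨y', hy', h⟩ := hlift _ hy
  have hker : RingHom.ker (restr E k) ≤ vanishingIdeal (0 : ℂ × (E × (Fin k → ℂ))) := by
    intro f hf
    rw [RingHom.mem_ker] at hf
    rw [← restr_mem_vanishingIdeal_iff, hf]
    exact Submodule.zero_mem _
  have hsub : y - y' ∈ (RingHom.ker (restr E k) • ⊤ :
      Submodule (HolO (E × (Fin k → ℂ))) H') := by
    rw [← Submodule.Quotient.mk_eq_zero, ← V.i_res, map_sub, h, sub_self, map_zero]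
  rw [← sub_add_cancel y y']
  exact add_mem (Submodule.smul_mono_left hker hsub) hy'

/-- By Nakayama's lemma, submodules of sections of the unfolding that map onto the fibre at the
origin are everything. -/
lemma Unfolding.eq_top_of_fibre (V : Unfolding k T H') (N : Submodule (HolO (E × (Fin k → ℂ))) H')
    (hN : ∀ x : H', ∃ a ∈ N, (Submodule.Quotient.mk (V.res a) : Fibre E H) =
      Submodule.Quotient.mk (V.res x)) : N = ⊤ := by
  refine top_le_iff.1 (Submodule.le_of_le_smul_of_le_jacobson_bot Module.Finite.fg_top
    (vanishingIdeal_le_jacobson (0 : ℂ × (E × (Fin k → ℂ)))) fun x _ => ?_)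
  obtain ⟨a, ha, h⟩ := hN x
  have hx : x - a ∈ (vanishingIdeal (0 : ℂ × (E × (Fin k → ℂ))) • ⊤ :
      Submodule (HolO (E × (Fin k → ℂ))) H') := by
    refine V.mem_smul_top_of_res ?_
    rw [map_sub]
    exact (Submodule.Quotient.eq _).1 h.symm
  rw [← add_sub_cancel a x]
  exact Submodule.add_mem_sup ha hx

/-- If the generation condition holds, then a lift of the generating vector of the fibre generates
all sections of the unfolding, already under the operators `z ∇_u` with `u` tangent to `M` and
`z² ∇_{∂/∂z}`. -/
lemma Unfolding.exists_cyclic (V : Unfolding k T H') (hGC : T.GenerationCondition) :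
    ∃ ζ : H', ∀ N : Submodule (HolO (E × (Fin k → ℂ))) H', ζ ∈ N →
      (∀ u : E, ∀ a ∈ N, V.T'.zNabla (u, 0) a ∈ N) → (∀ a ∈ N, V.T'.zzNabla a ∈ N) → N = ⊤ := by
  obtain ⟨ζ₀, hζ₀⟩ := hGC
  obtain ⟨x, rfl⟩ := Submodule.Quotient.mk_surjective _ ζ₀
  obtain ⟨ζ, rfl⟩ := V.res_surjective x
  refine ⟨ζ, fun N h1 h2 h3 => V.eq_top_of_fibre N fun x => ?_⟩
  let S : Submodule (HolO E) (Fibre E H) :=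
    { carrier := {y | ∃ a ∈ N, Submodule.Quotient.mk (V.res a) = y}
      zero_mem' := ⟨0, zero_mem _, by rw [map_zero, Submodule.Quotient.mk_zero]⟩
      add_mem' := by
        rintro _ _ ⟨a, ha, rfl⟩ ⟨b, hb, rfl⟩
        exact ⟨a + b, add_mem ha hb, by rw [map_add, Submodule.Quotient.mk_add]⟩
      smul_mem' := by
        rintro f _ ⟨a, ha, rfl⟩
        obtain ⟨g, rfl⟩ := restr_surjective (k := k) f
        exact ⟨g • a, N.smul_mem g ha, by rw [V.res_smul, Submodule.Quotient.mk_smul]⟩ }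
  have hS : S = ⊤ := by
    refine hζ₀ S ⟨ζ, h1, rfl⟩ ?_ ?_
    · rintro _ ⟨a, ha, rfl⟩
      exact ⟨_, h3 a ha, by rw [V.res_zzNabla]; rfl⟩
    · rintro v _ ⟨a, ha, rfl⟩
      exact ⟨_, h2 v a ha, by rw [V.res_zNabla]; rfl⟩
  have hx : (Submodule.Quotient.mk (V.res x) : Fibre E H) ∈ S := by rw [hS]; trivial
  exact hx

end Cyclic

/-! ### Commutation modulo `z` -/

section ModZ

variable {E : Type*} [NormedAddCommGroup E] [NormedSpace ℂ E]

/-- The odd part of a holomorphic function is divisible by `z`. -/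
lemma exists_sub_flipO_eq (f : HolO E) : ∃ g, f - flipO f = zO * g := by
  obtain ⟨f, hf, rfl⟩ := HolGerm.exists_eq_of f
  let F : ℂ × (ℂ × E) → ℂ := fun q => fderiv ℂ f (q.1 * q.2.1, q.2.2) (1, 0)
  have hF : ∀ θ : ℝ, AnalyticAt ℂ F ((θ : ℂ), 0) := by
    intro θ
    have h0 : AnalyticAt ℂ (fun q : ℂ × (ℂ × E) => ((q.1 * q.2.1, q.2.2) : ℂ × E))
        ((θ : ℂ), 0) :=
      (analyticAt_fst.mul ((ContinuousLinearMap.fst ℂ ℂ E ∘L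
        ContinuousLinearMap.snd ℂ ℂ (ℂ × E)).analyticAt _)).prod ((ContinuousLinearMap.snd ℂ ℂ E ∘L
        ContinuousLinearMap.snd ℂ ℂ (ℂ × E)).analyticAt _)
    have h1 : AnalyticAt ℂ (fun p => fderiv ℂ f p ((1, 0) : ℂ × E)) 0 :=
      (ContinuousLinearMap.apply ℂ ℂ ((1, 0) : ℂ × E)).analyticAt _ |>.comp hf.self_of_nhds.fderiv
    refine AnalyticAt.comp (g := fun p => fderiv ℂ f p ((1, 0) : ℂ × E))
      (f := fun q : ℂ × (ℂ × E) => ((q.1 * q.2.1, q.2.2) : ℂ × E)) ?_ h0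
    have h2 : (((θ : ℂ) * (0 : ℂ × E).1, (0 : ℂ × E).2) : ℂ × E) = 0 := by simp
    rw [← h2] at h1
    exact h1
  have hG := analyticAt_integral Complex.continuous_ofReal hF (-1) 1
  refine ⟨HolGerm.of _ hG.eventually_analyticAt, ?_⟩
  rw [zO, HolGerm.of_mul, flipO, HolGerm.pullback_of, sub_eq_iff_eq_add, HolGerm.of_add,
    HolGerm.of_eq_of_iff]
  obtain ⟨ε, hε, hball⟩ := Metric.eventually_nhds_iff_ball.1 hf
  filter_upwards [Metric.ball_mem_nhds (0 : ℂ × E) hε] with p hp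
  have hseg : ∀ τ ∈ Set.uIcc (-1 : ℝ) 1, AnalyticAt ℂ f ((τ : ℂ) * p.1, p.2) := by
    intro τ hτ
    rw [Set.uIcc_of_le (by norm_num)] at hτ
    refine hball _ ?_
    rw [mem_ball_zero_iff, Prod.norm_def, max_lt_iff] at hp ⊢
    refine ⟨lt_of_le_of_lt ?_ hp.1, hp.2⟩
    rw [norm_mul, Complex.norm_real, Real.norm_eq_abs]
    exact mul_le_of_le_one_left (norm_nonneg _) (abs_le.2 hτ)
  have hder : ∀ τ ∈ Set.uIcc (-1 : ℝ) 1,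
      HasDerivAt (fun τ : ℝ => f ((τ : ℂ) * p.1, p.2)) (p.1 * F ((τ : ℂ), p)) τ := by
    intro τ hτ
    have h1 : HasDerivAt (fun τ : ℝ => (((τ : ℂ) * p.1, p.2) : ℂ × E)) (p.1, 0) τ := by
      have := (Complex.ofRealCLM.hasDerivAt (x := τ)).mul_const p.1
      simpa using this.prodMk (hasDerivAt_const τ p.2)
    have h2 := ((hseg τ hτ).differentiableAt.hasFDerivAt.restrictScalars ℝ).comp_hasDerivAt τ h1
    have h3 : fderiv ℂ f ((τ : ℂ) * p.1, p.2) (p.1, 0) = p.1 * F ((τ : ℂ), p) := by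
      have : ((p.1, 0) : ℂ × E) = p.1 • ((1, 0) : ℂ × E) := by simp
      rw [this, map_smul, smul_eq_mul]
    rw [← h3]
    exact h2
  have hint : IntervalIntegrable (fun τ : ℝ => p.1 * F ((τ : ℂ), p)) MeasureTheory.volume
      (-1) 1 := by
    refine ContinuousOn.intervalIntegrable fun τ hτ => ContinuousAt.continuousWithinAt ?_
    refine continuousAt_const.mul ?_
    have h1 : ContinuousAt (fun q => fderiv ℂ f q ((1, 0) : ℂ × E)) ((τ : ℂ) * p.1, p.2) :=
      ((hseg τ hτ).fderiv.continuousAt).clm_apply continuousAt_const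
    exact ContinuousAt.comp (f := fun τ : ℝ => (((τ : ℂ) * p.1, p.2) : ℂ × E)) h1 (by fun_prop)
  have hmain := intervalIntegral.integral_eq_sub_of_hasDerivAt hder hint
  rw [intervalIntegral.integral_const_mul] at hmain
  have hn : negZ E p = (-p.1, p.2) := by ext <;> simp [negZ]
  simp only [Complex.ofReal_one, one_mul, Complex.ofReal_neg, neg_one_mul] at hmain
  simp only [Pi.add_apply, Pi.mul_apply, Function.comp_apply, hn, hmain]
  rw [sub_add_cancel]

variable {H : Type*} [AddCommGroup H] [Module (HolO E) H]

variable (E H) in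
/-- The submodule `z 𝒪(H)` of `𝒪(H)`. -/
def zMul : Submodule (HolO E) H := LinearMap.range (LinearMap.lsmul (HolO E) H zO)

lemma mem_zMul {a : H} : a ∈ zMul E H ↔ ∃ c : H, (zO : HolO E) • c = a := Iff.rfl

lemma zO_mul_smul_mem (f : HolO E) (a : H) : (zO * f) • a ∈ zMul E H :=
  ⟨f • a, (mul_smul _ _ _).symm⟩

/-- Two operators on sections commute modulo `z`. -/
def CommModZ (D D' : H →+ H) : Prop := ∀ a, D (D' a) - D' (D a) ∈ zMul E H

lemma CommModZ.symm {D D' : H →+ H} (h : CommModZ (E := E) D D') : CommModZ (E := E) D' D :=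
  fun a => by rw [← neg_sub]; exact neg_mem (h a)

variable [Module.Free (HolO E) H] [Module.Finite (HolO E) H]

/-- The operators on sections that generate the module structure and the connection: the
multiplications with holomorphic functions, the `z ∇_v` with `v ∈ W`, and `z² ∇_{∂/∂z}`. -/
inductive TEStructure.IsGenerator (T : TEStructure E H) (W : Set E) : (H →+ H) → Prop
  | smul (f : HolO E) : IsGenerator T W (DistribSMul.toAddMonoidHom H f)
  | zNabla (v : E) (hv : v ∈ W) : IsGenerator T W (T.zNabla v)
  | zzNabla : IsGenerator T W T.zzNabla

namespace TEStructure.IsGenerator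

variable {T : TEStructure E H} {W : Set E} {D D' : H →+ H}

lemma mono {W' : Set E} (h : W ⊆ W') (hD : T.IsGenerator W D) : T.IsGenerator W' D := by
  cases hD with
  | smul f => exact .smul f
  | zNabla v hv => exact .zNabla v (h hv)
  | zzNabla => exact .zzNabla

lemma map_zMul (hD : T.IsGenerator W D) {a : H} (ha : a ∈ zMul E H) : D a ∈ zMul E H := by
  obtain ⟨c, rfl⟩ := ha
  cases hD with
  | smul f => exact Submodule.smul_mem _ _ ⟨c, rfl⟩
  | zNabla v =>
    rw [LinearMap.lsmul_apply, T.zNabla_leibniz]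
    exact add_mem (zO_mul_smul_mem _ _) ⟨_, rfl⟩
  | zzNabla =>
    rw [LinearMap.lsmul_apply, T.zzNabla_leibniz, pow_two, mul_assoc]
    exact add_mem (zO_mul_smul_mem _ _) ⟨_, rfl⟩

lemma commModZ (hD : T.IsGenerator W D) (hD' : T.IsGenerator W D') :
    CommModZ (E := E) D D' := by
  have h1 : ∀ (f : HolO E) (v : E),
      CommModZ (E := E) (T.zNabla v) (DistribSMul.toAddMonoidHom H f) := by
    intro f v a
    rw [DistribSMul.toAddMonoidHom_apply, DistribSMul.toAddMonoidHom_apply, T.zNabla_leibniz,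
      add_sub_cancel_right]
    exact zO_mul_smul_mem _ _
  have h2 : ∀ f : HolO E, CommModZ (E := E) T.zzNabla (DistribSMul.toAddMonoidHom H f) := by
    intro f a
    rw [DistribSMul.toAddMonoidHom_apply, DistribSMul.toAddMonoidHom_apply, T.zzNabla_leibniz,
      add_sub_cancel_right, pow_two, mul_assoc]
    exact zO_mul_smul_mem _ _
  have h3 : ∀ v, CommModZ (E := E) T.zzNabla (T.zNabla v) := by
    intro v a
    rw [T.flat_z, add_sub_cancel_left]
    exact ⟨_, rfl⟩
  have h0 : ∀ {D D' : H →+ H}, (∀ a, D (D' a) = D' (D a)) → CommModZ (E := E) D D' :=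
    fun h a => by rw [h, sub_self]; exact zero_mem _
  cases hD with
  | smul f =>
    cases hD' with
    | smul g => exact h0 fun a => smul_comm f g a
    | zNabla v => exact (h1 f v).symm
    | zzNabla => exact (h2 f).symm
  | zNabla u =>
    cases hD' with
    | smul g => exact h1 g u
    | zNabla v => exact h0 fun a => T.flat_base u v a
    | zzNabla => exact (h3 u).symm
  | zzNabla =>
    cases hD' with
    | smul g => exact h2 g
    | zNabla v => exact h3 v
    | zzNabla => exact h0 fun a => rfl

end TEStructure.IsGenerator

end ModZ

/-! ### Absence of poles -/

section NoPole

variable {E : Type*} [NormedAddCommGroup E] [NormedSpace ℂ E] {k : ℕ}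
  {H' : Type*} [AddCommGroup H']

/-- The operator `D` on sections is symmetric modulo `z` with respect to the pairing `S`, as far
as derivatives of order `≤ m` are concerned: those of `z⁻¹ (S(D a, b) - S(a, D b))` restrict to
elements of `𝒱`. -/
def SymmModZ (𝒱 : AddSubgroup (HolOStar E)) (m : ℕ) (S : H' →+ H' →+ HolOStar (E × (Fin k → ℂ)))
    (D : H' →+ H') : Prop :=
  ∀ a b, JetIn 𝒱 m ((((zStar (E × (Fin k → ℂ)))⁻¹ : (HolOStar (E × (Fin k → ℂ)))ˣ) :
    HolOStar (E × (Fin k → ℂ))) * (S (D a) b - S a (D b)))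

variable {𝒱 : AddSubgroup (HolOStar E)} {m : ℕ} {S : H' →+ H' →+ HolOStar (E × (Fin k → ℂ))}
  {D D' : H' →+ H'}

lemma SymmModZ.zero : SymmModZ 𝒱 m S 0 := fun a b => by
  simpa using JetIn.zero 𝒱 m

lemma SymmModZ.id : SymmModZ 𝒱 m S (AddMonoidHom.id H') := fun a b => by
  simpa using JetIn.zero 𝒱 m

lemma SymmModZ.add (hD : SymmModZ 𝒱 m S D) (hD' : SymmModZ 𝒱 m S D') :
    SymmModZ 𝒱 m S (D + D') := fun a b => by
  convert (hD a b).add (hD' a b) using 1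
  simp only [AddMonoidHom.add_apply, map_add]
  ring

variable [Module (HolO (E × (Fin k → ℂ))) H']

/-- Changing an operator by a multiple of `z` does not affect its symmetry modulo `z`. -/
lemma SymmModZ.congr (hS : IsSesquilinear S) (hJ : ∀ a b, JetIn 𝒱 m (S a b))
    (hD : SymmModZ 𝒱 m S D)
    (h : ∀ a, D' a - D a ∈ zMul (E × (Fin k → ℂ)) H') : SymmModZ 𝒱 m S D' := fun a b => by
  obtain ⟨c, hc⟩ := mem_zMul.1 (h a)
  obtain ⟨d, hd⟩ := mem_zMul.1 (h b)
  rw [eq_comm, sub_eq_iff_eq_add] at hc hd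
  convert ((hD a b).add (hJ c b)).add (hJ a d) using 1
  rw [hc, hd, map_add, map_add, AddMonoidHom.add_apply, hS.smul_left, hS.smul_right, toStar_zO,
    flip_zStar]
  linear_combination (S c b + S a d) * (zStar (E × (Fin k → ℂ))).inv_mul

lemma SymmModZ.comp (hS : IsSesquilinear S) (hJ : ∀ a b, JetIn 𝒱 m (S a b))
    (hD : SymmModZ 𝒱 m S D) (hD' : SymmModZ 𝒱 m S D')
    (h : CommModZ (E := E × (Fin k → ℂ)) D D') : SymmModZ 𝒱 m S (D.comp D') := fun a b => by
  obtain ⟨c, hc⟩ := mem_zMul.1 (h b)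
  rw [eq_comm, sub_eq_iff_eq_add] at hc
  convert ((hD (D' a) b).add (hD' a (D b))).add (hJ a c) using 1
  rw [AddMonoidHom.comp_apply, AddMonoidHom.comp_apply, hc, map_add, hS.smul_right, toStar_zO,
    flip_zStar]
  linear_combination (S a c) * (zStar (E × (Fin k → ℂ))).inv_mul

variable [Module.Free (HolO (E × (Fin k → ℂ))) H'] [Module.Finite (HolO (E × (Fin k → ℂ))) H']
  {T : TEStructure (E × (Fin k → ℂ)) H'}

/-- For a flat pairing, the generators that do not involve derivatives with respect to `s` are
symmetric modulo `z`: the terms `z⁻¹ (P(z ∇_u a, b) - P(a, z ∇_u b)) = u P(a, b)` involve no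
division by `z` and no further derivatives with respect to `s`. -/
lemma TEStructure.IsGenerator.symmModZ (h𝒱 : IsStable 𝒱) (Q : FlatPairing T)
    (hJ : ∀ a b, JetIn 𝒱 m (Q.P a b)) (hD : T.IsGenerator {v | v.2 = 0} D) :
    SymmModZ 𝒱 m Q.P D := fun a b => by
  have hz := (zStar (E × (Fin k → ℂ))).inv_mul
  cases hD with
  | smul f =>
    obtain ⟨g, hg⟩ := exists_sub_flipO_eq f
    convert (hJ a b).toStar_mul h𝒱 g using 1
    have hg' := congrArg toStar hg
    rw [map_sub, map_mul, toStar_flipO, toStar_zO] at hg'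
    rw [DistribSMul.toAddMonoidHom_apply, DistribSMul.toAddMonoidHom_apply, Q.smul_left,
      Q.smul_right, ← sub_mul, hg']
    linear_combination (toStar g * Q.P a b) * hz
  | zNabla v hv =>
    obtain ⟨u, s⟩ := v
    obtain rfl : s = 0 := hv
    convert (hJ a b).deriv h𝒱 u using 1
    rw [← Q.flat_base]
    linear_combination (HolGerm.deriv ((0, (u, 0)) : ℂ × (E × (Fin k → ℂ))) (Q.P a b)) * hz
  | zzNabla =>
    convert (hJ a b).deriv_z h𝒱 using 1
    rw [← Q.flat_z]
    linear_combination ((zStar (E × (Fin k → ℂ)) : HolOStar (E × (Fin k → ℂ))) *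
      HolGerm.deriv ((1, 0) : ℂ × (E × (Fin k → ℂ))) (Q.P a b)) * hz

/-- If a section is cyclic for the generators that do not involve derivatives with respect to `s`,
then every operator that commutes modulo `z` with all generators is symmetric modulo `z`: modulo
`z`, it is a polynomial in those generators. -/
lemma symmModZ_of_cyclic (h𝒱 : IsStable 𝒱) (Q : FlatPairing T)
    (hJ : ∀ a b, JetIn 𝒱 m (Q.P a b)) {ζ : H'}
    (hζ : ∀ N : Submodule (HolO (E × (Fin k → ℂ))) H', ζ ∈ N →
      (∀ u : E, ∀ a ∈ N, T.zNabla (u, 0) a ∈ N) → (∀ a ∈ N, T.zzNabla a ∈ N) → N = ⊤)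
    {A : H' →+ H'}
    (hA : ∀ G, T.IsGenerator {v | v.2 = 0} G → CommModZ (E := E × (Fin k → ℂ)) A G) :
    SymmModZ 𝒱 m Q.P A := by
  have hcomp : ∀ G, T.IsGenerator {v | v.2 = 0} G → ∀ D,
      (∀ G, T.IsGenerator {v | v.2 = 0} G → CommModZ (E := E × (Fin k → ℂ)) D G) →
      SymmModZ 𝒱 m Q.P D → (∀ G', T.IsGenerator {v | v.2 = 0} G' →
        CommModZ (E := E × (Fin k → ℂ)) (G.comp D) G') ∧ SymmModZ 𝒱 m Q.P (G.comp D) := by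
    refine fun G hG D hD hDs => ⟨fun G' hG' a => ?_,
      (hG.symmModZ h𝒱 Q hJ).comp Q.isSesquilinear hJ hDs (hD G hG).symm⟩
    have h := add_mem (hG.map_zMul (hD G' hG' a)) (hG.commModZ hG' (D a))
    rwa [map_sub, sub_add_sub_cancel] at h
  -- the sections `D ζ` with `D` symmetric and commuting with all generators, modulo `z`
  let N₀ : Submodule (HolO (E × (Fin k → ℂ))) H' :=
    { carrier := {a | ∃ D : H' →+ H', (∀ G, T.IsGenerator {v | v.2 = 0} G →
        CommModZ (E := E × (Fin k → ℂ)) D G) ∧ SymmModZ 𝒱 m Q.P D ∧ D ζ = a}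
      zero_mem' := ⟨0, fun G _ a => by simp, SymmModZ.zero, rfl⟩
      add_mem' := by
        rintro _ _ ⟨D, hD, hDs, rfl⟩ ⟨D', hD', hDs', rfl⟩
        refine ⟨D + D', fun G hG a => ?_, hDs.add hDs', rfl⟩
        convert add_mem (hD G hG a) (hD' G hG a) using 1
        simp only [AddMonoidHom.add_apply, map_add]
        abel
      smul_mem' := by
        rintro f _ ⟨D, hD, hDs, rfl⟩
        obtain ⟨h1, h2⟩ := hcomp _ (.smul f) D hD hDs
        exact ⟨_, h1, h2, rfl⟩ }
  have hN₀ : N₀ = ⊤ := by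
    refine hζ N₀ ⟨AddMonoidHom.id H', fun G _ a => by simp, SymmModZ.id, rfl⟩ ?_ ?_
    · rintro u _ ⟨D, hD, hDs, rfl⟩
      obtain ⟨h1, h2⟩ := hcomp _ (.zNabla (u, 0) rfl) D hD hDs
      exact ⟨_, h1, h2, rfl⟩
    · rintro _ ⟨D, hD, hDs, rfl⟩
      obtain ⟨h1, h2⟩ := hcomp _ .zzNabla D hD hDs
      exact ⟨_, h1, h2, rfl⟩
  have hAζ : A ζ ∈ N₀ := by rw [hN₀]; trivial
  obtain ⟨D, hD, hDs, hDζ⟩ := hAζ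
  -- `A` and `D` agree on `ζ`, hence everywhere modulo `z`
  have hstep : ∀ G, T.IsGenerator {v | v.2 = 0} G → ∀ a,
      A a - D a ∈ zMul (E × (Fin k → ℂ)) H' → A (G a) - D (G a) ∈ zMul (E × (Fin k → ℂ)) H' := by
    intro G hG a ha
    have h := sub_mem (add_mem (hA G hG a) (hG.map_zMul ha)) (hD G hG a)
    rwa [map_sub, sub_add_sub_cancel, sub_sub_sub_cancel_right] at h
  let N₁ : Submodule (HolO (E × (Fin k → ℂ))) H' :=
    { carrier := {a | A a - D a ∈ zMul (E × (Fin k → ℂ)) H'}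
      zero_mem' := by simp
      add_mem' := fun {a b} ha hb => by
        have h := (zMul (E × (Fin k → ℂ)) H').add_mem ha hb
        rw [sub_add_sub_comm, ← map_add, ← map_add] at h
        exact h
      smul_mem' := fun f a ha => hstep _ (.smul f) a ha }
  have hN₁ : N₁ = ⊤ := by
    refine hζ N₁ ?_ (fun u a ha => hstep _ (.zNabla (u, 0) rfl) a ha)
      fun a ha => hstep _ .zzNabla a ha
    change A ζ - D ζ ∈ zMul (E × (Fin k → ℂ)) H'
    rw [hDζ, sub_self]
    exact zero_mem _
  refine hDs.congr Q.isSesquilinear hJ fun a => ?_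
  change a ∈ N₁
  rw [hN₁]
  trivial

variable {H : Type*} [AddCommGroup H] [Module (HolO E) H]
  [Module.Free (HolO E) H] [Module.Finite (HolO E) H] {T₀ : TEStructure E H}

/-- Under the generation condition, the extension of a pairing to an unfolding takes values in
the same power of `z`: by induction on the order of the derivatives with respect to `s`, since
`z ∂/∂s_j P(a, b) = P(z ∇_j a, b) - P(a, z ∇_j b)` and `z ∇_j` is symmetric modulo `z`. -/
theorem Unfolding.Extends.values {w : ℤ} {V : Unfolding k T₀ H'} {Q : FlatPairing T₀}
    {Q' : FlatPairing V.T'} (h : V.Extends Q Q') (hGC : T₀.GenerationCondition)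
    (hQ : ∀ a b : H, Q.P a b ∈ zPowO E w) (a b : H') :
    Q'.P a b ∈ zPowO (E × (Fin k → ℂ)) w := by
  obtain ⟨ζ, hζ⟩ := V.exists_cyclic hGC
  rw [V.extends_iff] at h
  refine mem_zPowO_of_jetIn fun m => ?_
  have h0 : ∀ a b, restrStar E k (Q'.P a b) ∈ zPowO E w := fun a b => by
    rw [h]; exact hQ _ _
  induction m generalizing a b with
  | zero => exact h0 a b
  | succ m ih =>
    refine ⟨h0 a b, fun j => ?_⟩
    have hA : SymmModZ (zPowO E w) m Q'.P (V.T'.zNabla (sVec E j)) :=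
      symmModZ_of_cyclic (isStable_zPowO w) Q' ih hζ fun G hG =>
        TEStructure.IsGenerator.commModZ (W := Set.univ) (.zNabla _ trivial) (hG.mono
          (Set.subset_univ _))
    convert hA a b using 1
    rw [← Q'.flat_base]
    linear_combination (-(HolGerm.deriv (sDir E j) (Q'.P a b))) *
      (zStar (E × (Fin k → ℂ))).inv_mul

end NoPole

/-! ### Symmetry and nondegeneracy -/

section Symmetry

variable {E : Type*} [NormedAddCommGroup E] [NormedSpace ℂ E]
  {H : Type*} [AddCommGroup H] [Module (HolO E) H]
  [Module.Free (HolO E) H] [Module.Finite (HolO E) H] {T : TEStructure E H}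

/-- The flat pairing `(a, b) ↦ c P(b, a)(-z, t)`, for an integer `c`. -/
def FlatPairing.swap (Q : FlatPairing T) (c : ℤ) : FlatPairing T where
  P := AddMonoidHom.mk' (fun a => AddMonoidHom.mk' (fun b => c • flip (Q.P b a))
      fun b b' => by rw [map_add, AddMonoidHom.add_apply, map_add, smul_add])
    fun a a' => by
      ext b
      simp only [AddMonoidHom.mk'_apply, AddMonoidHom.add_apply, map_add, smul_add]
  smul_left f a b := by
    simp only [AddMonoidHom.mk'_apply, Q.smul_right, map_mul, flip_flip, mul_smul_comm]
  smul_right f a b := by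
    simp only [AddMonoidHom.mk'_apply, Q.smul_left, map_mul, mul_smul_comm]
  flat_base v a b := by
    have h := congrArg flip (Q.flat_base v b a)
    rw [map_mul, map_sub, flip_zStar, ← deriv_flip] at h
    have hc : HolGerm.deriv ((0, v) : ℂ × E) (c • flip (Q.P b a)) =
        c • HolGerm.deriv ((0, v) : ℂ × E) (flip (Q.P b a)) :=
      map_zsmul (AddMonoidHom.mk' (HolGerm.deriv ((0, v) : ℂ × E)) (HolGerm.deriv_add _)) c _
    simp only [AddMonoidHom.mk'_apply]
    rw [hc]
    simp only [zsmul_eq_mul]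
    linear_combination -(c : HolOStar E) * h
  flat_z a b := by
    have h := congrArg flip (Q.flat_z b a)
    have hd := deriv_z_flip (Q.P b a)
    rw [map_mul, map_sub, map_pow, flip_zStar] at h
    have hc : HolGerm.deriv ((1, 0) : ℂ × E) (c • flip (Q.P b a)) =
        c • HolGerm.deriv ((1, 0) : ℂ × E) (flip (Q.P b a)) :=
      map_zsmul (AddMonoidHom.mk' (HolGerm.deriv ((1, 0) : ℂ × E)) (HolGerm.deriv_add _)) c _
    simp only [AddMonoidHom.mk'_apply]
    rw [hc, hd]
    simp only [zsmul_eq_mul]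
    linear_combination -(c : HolOStar E) * h

lemma FlatPairing.swap_apply (Q : FlatPairing T) (c : ℤ) (a b : H) :
    (Q.swap c).P a b = c • flip (Q.P b a) := rfl

/-- Symmetry is the equality of a flat pairing with another one, so that it extends to unfoldings by
uniqueness. -/
theorem Unfolding.Extends.symm {k : ℕ} {H' : Type*} [AddCommGroup H']
    [Module (HolO (E × (Fin k → ℂ))) H'] [Module.Free (HolO (E × (Fin k → ℂ))) H']
    [Module.Finite (HolO (E × (Fin k → ℂ))) H'] {V : Unfolding k T H'} {Q : FlatPairing T}
    {Q' : FlatPairing V.T'} (h : V.Extends Q Q') {c : ℤ}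
    (hQ : ∀ a b, Q.P b a = c • flip (Q.P a b)) (a b : H') : Q'.P b a = c • flip (Q'.P a b) := by
  have hswap : V.Extends Q (Q'.swap c) := by
    rw [V.extends_iff] at h ⊢
    intro a b
    rw [FlatPairing.swap_apply, map_zsmul, restrStar_flip, h, ← hQ]
  rw [← FlatPairing.swap_apply, ← h.unique hswap]

end Symmetry

section Nondegenerate

variable {E : Type*} [NormedAddCommGroup E] [NormedSpace ℂ E]
  {H : Type*} [AddCommGroup H] [Module (HolO E) H]
  {ι : Type*} [Fintype ι] {e : Module.Basis ι (HolO E) H} {S : H →+ H →+ HolOStar E}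
  {w : ℤ} {W : Matrix ι ι (HolO E)}

/-- The values of a sesquilinear pairing in terms of its Gram matrix `z^w W`. -/
lemma IsSesquilinear.apply_basis (hS : IsSesquilinear S)
    (hW : ∀ i j, S (e i) (e j) = ((zStar E ^ w : (HolOStar E)ˣ) : HolOStar E) * toStar (W i j))
    (i : ι) (b : H) : S (e i) b = ((zStar E ^ w : (HolOStar E)ˣ) : HolOStar E) *
      toStar (W.mulVec (fun l => flipO (e.repr b l)) i) := by
  conv_lhs => rw [← e.sum_repr b]
  rw [map_sum, Matrix.mulVec, dotProduct, map_sum, Finset.mul_sum]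
  refine Finset.sum_congr rfl fun j _ => ?_
  rw [hS.smul_right, hW, map_mul, toStar_flipO]
  ring

/-- A section represents the linear form `φ` if and only if its coordinates solve a linear
system. -/
lemma IsSesquilinear.forall_eq_iff (hS : IsSesquilinear S)
    (hW : ∀ i j, S (e i) (e j) = ((zStar E ^ w : (HolOStar E)ˣ) : HolOStar E) * toStar (W i j))
    (φ : H →ₗ[HolO E] HolO E) (b : H) :
    (∀ a, S a b = ((zStar E ^ w : (HolOStar E)ˣ) : HolOStar E) * toStar (φ a)) ↔
      W.mulVec (fun l => flipO (e.repr b l)) = fun i => φ (e i) := by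
  constructor
  · intro h
    funext i
    have h1 := h (e i)
    rw [hS.apply_basis hW] at h1
    exact toStar_injective ((Units.mul_right_inj _).1 h1)
  · intro h a
    have h1 : ∀ i, S (e i) b = ((zStar E ^ w : (HolOStar E)ˣ) : HolOStar E) *
        toStar (φ (e i)) := fun i => by rw [hS.apply_basis hW, h]
    have h2 : S a b = ∑ i, toStar (e.repr a i) * S (e i) b := by
      conv_lhs => rw [← e.sum_repr a]
      rw [map_sum, AddMonoidHom.finsetSum_apply]
      simp only [hS.smul_left]
    have h3 : φ a = ∑ i, e.repr a i * φ (e i) := by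
      conv_lhs => rw [← e.sum_repr a]
      simp only [map_sum, map_smul, smul_eq_mul]
    rw [h2, h3, map_sum, Finset.mul_sum]
    refine Finset.sum_congr rfl fun i _ => ?_
    rw [h1, map_mul]
    ring

lemma IsSesquilinear.existsUnique_of_isUnit_det [DecidableEq ι] (hS : IsSesquilinear S)
    (hW : ∀ i j, S (e i) (e j) = ((zStar E ^ w : (HolOStar E)ˣ) : HolOStar E) * toStar (W i j))
    (hdet : IsUnit W.det) (φ : H →ₗ[HolO E] HolO E) :
    ∃! b : H, ∀ a, S a b = ((zStar E ^ w : (HolOStar E)ˣ) : HolOStar E) * toStar (φ a) := by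
  simp only [hS.forall_eq_iff hW]
  refine ⟨∑ l, flipO (W⁻¹.mulVec (fun i => φ (e i)) l) • e l, ?_, ?_⟩
  · simp only [e.repr_sum_self, flipO_flipO]
    rw [Matrix.mulVec_mulVec, Matrix.mul_nonsing_inv _ hdet, Matrix.one_mulVec]
  · intro b hb
    rw [← hb, Matrix.mulVec_mulVec, Matrix.nonsing_inv_mul _ hdet, Matrix.one_mulVec]
    simp only [flipO_flipO, e.sum_repr]

variable {k : ℕ} [Module.Free (HolO E) H] [Module.Finite (HolO E) H] {T : TEStructure E H}
  {H' : Type*} [AddCommGroup H'] [Module (HolO (E × (Fin k → ℂ))) H']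
  [Module.Free (HolO (E × (Fin k → ℂ))) H'] [Module.Finite (HolO (E × (Fin k → ℂ))) H']

/-- Linear forms restrict to `M × {0}`. -/
lemma Unfolding.exists_linearForm (V : Unfolding k T H')
    (φ : H' →ₗ[HolO (E × (Fin k → ℂ))] HolO (E × (Fin k → ℂ))) :
    ∃ ψ : H →ₗ[HolO E] HolO E, ∀ a, ψ (V.res a) = restr E k (φ a) := by
  have hwd : ∀ a b, V.res a = V.res b → restr E k (φ a) = restr E k (φ b) := by
    intro a b h
    have hsub : a - b ∈ (RingHom.ker (restr E k) • ⊤ :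
        Submodule (HolO (E × (Fin k → ℂ))) H') := by
      rw [← Submodule.Quotient.mk_eq_zero, ← V.i_res, map_sub, h, sub_self, map_zero]
    have hφ : φ (a - b) ∈ RingHom.ker (restr E k) := by
      refine Submodule.smul_induction_on (p := fun x => φ x ∈ RingHom.ker (restr E k)) hsub ?_ ?_
      · intro f hf x _
        rw [map_smul, smul_eq_mul]
        exact Ideal.mul_mem_right _ _ hf
      · intro x y hx hy
        rw [map_add]
        exact add_mem hx hy
    rw [RingHom.mem_ker, map_sub, map_sub] at hφ
    exact sub_eq_zero.1 hφ
  choose s hs using V.res_surjective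
  have hψ : ∀ a, restr E k (φ (s (V.res a))) = restr E k (φ a) := fun a => hwd _ _ (hs _)
  refine ⟨{ toFun := fun x => restr E k (φ (s x)), map_add' := ?_, map_smul' := ?_ }, hψ⟩
  · intro x y
    obtain ⟨a, rfl⟩ := V.res_surjective x
    obtain ⟨b, rfl⟩ := V.res_surjective y
    rw [← map_add V.res, hψ, hψ, hψ, map_add, map_add]
  · intro f x
    obtain ⟨a, rfl⟩ := V.res_surjective x
    obtain ⟨g, rfl⟩ := restr_surjective (k := k) f
    rw [← V.res_smul, hψ, hψ, map_smul, smul_eq_mul, map_mul]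
    rfl

/-- Nondegeneracy of a pairing with values in `z^w 𝒪` is inherited from its restriction: it says
that the determinant of the Gram matrix does not vanish at the origin. -/
theorem Unfolding.Extends.nondegenerate {V : Unfolding k T H'} {Q : FlatPairing T}
    {Q' : FlatPairing V.T'} (h : V.Extends Q Q') (hQ : Q.IsTEP w)
    (hQ' : ∀ a b : H', Q'.P a b ∈ zPowO (E × (Fin k → ℂ)) w)
    (φ : H' →ₗ[HolO (E × (Fin k → ℂ))] HolO (E × (Fin k → ℂ))) :
    ∃! b : H', ∀ a : H', Q'.P a b = ((zStar (E × (Fin k → ℂ)) ^ w :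
      (HolOStar (E × (Fin k → ℂ)))ˣ) : HolOStar (E × (Fin k → ℂ))) * toStar (φ a) := by
  classical
  rw [V.extends_iff] at h
  let e := Module.Free.chooseBasis (HolO (E × (Fin k → ℂ))) H'
  choose W hW using fun i j => hQ' (e i) (e j)
  let W' : Matrix _ _ (HolO (E × (Fin k → ℂ))) := Matrix.of W
  have hW' : ∀ i j, Q'.P (e i) (e j) = ((zStar (E × (Fin k → ℂ)) ^ w :
      (HolOStar (E × (Fin k → ℂ)))ˣ) : HolOStar (E × (Fin k → ℂ))) * toStar (W' i j) := hW
  refine Q'.isSesquilinear.existsUnique_of_isUnit_det hW' ?_ φ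
  -- sections `b j` that represent the coordinate forms after restriction to `M × {0}`
  have hb : ∀ j, ∃ b : H', ∀ i, restr E k (W'.mulVec (fun l => flipO (e.repr b l)) i) =
      restr E k (e.coord j (e i)) := by
    intro j
    obtain ⟨ψ, hψ⟩ := V.exists_linearForm (e.coord j)
    obtain ⟨x, hx, -⟩ := hQ.nondegenerate ψ
    obtain ⟨b, rfl⟩ := V.res_surjective x
    refine ⟨b, fun i => ?_⟩
    have h1 := hx (V.res (e i))
    rw [← h, Q'.isSesquilinear.apply_basis hW', map_mul, restrStar_zStar_zpow, restrStar_toStar,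
      hψ] at h1
    exact toStar_injective ((Units.mul_right_inj _).1 h1)
  choose b hb using hb
  let F : Matrix _ _ (HolO (E × (Fin k → ℂ))) := Matrix.of fun l j => flipO (e.repr (b j) l)
  have hWF : (restr E k).mapMatrix (W' * F) = 1 := by
    refine Matrix.ext fun i j => (hb j i).trans ?_
    rw [Module.Basis.coord_apply, Module.Basis.repr_self, Finsupp.single_apply, Matrix.one_apply]
    split_ifs <;> simp
  have hunit : IsUnit (W' * F).det := by
    refine isUnit_of_notMem_vanishingIdeal fun hmem => ?_
    rw [← restr_mem_vanishingIdeal_iff, RingHom.map_det, hWF, Matrix.det_one] at hmem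
    exact one_ne_zero (α := ℂ) hmem
  rw [Matrix.det_mul] at hunit
  exact isUnit_of_mul_isUnit_left hunit

end Nondegenerate

end TEP

end

theorem lemma3p2 {E : Type*} [NormedAddCommGroup E] [NormedSpace ℂ E] [FiniteDimensional ℂ E]
    {H : Type*} [AddCommGroup H] [Module (TEP.HolO E) H]
    [Module.Free (TEP.HolO E) H] [Module.Finite (TEP.HolO E) H]
    (w : ℤ) (T : TEP.TEStructure E H) (Q : TEP.FlatPairing T) (hQ : Q.IsTEP w)
    (hGC : T.GenerationCondition)
    (k : ℕ) {H' : Type*} [AddCommGroup H'] [Module (TEP.HolO (E × (Fin k → ℂ))) H']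
    [Module.Free (TEP.HolO (E × (Fin k → ℂ))) H'] [Module.Finite (TEP.HolO (E × (Fin k → ℂ))) H']
    (V : TEP.Unfolding k T H') :
    (∃! Q' : TEP.FlatPairing V.T', V.Extends Q Q') ∧
      ∀ Q' : TEP.FlatPairing V.T', V.Extends Q Q' → Q'.IsTEP w := by
  obtain ⟨Q₀, h₀⟩ := V.exists_extends Q
  refine ⟨⟨Q₀, h₀, fun Q' h => h.unique h₀⟩, fun Q' h => ?_⟩
  have hvalues := h.values hGC hQ.values
  exact ⟨h.symm hQ.symm, hvalues, h.nondegenerate hQ hvalues⟩
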